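/- **Setting.** A seller offers $n$ items, partially ordered by a relation $\preceq$ of width $k$ (the largest antichain has $k$ elements), to one buyer. There are $m$ buyer types; type $j$ occurs with probability $w_j\ge 0$, $\sum_j w_j=1$, and has a valuation $v_j:2^{[n]}\to\mathbb R_{\ge 0}$ with $v_j(\emptyset)=0$ that is monotone under inclusion and satisfies $v_j(S\cup\{i,i'\})=v_j(S\cup\{i'\})$ for all $S\subseteq[n]$ and all $i\preceq i'$ (an item dominated by another item of the bundle adds no value); apart from this the valuations are arbitrary combinatorial functions. For some $H$, every value $v_j(S)$ is either $0$ or lies in $[1,H]$, and $v_j([n])\ge 1$ for every $j$. (The setting in which the items are partitioned into $k$ totally ordered categories and the value of a bundle depends only on its best item in each category is the special case where $\preceq$ is a disjoint union of $k$ chains.) An item pricing is a vector $p\in\mathbb R_{\ge 0}^n$; a bundle $S$ costs $p(S)=\sum_{i\in S}p_i$. Type $j$ buys a bundle maximizing $v_j(S)-p(S)$ over all $S\subseteq[n]$ (including $\emptyset$), ties being broken in favour of the largest payment $p(S)$. The revenue $\mathrm{Rev}(p)$ is the expected payment $\sum_j w_j\,p(S_j)$. **Input and model of computation.** The input consists of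 $n$, $k$, $m$, the relation $\preceq$ as an $n\times n$ table, a real $\varepsilon>0$, the probabilities $w_j$, and for each type $j$ the table of values $v_j(\{x_0,\dots,x_{k-1}\})$ over all $(x_0,\dots,x_{k-1})\in[n]^k$ (so all nonempty bundles of size at most $k$). The bound $H$ is not part of the input. Running time is the number of elementary operations of a real random access machine at unit cost: it stores natural numbers and real numbers in finitely many arrays addressed by computed natural numbers; it may add, subtract (truncated at $0$) and compare natural numbers, add, subtract, multiply, divide and compare real numbers, and convert a natural number to a real one (but not round a real number to an integer); its only constants are natural numbers. **Theorem.** There are a single program, a polynomial $A$ in three variables and a polynomial $B$ in two variables such that, on every input as above, for every admissible $H$ and every $\varepsilon>0$, the program halts within $$A\bigl(m,\; n^{B(k,1/\varepsilon)},\; \log H\bigr)$$ steps and outputs an item pricing $p\in\mathbb R_{\ge0}^n$ that is a $(1+\varepsilon)$-approximation to the optimal item pricing: $\mathrm{Rev}(q)\le(1+\varepsilon)\,\mathrm{Rev}(p)$ for every item pricing $q\in\mathbb R_{\ge 0}^n$. -/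

import Mathlib

namespace OrderedPricing

/-! ### Buyers, item pricings and revenue -/

/-- The price of a bundle under an item pricing. -/
def bundlePrice {n : ℕ} (p : Fin n → ℝ) (S : Finset (Fin n)) : ℝ := ∑ i ∈ S, p i

/-- The bundles that maximize the utility of a buyer with valuation `v` under item prices `p`. -/
noncomputable def demand {n : ℕ} (v : Finset (Fin n) → ℝ) (p : Fin n → ℝ) :
    Finset (Finset (Fin n)) :=
  open Classical in
  Finset.univ.filter fun S => ∀ T, v T - bundlePrice p T ≤ v S - bundlePrice p S

theorem demand_nonempty {n : ℕ} (v : Finset (Fin n) → ℝ) (p : Fin n → ℝ) :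
    (demand v p).Nonempty := by
  obtain ⟨S, hS⟩ := Finite.exists_max fun S : Finset (Fin n) => v S - bundlePrice p S
  exact ⟨S, by simpa [demand] using hS⟩

/-- The payment of a buyer: she buys a utility-maximizing bundle, and among these the seller
picks a most expensive one. -/
noncomputable def payment {n : ℕ} (v : Finset (Fin n) → ℝ) (p : Fin n → ℝ) : ℝ :=
  (demand v p).sup' (demand_nonempty v p) (bundlePrice p)

/-- Expected revenue of an item pricing when type `j` has valuation `v j` and probability
`w j`. -/
noncomputable def revenue {n m : ℕ} (v : Fin m → Finset (Fin n) → ℝ) (w : Fin m → ℝ)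
    (p : Fin n → ℝ) : ℝ :=
  ∑ j, w j * payment (v j) p

/-- The width of a relation: the largest size of an antichain. -/
noncomputable def width {n : ℕ} (r : Fin n → Fin n → Prop) : ℕ :=
  open Classical in
  (Finset.univ.filter fun S : Finset (Fin n) => IsAntichain r (S : Set (Fin n))).sup Finset.card

/-- An explicitly given distribution over `m` buyer types with values over `n` items, and a
relation on the items (`rel i j` means that `j` dominates `i`). -/
structure Market (n m : ℕ) where
  rel : Fin n → Fin n → Prop
  val : Fin m → Finset (Fin n) → ℝ
  prob : Fin m → ℝ

/-- The standing assumptions on a market: items are partially ordered with width `k`, `prob` is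
a probability distribution, every type has a normalized monotone valuation for which dominated
items may be discarded, every value is `0` or lies in `[1, H]`, and no type is trivial. -/
structure Market.Valid {n m : ℕ} (M : Market n m) (k : ℕ) (H : ℝ) : Prop where
  refl : ∀ i, M.rel i i
  trans : ∀ i j l, M.rel i j → M.rel j l → M.rel i l
  antisymm : ∀ i j, M.rel i j → M.rel j i → i = j
  width_eq : width M.rel = k
  prob_nonneg : ∀ j, 0 ≤ M.prob j
  prob_sum : ∑ j, M.prob j = 1
  empty : ∀ j, M.val j ∅ = 0
  mono : ∀ j, Monotone (M.val j)
  discard : ∀ j i i', M.rel i i' → ∀ S : Finset (Fin n), M.val j (S ∪ {i, i'}) = M.val j (S ∪ {i'})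
  range : ∀ j S, M.val j S = 0 ∨ (1 ≤ M.val j S ∧ M.val j S ≤ H)
  nontrivial : ∀ j, 1 ≤ M.val j Finset.univ

/-! ### Real random access machine programs

The memory consists of arrays of natural numbers and arrays of real numbers. A program names
finitely many arrays; each has a cell for every natural number and cells are addressed by
computed naturals. Naturals can be added, subtracted (truncated at zero) and compared; reals can
be added, subtracted, multiplied, divided and compared; a natural can be converted to a real but
not conversely. The only constants are natural numbers. Every elementary operation costs one
step. -/

/-- Memory contents: `nat a i` is cell `i` of the `a`-th array of naturals, and similarly for
`real`. -/
structure Memory where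
  nat : ℕ → ℕ → ℕ
  real : ℕ → ℕ → ℝ

/-- Expressions with natural values; `get a e` reads cell `e` of array `a`. -/
inductive NExp : Type
  | const (c : ℕ)
  | get (a : ℕ) (e : NExp)
  | add (e₁ e₂ : NExp)
  | sub (e₁ e₂ : NExp)

/-- Expressions with real values. -/
inductive RExp : Type
  | ofNat (e : NExp)
  | get (a : ℕ) (e : NExp)
  | add (e₁ e₂ : RExp)
  | sub (e₁ e₂ : RExp)
  | mul (e₁ e₂ : RExp)
  | div (e₁ e₂ : RExp)

/-- Tests. -/
inductive BExp : Type
  | leN (e₁ e₂ : NExp)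
  | leR (e₁ e₂ : RExp)
  | not (b : BExp)
  | and (b₁ b₂ : BExp)

/-- Programs; `setN a i e` stores the value of `e` in cell `i` of the natural array `a`. -/
inductive Prog : Type
  | skip
  | setN (a : ℕ) (i e : NExp)
  | setR (a : ℕ) (i : NExp) (e : RExp)
  | seq (P Q : Prog)
  | ite (b : BExp) (P Q : Prog)
  | loop (b : BExp) (P : Prog)

def NExp.eval (s : Memory) : NExp → ℕ
  | .const c => c
  | .get a e => s.nat a (e.eval s)
  | .add e₁ e₂ => e₁.eval s + e₂.eval s
  | .sub e₁ e₂ => e₁.eval s - e₂.eval s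

/-- The number of operations in an expression. -/
def NExp.cost : NExp → ℕ
  | .const _ => 1
  | .get _ e => e.cost + 1
  | .add e₁ e₂ => e₁.cost + e₂.cost + 1
  | .sub e₁ e₂ => e₁.cost + e₂.cost + 1

noncomputable def RExp.eval (s : Memory) : RExp → ℝ
  | .ofNat e => (e.eval s : ℝ)
  | .get a e => s.real a (e.eval s)
  | .add e₁ e₂ => e₁.eval s + e₂.eval s
  | .sub e₁ e₂ => e₁.eval s - e₂.eval s
  | .mul e₁ e₂ => e₁.eval s * e₂.eval s
  | .div e₁ e₂ => e₁.eval s / e₂.eval s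

def RExp.cost : RExp → ℕ
  | .ofNat e => e.cost + 1
  | .get _ e => e.cost + 1
  | .add e₁ e₂ => e₁.cost + e₂.cost + 1
  | .sub e₁ e₂ => e₁.cost + e₂.cost + 1
  | .mul e₁ e₂ => e₁.cost + e₂.cost + 1
  | .div e₁ e₂ => e₁.cost + e₂.cost + 1

def BExp.Holds (s : Memory) : BExp → Prop
  | .leN e₁ e₂ => e₁.eval s ≤ e₂.eval s
  | .leR e₁ e₂ => e₁.eval s ≤ e₂.eval s
  | .not b => ¬ b.Holds s
  | .and b₁ b₂ => b₁.Holds s ∧ b₂.Holds s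

def BExp.cost : BExp → ℕ
  | .leN e₁ e₂ => e₁.cost + e₂.cost + 1
  | .leR e₁ e₂ => e₁.cost + e₂.cost + 1
  | .not b => b.cost + 1
  | .and b₁ b₂ => b₁.cost + b₂.cost + 1

/-- Overwrite one cell of a natural array. -/
def Memory.setNat (s : Memory) (a i x : ℕ) : Memory :=
  { s with nat := Function.update s.nat a (Function.update (s.nat a) i x) }

/-- Overwrite one cell of a real array. -/
noncomputable def Memory.setReal (s : Memory) (a i : ℕ) (x : ℝ) : Memory :=
  { s with real := Function.update s.real a (Function.update (s.real a) i x) }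

/-- `Runs P s s' t`: started on memory `s`, the program `P` halts with memory `s'` after exactly
`t` steps. -/
inductive Runs : Prog → Memory → Memory → ℕ → Prop
  | skip (s : Memory) : Runs .skip s s 1
  | setN (a : ℕ) (i e : NExp) (s : Memory) :
      Runs (.setN a i e) s (s.setNat a (i.eval s) (e.eval s)) (i.cost + e.cost + 1)
  | setR (a : ℕ) (i : NExp) (e : RExp) (s : Memory) :
      Runs (.setR a i e) s (s.setReal a (i.eval s) (e.eval s)) (i.cost + e.cost + 1)
  | seq {P Q : Prog} {s s' s'' : Memory} {t t' : ℕ} :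
      Runs P s s' t → Runs Q s' s'' t' → Runs (.seq P Q) s s'' (t + t')
  | ite_true {b : BExp} {P Q : Prog} {s s' : Memory} {t : ℕ} :
      b.Holds s → Runs P s s' t → Runs (.ite b P Q) s s' (b.cost + t)
  | ite_false {b : BExp} {P Q : Prog} {s s' : Memory} {t : ℕ} :
      ¬ b.Holds s → Runs Q s s' t → Runs (.ite b P Q) s s' (b.cost + t)
  | loop_done {b : BExp} {P : Prog} {s : Memory} :
      ¬ b.Holds s → Runs (.loop b P) s s b.cost
  | loop_step {b : BExp} {P : Prog} {s s' s'' : Memory} {t t' : ℕ} :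
      b.Holds s → Runs P s s' t → Runs (.loop b P) s' s'' t' →
        Runs (.loop b P) s s'' (b.cost + t + t')

/-! ### Input and output conventions -/

/-- The bundle `{x₀, …, x_{k-1}}` whose (possibly repeated) members are the base-`n` digits of
the code `c = ∑ l, x_l * n ^ l`. Every nonempty bundle of size at most `k` has a code. -/
def codedBundle {n k : ℕ} (c : Fin (n ^ k)) : Finset (Fin n) :=
  Finset.univ.image (finFunctionFinEquiv.symm c)

/-- The input memory. Cells `0, 1, 2` of natural array `0` hold `n, k, m`; cell `i * n + j` of
natural array `1` tells whether `j` dominates `i`. Cell `0` of real array `0` holds `ε`; real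
array `1` holds the probabilities; cell `j * n ^ k + c` of real array `2` holds the value of type
`j` for the bundle with code `c`. All other cells are zero. -/
noncomputable def inputMemory {n m : ℕ} (M : Market n m) (k : ℕ) (ε : ℝ) : Memory where
  nat := open Classical in fun a x =>
    if a = 0 then
      if x = 0 then n else if x = 1 then k else if x = 2 then m else 0
    else if a = 1 then
      if h : x < n * n then
        let y := finProdFinEquiv.symm (⟨x, h⟩ : Fin (n * n))
        if M.rel y.1 y.2 then 1 else 0
      else 0
    else 0
  real := fun a x =>
    if a = 0 then
      if x = 0 then ε else 0
    else if a = 1 then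
      if h : x < m then M.prob ⟨x, h⟩ else 0
    else if a = 2 then
      if h : x < m * n ^ k then
        let y := finProdFinEquiv.symm (⟨x, h⟩ : Fin (m * n ^ k))
        M.val y.1 (codedBundle y.2)
      else 0
    else 0

/-- The item prices computed by a program: cells `0, …, n - 1` of real array `3`. -/
def outputPrices (n : ℕ) (s : Memory) : Fin n → ℝ := fun i => s.real 3 i

end OrderedPricing

/-!
The scheme is a dynamic program over prices, based on three observations.

*Discounts protect revenue.* If prices are perturbed slightly and then discounted by a factor
`1 - δ`, the discount on an expensive bundle exceeds that on a cheap one, so that a type never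
switches to a bundle that is cheaper by more than a factor about `1 - δ`
(`payment_of_favourite`, `Favourite.price_ge`). Hence prices may be rounded to powers of
`1 + δ ^ 2`, and items whose prices are smaller than a payment by a large factor may be regarded
as free.

*Far apart price ranges decouple.* Cut the price axis into blocks of `L = 1 / δ` zones, each zone
spanning a large ratio `zone k L`. In a block, a type is imagined to choose among the items priced
in or below the block, the latter being free. Her payment is credited to the block if it lies above
the lowest zone. A price vector then earns almost the sum of all credits
(`Good.extend`): a type pays about the highest payment credited on her behalf, the lower ones being
negligible against it, and items above the block can only raise what she pays. Conversely, given
optimal prices, a payment is credited unless it falls into the lowest zone of a block; there are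
`L` ways to place the block boundaries, and only one of them is bad for a given payment
(`sum_counted_ge`). Payments below all blocks are negligible, since constant prices `1 / k` already
earn `1 / k` (`Market.Valid.payment_const`).

*Few states.* Prices may be taken to be monotone along the partial order
(`Market.Valid.exists_monotone_prices`). The items priced below a threshold then form a down-set,
which is generated by at most `k` items and so has one of `n ^ k + 1` codes. The only information
passed from one block to the next is the down-set of items priced below it; a block is described by
one down-set for each of its price levels, that is by a number `e` with `blockLen k L + 1` digits to
the base `n ^ k + 1`. The dynamic program tries all of them; `Inv` is its invariant. All `L`
placements are treated simultaneously, a block starting at every zone. The number of zones is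
logarithmic in the largest value (`zone_count`).

The running time is controlled syntactically: `Prog.bound` bounds the time of a program if each
loop makes at most `Y` iterations, and is polynomial in `Y`. It therefore suffices to prove, with
the rules for `Ends`, that the program is correct and that no loop exceeds `iterations` many
rounds. Markets with one item are solved exactly by trying the values as prices.
-/

namespace OrderedPricing

/-! ### A program logic with running times -/

/-- The natural arrays that a program may write to. -/
def Prog.natWrites : Prog → List ℕ
  | .skip => []
  | .setN a _ _ => [a]
  | .setR _ _ _ => []
  | .seq P Q => P.natWrites ++ Q.natWrites
  | .ite _ P Q => P.natWrites ++ Q.natWrites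
  | .loop _ P => P.natWrites

/-- The real arrays that a program may write to. -/
def Prog.realWrites : Prog → List ℕ
  | .skip => []
  | .setN _ _ _ => []
  | .setR a _ _ => [a]
  | .seq P Q => P.realWrites ++ Q.realWrites
  | .ite _ P Q => P.realWrites ++ Q.realWrites
  | .loop _ P => P.realWrites

/-- An upper bound for the running time if each execution of a loop makes at most `Y`
iterations. -/
def Prog.bound (Y : ℕ) : Prog → ℕ
  | .skip => 1
  | .setN _ i e => i.cost + e.cost + 1
  | .setR _ i e => i.cost + e.cost + 1
  | .seq P Q => P.bound Y + Q.bound Y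
  | .ite b P Q => b.cost + (P.bound Y + Q.bound Y)
  | .loop b P => (Y + 1) * (b.cost + P.bound Y)

/-- For a fixed program the time bound is polynomial in the bound on the numbers of
iterations, of degree the nesting depth of the loops. -/
theorem Prog.bound_le_poly (P : Prog) : ∃ C d : ℕ, ∀ Y, P.bound Y ≤ C * (Y + 1) ^ d := by
  induction P with
  | skip => exact ⟨1, 0, fun Y => by simp [Prog.bound]⟩
  | setN a i e => exact ⟨i.cost + e.cost + 1, 0, fun Y => by simp [Prog.bound]⟩
  | setR a i e => exact ⟨i.cost + e.cost + 1, 0, fun Y => by simp [Prog.bound]⟩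
  | seq P Q hP hQ =>
    obtain ⟨C, d, h⟩ := hP
    obtain ⟨C', d', h'⟩ := hQ
    refine ⟨C + C', d + d', fun Y => ?_⟩
    have h1 : (Y + 1) ^ d ≤ (Y + 1) ^ (d + d') := Nat.pow_le_pow_right (by omega) (by omega)
    have h2 : (Y + 1) ^ d' ≤ (Y + 1) ^ (d + d') := Nat.pow_le_pow_right (by omega) (by omega)
    calc P.bound Y + Q.bound Y ≤ C * (Y + 1) ^ (d + d') + C' * (Y + 1) ^ (d + d') :=
          add_le_add ((h Y).trans (Nat.mul_le_mul_left _ h1))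
            ((h' Y).trans (Nat.mul_le_mul_left _ h2))
      _ = _ := by ring
  | ite b P Q hP hQ =>
    obtain ⟨C, d, h⟩ := hP
    obtain ⟨C', d', h'⟩ := hQ
    refine ⟨b.cost + (C + C'), d + d', fun Y => ?_⟩
    have h0 : 1 ≤ (Y + 1) ^ (d + d') := Nat.one_le_pow _ _ (by omega)
    have h1 : (Y + 1) ^ d ≤ (Y + 1) ^ (d + d') := Nat.pow_le_pow_right (by omega) (by omega)
    have h2 : (Y + 1) ^ d' ≤ (Y + 1) ^ (d + d') := Nat.pow_le_pow_right (by omega) (by omega)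
    calc b.cost + (P.bound Y + Q.bound Y)
        ≤ b.cost * (Y + 1) ^ (d + d') + (C * (Y + 1) ^ (d + d') + C' * (Y + 1) ^ (d + d')) :=
          add_le_add (Nat.le_mul_of_pos_right _ h0)
            (add_le_add ((h Y).trans (Nat.mul_le_mul_left _ h1))
              ((h' Y).trans (Nat.mul_le_mul_left _ h2)))
      _ = _ := by ring
  | loop b P hP =>
    obtain ⟨C, d, h⟩ := hP
    refine ⟨b.cost + C, d + 1, fun Y => ?_⟩
    have h0 : 1 ≤ (Y + 1) ^ d := Nat.one_le_pow _ _ (by omega)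
    calc (Y + 1) * (b.cost + P.bound Y) ≤ (Y + 1) * (b.cost * (Y + 1) ^ d + C * (Y + 1) ^ d) :=
          Nat.mul_le_mul_left _ (add_le_add (Nat.le_mul_of_pos_right _ h0) (h Y))
      _ = _ := by ring

/-- The memories `s` and `s'` agree on all arrays that `P` does not write to. -/
structure SameOff (P : Prog) (s s' : Memory) : Prop where
  nat : ∀ a, a ∉ P.natWrites → s'.nat a = s.nat a
  real : ∀ a, a ∉ P.realWrites → s'.real a = s.real a

theorem SameOff.rfl' (P : Prog) (s : Memory) : SameOff P s s := ⟨fun _ _ => rfl, fun _ _ => rfl⟩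

theorem SameOff.trans {P : Prog} {s s' s'' : Memory} (h : SameOff P s s')
    (h' : SameOff P s' s'') : SameOff P s s'' :=
  ⟨fun a ha => (h'.nat a ha).trans (h.nat a ha), fun a ha => (h'.real a ha).trans (h.real a ha)⟩

theorem SameOff.mono {P Q : Prog} {s s' : Memory} (h : SameOff P s s')
    (hn : P.natWrites ⊆ Q.natWrites) (hr : P.realWrites ⊆ Q.realWrites) : SameOff Q s s' :=
  ⟨fun a ha => h.nat a fun h' => ha (hn h'), fun a ha => h.real a fun h' => ha (hr h')⟩

theorem Runs.sameOff {P : Prog} {s s' : Memory} {t : ℕ} (h : Runs P s s' t) :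
    SameOff P s s' := by
  induction h with
  | skip s => exact SameOff.rfl' _ _
  | setN a i e s =>
    exact ⟨fun b hb => Function.update_of_ne (by simpa [Prog.natWrites] using hb) _ _,
      fun _ _ => rfl⟩
  | setR a i e s =>
    exact ⟨fun _ _ => rfl,
      fun b hb => Function.update_of_ne (by simpa [Prog.realWrites] using hb) _ _⟩
  | seq _ _ h h' =>
    exact (h.mono (by simp [Prog.natWrites]) (by simp [Prog.realWrites])).trans
      (h'.mono (by simp [Prog.natWrites]) (by simp [Prog.realWrites]))
  | ite_true _ _ h => exact h.mono (by simp [Prog.natWrites]) (by simp [Prog.realWrites])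
  | ite_false _ _ h => exact h.mono (by simp [Prog.natWrites]) (by simp [Prog.realWrites])
  | loop_done _ => exact SameOff.rfl' _ _
  | loop_step _ _ _ h h' => exact SameOff.trans ⟨h.nat, h.real⟩ h'

/-- Started on `s`, the program `P` halts within the time allowed by at most `Y` iterations per
loop, in a memory that satisfies `Q` and agrees with `s` off the arrays written to. -/
def Ends (Y : ℕ) (P : Prog) (s : Memory) (Q : Memory → Prop) : Prop :=
  ∃ s' t, Runs P s s' t ∧ t ≤ P.bound Y ∧ SameOff P s s' ∧ Q s'

namespace Ends

variable {Y : ℕ} {P R : Prog} {s : Memory} {Q Q' : Memory → Prop}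

theorem mono (h : Ends Y P s Q) (hQ : ∀ s', SameOff P s s' → Q s' → Q' s') : Ends Y P s Q' := by
  obtain ⟨s', t, h1, h2, h3, h4⟩ := h
  exact ⟨s', t, h1, h2, h3, hQ s' h3 h4⟩

theorem skip (h : Q s) : Ends Y .skip s Q := ⟨s, 1, .skip s, le_rfl, SameOff.rfl' _ _, h⟩

theorem setN {a : ℕ} {i e : NExp} (h : Q (s.setNat a (i.eval s) (e.eval s))) :
    Ends Y (.setN a i e) s Q :=
  ⟨_, _, .setN a i e s, le_rfl, (Runs.setN a i e s).sameOff, h⟩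

theorem setR {a : ℕ} {i : NExp} {e : RExp} (h : Q (s.setReal a (i.eval s) (e.eval s))) :
    Ends Y (.setR a i e) s Q :=
  ⟨_, _, .setR a i e s, le_rfl, (Runs.setR a i e s).sameOff, h⟩

theorem seq (h : Ends Y P s fun s' => SameOff P s s' → Ends Y R s' Q) :
    Ends Y (.seq P R) s Q := by
  obtain ⟨s', t, h1, h2, h3, h4⟩ := h
  obtain ⟨s'', t', h1', h2', _, h4'⟩ := h4 h3
  exact ⟨s'', _, .seq h1 h1', add_le_add h2 h2', (Runs.seq h1 h1').sameOff, h4'⟩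

theorem ite {b : BExp} (h : b.Holds s → Ends Y P s Q) (h' : ¬ b.Holds s → Ends Y R s Q) :
    Ends Y (.ite b P R) s Q := by
  by_cases hb : b.Holds s
  · obtain ⟨s', t, h1, h2, _, h4⟩ := h hb
    have h5 := Runs.ite_true (Q := R) hb h1
    exact ⟨s', _, h5, by simp only [Prog.bound]; omega, h5.sameOff, h4⟩
  · obtain ⟨s', t, h1, h2, _, h4⟩ := h' hb
    have h5 := Runs.ite_false (P := P) hb h1
    exact ⟨s', _, h5, by simp only [Prog.bound]; omega, h5.sameOff, h4⟩

/-- The rule for loops: `I i` is an invariant that may refer to the number `i` of iterations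
made so far. -/
theorem loop {b : BExp} (I : ℕ → Memory → Prop) (h0 : I 0 s)
    (hstep : ∀ i s', SameOff P s s' → I i s' → b.Holds s' → i < Y ∧ Ends Y P s' (I (i + 1)))
    (hend : ∀ i s', SameOff P s s' → I i s' → ¬ b.Holds s' → Q s') :
    Ends Y (.loop b P) s Q := by
  have key : ∀ d i s', i + d = Y → SameOff P s s' → I i s' →
      ∃ s'' t, Runs (.loop b P) s' s'' t ∧ t ≤ (d + 1) * (b.cost + P.bound Y) ∧ Q s'' := by
    intro d
    induction d with
    | zero =>
      intro i s' hi hs hI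
      by_cases hb : b.Holds s'
      · have := (hstep i s' hs hI hb).1
        omega
      · exact ⟨s', _, .loop_done hb, by omega, hend i s' hs hI hb⟩
    | succ d ih =>
      intro i s' hi hs hI
      by_cases hb : b.Holds s'
      · obtain ⟨s1, t1, h1, h2, h3, h4⟩ := (hstep i s' hs hI hb).2
        obtain ⟨s2, t2, g1, g2, g3⟩ := ih (i + 1) s1 (by omega) (hs.trans h3) h4
        refine ⟨s2, _, .loop_step hb h1 g1, ?_, g3⟩
        have : (d + 1 + 1) * (b.cost + P.bound Y)
          = (d + 1) * (b.cost + P.bound Y) + (b.cost + P.bound Y) := by ring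
        omega
      · exact ⟨s', _, .loop_done hb, by nlinarith, hend i s' hs hI hb⟩
  obtain ⟨s'', t, h1, h2, h3⟩ := key Y 0 s (by omega) (SameOff.rfl' _ _) h0
  exact ⟨s'', t, h1, h2, h1.sameOff, h3⟩

end Ends

/-- The arrays that a natural expression reads. -/
def NExp.reads : NExp → List ℕ
  | .const _ => []
  | .get a e => a :: e.reads
  | .add e₁ e₂ => e₁.reads ++ e₂.reads
  | .sub e₁ e₂ => e₁.reads ++ e₂.reads

theorem NExp.eval_congr {s s' : Memory} (e : NExp) (h : ∀ a ∈ e.reads, s'.nat a = s.nat a) :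
    e.eval s' = e.eval s := by
  induction e with
  | const c => rfl
  | get a e ih =>
    simp only [NExp.reads, List.mem_cons, forall_eq_or_imp] at h
    simp only [NExp.eval, ih h.2, h.1]
  | add e₁ e₂ ih₁ ih₂ =>
    simp only [NExp.reads, List.mem_append] at h
    simp only [NExp.eval, ih₁ fun a ha => h a (.inl ha), ih₂ fun a ha => h a (.inr ha)]
  | sub e₁ e₂ ih₁ ih₂ =>
    simp only [NExp.reads, List.mem_append] at h
    simp only [NExp.eval, ih₁ fun a ha => h a (.inl ha), ih₂ fun a ha => h a (.inr ha)]

attribute [simp] NExp.eval RExp.eval BExp.Holds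

section Memory

variable (s : Memory) (a b i x : ℕ) (y : ℝ)

@[simp] theorem setNat_nat_self :
    (s.setNat a i x).nat a = Function.update (s.nat a) i x := by simp [Memory.setNat]

@[simp] theorem setNat_nat_of_ne {a b : ℕ} (h : b ≠ a) : (s.setNat a i x).nat b = s.nat b := by
  simp [Memory.setNat, h]

@[simp] theorem setNat_real : (s.setNat a i x).real = s.real := rfl

@[simp] theorem setReal_real_self :
    (s.setReal a i y).real a = Function.update (s.real a) i y := by simp [Memory.setReal]

@[simp] theorem setReal_real_of_ne {a b : ℕ} (h : b ≠ a) :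
    (s.setReal a i y).real b = s.real b := by
  simp [Memory.setReal, h]

@[simp] theorem setReal_nat : (s.setReal a i y).nat = s.nat := rfl

end Memory

/-- The natural scalar variable `a`, kept in cell `0` of the natural array `a`. -/
abbrev nvar (a : ℕ) : NExp := .get a (.const 0)

/-- The real scalar variable `a`, kept in cell `0` of the real array `a`. -/
abbrev rvar (a : ℕ) : RExp := .get a (.const 0)

/-- Assignment to a natural scalar variable. -/
abbrev Prog.letN (a : ℕ) (e : NExp) : Prog := .setN a (.const 0) e

/-- Assignment to a real scalar variable. -/
abbrev Prog.letR (a : ℕ) (e : RExp) : Prog := .setR a (.const 0) e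

/-- Run `P` with the scalar variable `a` taking the values `0, …, e - 1`. -/
def Prog.for (a : ℕ) (e : NExp) (P : Prog) : Prog :=
  .seq (.letN a (.const 0))
    (.loop (.not (.leN e (nvar a))) (.seq P (.letN a (.add (nvar a) (.const 1)))))

/-- The rule for counting loops. The bound `e` is evaluated anew before each iteration, so it must
not depend on what the loop writes. The invariant `I i` holds when the counter is `i`. -/
theorem Ends.for {Y a B : ℕ} {e : NExp} {P : Prog} {s : Memory} {Q : Memory → Prop}
    (I : ℕ → Memory → Prop) (ha : a ∉ P.natWrites) (ha' : a ∉ e.reads)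
    (he : ∀ b ∈ e.reads, b ∉ P.natWrites) (hB : e.eval s = B) (hY : B ≤ Y)
    (h0 : I 0 (s.setNat a 0 0))
    (hstep : ∀ i s', i < B → SameOff (.for a e P) s s' → s'.nat a 0 = i → I i s' →
      Ends Y P s' fun s'' => SameOff P s' s'' → I (i + 1) (s''.setNat a 0 (i + 1)))
    (hend : ∀ s', SameOff (.for a e P) s s' → I B s' → Q s') : Ends Y (.for a e P) s Q := by
  have hmono : ∀ s', SameOff (.seq P (.letN a (.add (nvar a) (.const 1)))) (s.setNat a 0 0) s' →
      SameOff (.for a e P) s s' := by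
    intro s' h
    refine ⟨fun b hb => ?_, fun b hb => ?_⟩
    · simp only [Prog.for, Prog.natWrites, List.mem_append, List.mem_singleton, not_or] at hb
      rw [h.nat b (by simp [Prog.natWrites, hb])]
      simp [hb.1]
    · simp only [Prog.for, Prog.realWrites, List.mem_append, not_or] at hb
      rw [h.real b (by simp [Prog.realWrites, hb])]
      simp
  have heval : ∀ s', SameOff (.for a e P) s s' → e.eval s' = B := by
    intro s' h
    rw [← hB]
    refine NExp.eval_congr e fun b hb => h.nat b ?_
    simp only [Prog.for, Prog.natWrites, List.mem_append, List.mem_singleton, not_or]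
    have : b ≠ a := fun h => ha' (h ▸ hb)
    exact ⟨this, he b hb, this⟩
  refine Ends.seq (Ends.setN fun _ => ?_)
  refine Ends.loop (fun i s' => s'.nat a 0 = i ∧ i ≤ B ∧ I i s') ⟨by simp, by omega, h0⟩ ?_ ?_
  · rintro i s' hs ⟨h1, h2, h3⟩ hb
    simp only [BExp.Holds, heval s' (hmono s' hs), NExp.eval, h1] at hb
    refine ⟨by omega, Ends.seq ((hstep i s' (by omega) (hmono s' hs) h1 h3).mono ?_)⟩
    intro s'' hs'' hI _
    refine Ends.setN ?_
    have : s''.nat a 0 = i := by rw [hs''.nat a ha, h1]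
    simp only [NExp.eval, this]
    exact ⟨by simp, by omega, hI hs''⟩
  · rintro i s' hs ⟨h1, h2, h3⟩ hb
    simp only [BExp.Holds, heval s' (hmono s' hs), NExp.eval, h1] at hb
    obtain rfl : i = B := by omega
    exact hend s' (hmono s' hs) h3

/-- Multiplication of natural numbers by repeated addition, with counter `t`. -/
def Prog.mul (t a : ℕ) (e₁ e₂ : NExp) : Prog :=
  .seq (.letN a (.const 0)) (.for t e₂ (.letN a (.add (nvar a) e₁)))

theorem Ends.mul {Y t a : ℕ} {e₁ e₂ : NExp} {s : Memory} {Q : Memory → Prop} (hta : t ≠ a)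
    (h₁ : a ∉ e₁.reads ∧ t ∉ e₁.reads) (h₂ : a ∉ e₂.reads ∧ t ∉ e₂.reads)
    (hY : e₂.eval s ≤ Y)
    (hQ : ∀ s', SameOff (.mul t a e₁ e₂) s s' → s'.nat a 0 = e₁.eval s * e₂.eval s → Q s') :
    Ends Y (.mul t a e₁ e₂) s Q := by
  have hs : ∀ e : NExp, (a ∉ e.reads ∧ t ∉ e.reads) → ∀ s', SameOff (.mul t a e₁ e₂) s s' →
      e.eval s' = e.eval s := by
    intro e he s' h
    refine NExp.eval_congr e fun b hb => h.nat b ?_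
    have h1 : b ≠ a := fun h => he.1 (h ▸ hb)
    have h2 : b ≠ t := fun h => he.2 (h ▸ hb)
    simp [Prog.mul, Prog.for, Prog.natWrites, h1, h2]
  have main : Ends Y (.mul t a e₁ e₂) s fun s' => s'.nat a 0 = e₁.eval s * e₂.eval s := by
    refine Ends.seq (Ends.setN fun hs0 => ?_)
    have e0 : ∀ e : NExp, (a ∉ e.reads ∧ t ∉ e.reads) →
        e.eval (s.setNat a ((NExp.const 0).eval s) ((NExp.const 0).eval s)) = e.eval s :=
      fun e he => hs e he _ (hs0.mono (by simp [Prog.mul, Prog.natWrites])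
        (by simp [Prog.realWrites]))
    refine Ends.for (fun i s' => s'.nat a 0 = e₁.eval s * i) (by simp [Prog.natWrites, hta]) h₂.2
      (fun b hb => by
        have : b ≠ a := fun h => h₂.1 (h ▸ hb)
        simp [Prog.natWrites, this]) rfl (by rw [e0 e₂ h₂]; exact hY)
      (by simp [hta.symm]) ?_ ?_
    · intro i s' hi hs' _ hI
      refine Ends.setN fun _ => ?_
      have h3 : e₁.eval s' = e₁.eval s := by
        rw [← e0 e₁ h₁]
        refine NExp.eval_congr e₁ fun b hb => hs'.nat b ?_
        have h1 : b ≠ a := fun h => h₁.1 (h ▸ hb)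
        have h2 : b ≠ t := fun h => h₁.2 (h ▸ hb)
        simp [Prog.for, Prog.natWrites, h1, h2]
      simp [hta.symm, h3, hI, mul_add]
    · intro s' _ hI
      rw [hI, e0 e₂ h₂]
  exact main.mono hQ

/-- Division with remainder by repeated subtraction: `y` is replaced by its remainder modulo
`e`, and `a` receives the quotient. -/
def Prog.divMod (y a : ℕ) (e : NExp) : Prog :=
  .seq (.letN a (.const 0))
    (.loop (.leN e (nvar y))
      (.seq (.letN y (.sub (nvar y) e)) (.letN a (.add (nvar a) (.const 1)))))

theorem Ends.divMod {Y y a : ℕ} {e : NExp} {s : Memory} {Q : Memory → Prop} (hya : y ≠ a)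
    (hr : a ∉ e.reads ∧ y ∉ e.reads) (he : 0 < e.eval s) (hY : s.nat y 0 ≤ Y)
    (hQ : ∀ s', SameOff (.divMod y a e) s s' → s'.nat y 0 = s.nat y 0 % e.eval s →
      s'.nat a 0 = s.nat y 0 / e.eval s → Q s') :
    Ends Y (.divMod y a e) s Q := by
  have main : Ends Y (.divMod y a e) s fun s' =>
      s'.nat y 0 = s.nat y 0 % e.eval s ∧ s'.nat a 0 = s.nat y 0 / e.eval s := by
    refine Ends.seq (Ends.setN fun hs0 => ?_)
    refine Ends.loop (fun i s' => e.eval s' = e.eval s ∧ s'.nat y 0 + e.eval s * i = s.nat y 0 ∧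
      s'.nat a 0 = i) ⟨?_, by simp [hya], by simp⟩ ?_ ?_
    · refine NExp.eval_congr e fun b hb => hs0.nat b ?_
      have h1 : b ≠ a := fun h => hr.1 (h ▸ hb)
      simp [Prog.natWrites, h1]
    · rintro i s' _ ⟨h1, h2, h3⟩ hb
      simp only [BExp.Holds, NExp.eval, h1] at hb
      constructor
      · nlinarith
      have h4 : e.eval (s'.setNat y 0 (s'.nat y 0 - e.eval s)) = e.eval s := by
        rw [← h1]
        refine NExp.eval_congr e fun b hb => ?_
        exact setNat_nat_of_ne _ _ _ fun h => hr.2 (h ▸ hb)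
      have h5 : ∀ x, e.eval ((s'.setNat y 0 (s'.nat y 0 - e.eval s)).setNat a 0 x) = e.eval s := by
        intro x
        refine Eq.trans (NExp.eval_congr e fun b hb => ?_) h4
        have h6 : b ≠ a := fun h => hr.1 (h ▸ hb)
        exact setNat_nat_of_ne _ _ _ h6
      refine Ends.seq (Ends.setN fun _ => Ends.setN ?_)
      simp only [NExp.eval, h1, h5, true_and]
      simp only [ne_eq, hya, not_false_eq_true, setNat_nat_of_ne, setNat_nat_self,
        Function.update_self, hya.symm, h3, and_true, mul_add, mul_one]
      omega
    · rintro i s' _ ⟨h1, h2, h3⟩ hb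
      simp only [BExp.Holds, NExp.eval, h1, not_le] at hb
      rw [h3, ← h2, Nat.add_mul_mod_self_left, Nat.add_mul_div_left _ _ he, Nat.mod_eq_of_lt hb,
        Nat.div_eq_of_lt hb, zero_add]
      exact ⟨rfl, rfl⟩
  exact main.mono fun s' h h' => hQ s' h h'.1 h'.2

/-! ### Demand, payments and small bundles -/

section Buyers

variable {n m k : ℕ} {H : ℝ} {M : Market n m}

theorem mem_demand {v : Finset (Fin n) → ℝ} {p : Fin n → ℝ} {S : Finset (Fin n)} :
    S ∈ demand v p ↔ ∀ T, v T - bundlePrice p T ≤ v S - bundlePrice p S := by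
  simp [demand]

theorem bundlePrice_le_payment {v : Finset (Fin n) → ℝ} {p : Fin n → ℝ} {S : Finset (Fin n)}
    (h : S ∈ demand v p) : bundlePrice p S ≤ payment v p :=
  Finset.le_sup' (bundlePrice p) h

theorem exists_mem_demand_eq_payment (v : Finset (Fin n) → ℝ) (p : Fin n → ℝ) :
    ∃ S ∈ demand v p, bundlePrice p S = payment v p := by
  obtain ⟨S, hS, h⟩ := Finset.exists_mem_eq_sup' (demand_nonempty v p) (bundlePrice p)
  exact ⟨S, hS, h.symm⟩

theorem bundlePrice_nonneg {p : Fin n → ℝ} (hp : ∀ i, 0 ≤ p i) (S : Finset (Fin n)) :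
    0 ≤ bundlePrice p S := Finset.sum_nonneg fun i _ => hp i

theorem bundlePrice_mono_set {p : Fin n → ℝ} (hp : ∀ i, 0 ≤ p i) {S T : Finset (Fin n)}
    (h : S ⊆ T) : bundlePrice p S ≤ bundlePrice p T :=
  Finset.sum_le_sum_of_subset_of_nonneg h fun i _ _ => hp i

theorem le_bundlePrice {p : Fin n → ℝ} (hp : ∀ i, 0 ≤ p i) {S : Finset (Fin n)} {i : Fin n}
    (h : i ∈ S) : p i ≤ bundlePrice p S :=
  Finset.single_le_sum (f := p) (fun i _ => hp i) h

theorem bundlePrice_smul (a : ℝ) (p : Fin n → ℝ) (S : Finset (Fin n)) :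
    bundlePrice (fun i => a * p i) S = a * bundlePrice p S := by
  simp [bundlePrice, Finset.mul_sum]

@[simp] theorem bundlePrice_empty (p : Fin n → ℝ) : bundlePrice p ∅ = 0 := by
  simp [bundlePrice]

/-- If `p` exceeds `h` by at most `b` on each item of a bundle of at most `k` items, then it
exceeds it by at most `k * b` on the bundle. -/
theorem bundlePrice_le_add {p h : Fin n → ℝ} {b : ℝ} (hb : 0 ≤ b) {S : Finset (Fin n)}
    (hS : S.card ≤ k) (hp : ∀ i ∈ S, p i ≤ h i + b) :
    bundlePrice p S ≤ bundlePrice h S + k * b := by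
  have h1 : bundlePrice p S ≤ ∑ i ∈ S, (h i + b) := Finset.sum_le_sum hp
  have h2 : (S.card : ℝ) * b ≤ k * b := by gcongr
  rw [Finset.sum_add_distrib, Finset.sum_const, nsmul_eq_mul] at h1
  exact h1.trans (by gcongr; exact le_rfl)

theorem payment_nonneg (v : Finset (Fin n) → ℝ) {p : Fin n → ℝ} (hp : ∀ i, 0 ≤ p i) :
    0 ≤ payment v p := by
  obtain ⟨S, _, h⟩ := exists_mem_demand_eq_payment v p
  exact h ▸ bundlePrice_nonneg hp S

theorem Market.Valid.card_pos (hM : M.Valid k H) : 0 < n := by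
  rcases Nat.eq_zero_or_pos n with rfl | h
  · rcases Nat.eq_zero_or_pos m with rfl | hm
    · have := hM.prob_sum
      simp at this
    · have h1 := hM.nontrivial ⟨0, hm⟩
      rw [Finset.univ_eq_empty, hM.empty] at h1
      norm_num at h1
  · exact h

theorem Market.Valid.types_pos (hM : M.Valid k H) : 0 < m := by
  rcases Nat.eq_zero_or_pos m with rfl | hm
  · have := hM.prob_sum
    simp at this
  · exact hm

theorem Market.Valid.card_le_width (hM : M.Valid k H) {S : Finset (Fin n)}
    (hS : IsAntichain M.rel (S : Set (Fin n))) : S.card ≤ k := by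
  classical
  rw [← hM.width_eq]
  unfold width
  exact Finset.le_sup (f := Finset.card) (by simpa using hS)

theorem Market.Valid.width_pos (hM : M.Valid k H) : 0 < k := by
  have h := hM.card_le_width (S := {⟨0, hM.card_pos⟩}) (by simp)
  rw [Finset.card_singleton] at h
  exact h

theorem Market.Valid.width_le (hM : M.Valid k H) : k ≤ n := by
  classical
  rw [← hM.width_eq]
  refine Finset.sup_le fun S _ => ?_
  simpa using Finset.card_le_univ S

theorem Market.Valid.one_le_bound (hM : M.Valid k H) : 1 ≤ H := by
  have h1 := hM.nontrivial ⟨0, hM.types_pos⟩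
  rcases hM.range ⟨0, hM.types_pos⟩ Finset.univ with h | h
  · rw [h] at h1
    norm_num at h1
  · linarith

theorem Market.Valid.val_nonneg (hM : M.Valid k H) (j : Fin m) (S : Finset (Fin n)) :
    0 ≤ M.val j S := by
  rcases hM.range j S with h | h <;> linarith

/-- Adding dominated items to a bundle does not change its value. -/
theorem Market.Valid.val_union (hM : M.Valid k H) (j : Fin m) (S R : Finset (Fin n))
    (h : ∀ i ∈ R, ∃ i' ∈ S, M.rel i i') : M.val j (S ∪ R) = M.val j S := by
  classical
  induction R using Finset.induction_on with
  | empty => simp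
  | insert i R _ ih =>
    obtain ⟨i', hi', hr⟩ := h i (by simp)
    rw [← ih fun x hx => h x (by simp [hx])]
    have h1 := hM.discard j i i' hr (S ∪ R)
    have h2 : S ∪ R ∪ {i, i'} = S ∪ insert i R := by
      ext x
      simp only [Finset.mem_union, Finset.mem_insert, Finset.mem_singleton]
      grind
    have h3 : S ∪ R ∪ {i'} = S ∪ R := by
      ext x
      simp only [Finset.mem_union, Finset.mem_singleton]
      grind
    rwa [h2, h3] at h1

/-- Every bundle contains at most `k` items that dominate all its items. -/
theorem Market.Valid.exists_dominating (hM : M.Valid k H) (U : Finset (Fin n)) :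
    ∃ S ⊆ U, S.card ≤ k ∧ ∀ i ∈ U, ∃ i' ∈ S, M.rel i i' := by
  classical
  refine ⟨U.filter fun i => ∀ i' ∈ U, M.rel i i' → i' = i, Finset.filter_subset _ _,
    hM.card_le_width ?_, ?_⟩
  · intro i hi i' hi' hne hr
    simp only [Finset.coe_filter, Set.mem_ofPred_eq] at hi hi'
    exact hne (hi.2 i' hi'.1 hr).symm
  · intro i hi
    -- an item of `U` above `i` with as many items below it as possible is maximal in `U`
    obtain ⟨x, hx, hmax⟩ := Finset.exists_max_image (U.filter fun i' => M.rel i i')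
      (fun i' => (Finset.univ.filter fun y => M.rel y i').card) ⟨i, by simp [hi, hM.refl]⟩
    simp only [Finset.mem_filter] at hx hmax
    refine ⟨x, Finset.mem_filter.2 ⟨hx.1, fun y hy hxy => ?_⟩, hx.2⟩
    by_contra hne
    have h1 := hmax y ⟨hy, hM.trans _ _ _ hx.2 hxy⟩
    have h2 : (Finset.univ.filter fun z => M.rel z x) ⊂ Finset.univ.filter fun z => M.rel z y := by
      refine Finset.ssubset_iff_of_subset (fun z hz => ?_) |>.2 ⟨y, ?_, ?_⟩
      · simp only [Finset.mem_filter, Finset.mem_univ, true_and] at hz ⊢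
        exact hM.trans _ _ _ hz hxy
      · simp [hM.refl]
      · simp only [Finset.mem_filter, Finset.mem_univ, true_and]
        exact fun h => hne (hM.antisymm _ _ h hxy)
    exact absurd (Finset.card_lt_card h2) (by omega)

/-- Dominated items can be dropped from a bundle: it suffices to consider bundles of at most
`k` items. -/
theorem Market.Valid.exists_small (hM : M.Valid k H) (U : Finset (Fin n)) :
    ∃ S ⊆ U, S.card ≤ k ∧ ∀ j, M.val j S = M.val j U := by
  obtain ⟨S, hSU, hS, hd⟩ := hM.exists_dominating U
  refine ⟨S, hSU, hS, fun j => ?_⟩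
  rw [← hM.val_union j S U hd, Finset.union_eq_right.2 hSU]

theorem Market.Valid.exists_small_payment (hM : M.Valid k H) (j : Fin m) {p : Fin n → ℝ}
    (hp : ∀ i, 0 ≤ p i) : ∃ S ∈ demand (M.val j) p, S.card ≤ k ∧
      bundlePrice p S = payment (M.val j) p := by
  obtain ⟨U, hU, hpay⟩ := exists_mem_demand_eq_payment (M.val j) p
  obtain ⟨S, hSU, hS, hv⟩ := hM.exists_small U
  have h1 := mem_demand.1 hU S
  have h2 := bundlePrice_mono_set hp hSU
  rw [hv j] at h1
  have h3 : bundlePrice p S = bundlePrice p U := le_antisymm h2 (by linarith)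
  refine ⟨S, mem_demand.2 fun T => ?_, hS, h3.trans hpay⟩
  rw [hv j, h3]
  exact mem_demand.1 hU T

theorem Market.Valid.payment_le_val (hM : M.Valid k H) (j : Fin m) {p : Fin n → ℝ}
    {S : Finset (Fin n)} (hS : S ∈ demand (M.val j) p) : bundlePrice p S ≤ M.val j S := by
  have := mem_demand.1 hS ∅
  rw [hM.empty, bundlePrice_empty] at this
  linarith

/-- An item may be given the price of its cheapest dominating item: no type then pays less. -/
theorem Market.Valid.exists_monotone_prices (hM : M.Valid k H) {q : Fin n → ℝ}
    (hq : ∀ i, 0 ≤ q i) : ∃ q' : Fin n → ℝ, (∀ i, 0 ≤ q' i) ∧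
      (∀ i i', M.rel i i' → q' i ≤ q' i') ∧
      ∀ j, payment (M.val j) q ≤ payment (M.val j) q' := by
  classical
  have hmin : ∀ i, ∃ x, M.rel i x ∧ ∀ y, M.rel i y → q x ≤ q y := by
    intro i
    obtain ⟨x, hx, hm⟩ := Finset.exists_min_image (Finset.univ.filter fun y => M.rel i y) q
      ⟨i, by simp [hM.refl]⟩
    simp only [Finset.mem_filter, Finset.mem_univ, true_and] at hx hm
    exact ⟨x, hx, hm⟩
  choose f hf hfm using hmin
  refine ⟨fun i => q (f i), fun i => hq _, fun i i' h => hfm _ _ (hM.trans _ _ _ h (hf i')),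
    fun j => ?_⟩
  obtain ⟨S, hS, hpay⟩ := exists_mem_demand_eq_payment (M.val j) q
  -- buying the dominating items `f i` instead of the items `i` of a bundle `T` costs the new
  -- price of `T` at the old prices and is worth at least as much
  have hup : ∀ T : Finset (Fin n), M.val j T - bundlePrice (fun i => q (f i)) T
      ≤ M.val j S - bundlePrice q S := by
    intro T
    have h1 : M.val j T ≤ M.val j (T.image f) := by
      rw [← hM.val_union j (T.image f) T fun i hi => ⟨f i, Finset.mem_image_of_mem f hi, hf i⟩]
      exact hM.mono j Finset.subset_union_right
    have h2 : bundlePrice q (T.image f) ≤ bundlePrice (fun i => q (f i)) T :=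
      Finset.sum_image_le_of_nonneg (fun i _ => hq i)
    have h3 := mem_demand.1 hS (T.image f)
    linarith
  have hle : bundlePrice (fun i => q (f i)) S ≤ bundlePrice q S :=
    Finset.sum_le_sum fun i _ => hfm i i (hM.refl i)
  have heq : bundlePrice (fun i => q (f i)) S = bundlePrice q S :=
    le_antisymm hle (by linarith [hup S])
  rw [← hpay, ← heq]
  exact bundlePrice_le_payment (mem_demand.2 fun T => by rw [heq]; exact hup T)

/-- Selling every item at price `1 / k` earns at least `1 / k` from every type: the at most `k`
maximal items together cost at most `1`. -/
theorem Market.Valid.payment_const (hM : M.Valid k H) (j : Fin m) :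
    1 / (k : ℝ) ≤ payment (M.val j) fun _ => 1 / (k : ℝ) := by
  have hk : (0 : ℝ) < k := by exact_mod_cast hM.width_pos
  obtain ⟨S, _, hS, hv⟩ := hM.exists_small Finset.univ
  have hb : ∀ U : Finset (Fin n), bundlePrice (fun _ => 1 / (k : ℝ)) U = U.card * (1 / k) := by
    intro U
    simp [bundlePrice]
  have hbU : ∀ U : Finset (Fin n), U.Nonempty →
      1 / (k : ℝ) ≤ bundlePrice (fun _ => 1 / (k : ℝ)) U := by
    intro U hU
    rw [hb]
    have : (1 : ℝ) ≤ U.card := by exact_mod_cast hU.card_pos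
    exact le_mul_of_one_le_left (by positivity) this
  have hSn : S.Nonempty := by
    rw [Finset.nonempty_iff_ne_empty]
    rintro rfl
    have h1 := hM.nontrivial j
    rw [← hv j, hM.empty] at h1
    norm_num at h1
  have hSu : 0 ≤ M.val j S - bundlePrice (fun _ => 1 / (k : ℝ)) S := by
    have h1 : (S.card : ℝ) ≤ k := by exact_mod_cast hS
    have h2 : (S.card : ℝ) * (1 / k) ≤ 1 := by rw [mul_one_div, div_le_one hk]; exact h1
    rw [hv j, hb]
    linarith [hM.nontrivial j]
  obtain ⟨U, hU⟩ := demand_nonempty (M.val j) fun _ => 1 / (k : ℝ)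
  rcases U.eq_empty_or_nonempty with rfl | hUn
  · refine (hbU S hSn).trans (bundlePrice_le_payment (mem_demand.2 fun T => ?_))
    have := mem_demand.1 hU T
    rw [hM.empty, bundlePrice_empty] at this
    linarith
  · exact (hbU U hUn).trans (bundlePrice_le_payment hU)

end Buyers

/-! ### Codes of bundles and of down-sets -/

section Codes

variable {n m k : ℕ} {H : ℝ}

theorem card_codedBundle (c : Fin (n ^ k)) : (codedBundle c).card ≤ k := by
  unfold codedBundle
  exact Finset.card_image_le.trans (by simp)

theorem exists_codedBundle {S : Finset (Fin n)} (hS : S.Nonempty) (hk : S.card ≤ k) :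
    ∃ c : Fin (n ^ k), codedBundle c = S := by
  obtain ⟨x, hx⟩ := hS
  have e := S.equivFin
  refine ⟨finFunctionFinEquiv fun l : Fin k =>
    if h : (l : ℕ) < S.card then (e.symm ⟨l, h⟩ : Fin n) else x, ?_⟩
  unfold codedBundle
  rw [Equiv.symm_apply_apply]
  ext i
  simp only [Finset.mem_image, Finset.mem_univ, true_and]
  constructor
  · rintro ⟨l, rfl⟩
    split_ifs with h
    · exact (e.symm ⟨l, h⟩).2
    · exact hx
  · intro hi
    refine ⟨⟨e ⟨i, hi⟩, (e ⟨i, hi⟩).2.trans_le hk⟩, ?_⟩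
    simp

open Classical in
/-- The down-set of the items dominated by a member of the bundle with code `c`; the code
`n ^ k` stands for the empty down-set. -/
noncomputable def down (M : Market n m) (k c : ℕ) : Finset (Fin n) :=
  if h : c < n ^ k then
    Finset.univ.filter fun i => ∃ i' ∈ codedBundle (⟨c, h⟩ : Fin (n ^ k)), M.rel i i'
  else ∅

theorem Market.Valid.exists_down {M : Market n m} (hM : M.Valid k H) {D : Set (Fin n)}
    (hD : ∀ i i', M.rel i i' → i' ∈ D → i ∈ D) :
    ∃ c < n ^ k + 1, ∀ i, i ∈ down M k c ↔ i ∈ D := by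
  classical
  rcases D.eq_empty_or_nonempty with rfl | ⟨x, hx⟩
  · exact ⟨n ^ k, by omega, by simp [down]⟩
  · obtain ⟨S, hSU, hS, hd⟩ := hM.exists_dominating (Finset.univ.filter (· ∈ D))
    have hSn : S.Nonempty := by
      obtain ⟨y, hy, _⟩ := hd x (by simpa using hx)
      exact ⟨y, hy⟩
    obtain ⟨c, hc⟩ := exists_codedBundle hSn hS
    refine ⟨c, by omega, fun i => ?_⟩
    simp only [down, c.2, dif_pos, Fin.eta, hc, Finset.mem_filter, Finset.mem_univ, true_and]
    constructor
    · rintro ⟨i', hi', hr⟩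
      exact hD i i' hr (by simpa using hSU hi')
    · exact fun hi => hd i (by simpa using hi)

/-- Every sequence of digits is the sequence of digits of some number. -/
theorem exists_digits {N : ℕ} (r : ℕ) (f : ℕ → ℕ) (hf : ∀ t, f t < N) :
    ∃ e < N ^ (r + 1), (∀ t < r, e / N ^ t % N = f t) ∧ e / N ^ r = f r := by
  induction r generalizing f with
  | zero => exact ⟨f 0, by simpa using hf 0, by simp, by simp⟩
  | succ r ih =>
    obtain ⟨e, he, h1, h2⟩ := ih (fun t => f (t + 1)) fun t => hf _
    have hN : 0 < N := (Nat.zero_le _).trans_lt (hf 0)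
    have hdiv : ∀ t, (e * N + f 0) / N ^ (t + 1) = e / N ^ t := by
      intro t
      rw [pow_succ', ← Nat.div_div_eq_div_mul, mul_comm, Nat.mul_add_div hN,
        Nat.div_eq_of_lt (hf 0), add_zero]
    refine ⟨e * N + f 0, ?_, ?_, ?_⟩
    · calc e * N + f 0 < e * N + N := by have := hf 0; omega
        _ = (e + 1) * N := by ring
        _ ≤ N ^ (r + 1) * N := Nat.mul_le_mul_right _ he
        _ = N ^ (r + 1 + 1) := (pow_succ _ _).symm
    · rintro (_ | t) ht
      · rw [pow_zero, Nat.div_one, mul_comm, Nat.mul_add_mod, Nat.mod_eq_of_lt (hf 0)]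
      · rw [hdiv]
        exact h1 t (by omega)
    · rw [hdiv, h2]

end Codes

/-! ### Price levels, zones and blocks -/

section Levels

/-- The ratio of consecutive price levels. -/
noncomputable def step (L : ℕ) : ℝ := 1 + 1 / ((L : ℝ) * L)

/-- The ratio by which a payment has to exceed the prices of earlier blocks in order to be
counted. -/
def gap (k L : ℕ) : ℕ := L * L * k

/-- The number of price levels in a zone. -/
def zoneLen (k L : ℕ) : ℕ := (gap k L + gap k L) * (L * L)

/-- The ratio of the ends of a zone. -/
noncomputable def zone (k L : ℕ) : ℝ := step L ^ zoneLen k L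

/-- The number of price levels in a block of `L` zones. -/
def blockLen (k L : ℕ) : ℕ := zoneLen k L * L

/-- The lower end of the `q`-th zone. The `q`-th block extends from `base k L q` to
`base k L (q + L)`. -/
noncomputable def base (k L q : ℕ) : ℝ := 1 / ((L : ℝ) * k) / zone k L ^ L * zone k L ^ q

variable {k L : ℕ}

theorem one_lt_step (hL : 0 < L) : 1 < step L := by
  have : (0 : ℝ) < L := by exact_mod_cast hL
  unfold step
  have : 0 < 1 / ((L : ℝ) * L) := by positivity
  linarith

/-- By Bernoulli's inequality, a zone is wide enough to contain the gap twice. -/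
theorem two_mul_gap_le_zone (hL : 0 < L) : 2 * (gap k L : ℝ) ≤ zone k L := by
  have hL' : (0 : ℝ) < L := by exact_mod_cast hL
  have h := one_add_mul_le_pow (a := 1 / ((L : ℝ) * L))
    (by have : 0 < 1 / ((L : ℝ) * L) := by positivity
        linarith) (zoneLen k L)
  have h2 : (zoneLen k L : ℝ) * (1 / ((L : ℝ) * L)) = 2 * gap k L := by
    unfold zoneLen
    push_cast
    field_simp
    ring
  rw [h2] at h
  unfold zone step
  linarith

theorem sq_le_gap (hk : 0 < k) : L * L ≤ gap k L := Nat.le_mul_of_pos_right _ hk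

theorem zone_ge (hk : 0 < k) (hL : 18 ≤ L) : 3 ≤ zone k L := by
  have h1 := two_mul_gap_le_zone (k := k) (by omega : 0 < L)
  have h2 : 18 * 18 ≤ gap k L := (Nat.mul_le_mul hL hL).trans (sq_le_gap hk)
  have h3 : (18 * 18 : ℝ) ≤ gap k L := by exact_mod_cast h2
  linarith

theorem base_pos (hk : 0 < k) (hL : 18 ≤ L) (q : ℕ) : 0 < base k L q := by
  have h1 : (0 : ℝ) < L := by exact_mod_cast (by omega : 0 < L)
  have h2 : (0 : ℝ) < k := by exact_mod_cast hk
  have h3 := zone_ge hk hL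
  unfold base
  positivity

theorem base_succ (q : ℕ) : base k L (q + 1) = base k L q * zone k L := by
  unfold base
  rw [pow_succ, mul_assoc]

theorem base_mono (hk : 0 < k) (hL : 18 ≤ L) : Monotone (base k L) := by
  refine monotone_nat_of_le_succ fun q => ?_
  rw [base_succ]
  exact le_mul_of_one_le_right (base_pos hk hL q).le (by linarith [zone_ge hk hL])

theorem base_add (q : ℕ) : base k L (q + L) = base k L q * step L ^ blockLen k L := by
  unfold base blockLen zone
  rw [pow_mul, pow_add, mul_assoc]

theorem base_add_eq (hk : 0 < k) (hL : 18 ≤ L) (q : ℕ) :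
    base k L (q + L) = 1 / ((L : ℝ) * k) * zone k L ^ q := by
  have h3 := zone_ge hk hL
  unfold base
  rw [pow_add]
  field_simp

theorem base_add_div (hL : 18 ≤ L) (q : ℕ) :
    base k L (q + L) / step L ^ blockLen k L = base k L q := by
  rw [base_add, mul_div_cancel_right₀]
  exact pow_ne_zero _ (by linarith [one_lt_step (by omega : 0 < L)])

theorem base_mul_zone_le (hk : 0 < k) (hL : 18 ≤ L) {q q' : ℕ} (h : q < q') :
    base k L q * zone k L ≤ base k L q' := by
  rw [← base_succ]
  exact base_mono hk hL h

end Levels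

/-! ### The hypothetical market of a block -/

section Block

variable {n m k L : ℕ} {H : ℝ} {M : Market n m}

/-- The level prices after reading `t` base-`(n ^ k + 1)` digits of `e`, where digit `t` is the code of
a set of items to be priced at most `top / θ ^ (t + 1)`. All other items have price `big`. -/
noncomputable def levelPrice (M : Market n m) (k : ℕ) (θ top big : ℝ) (e : ℕ) :
    ℕ → Fin n → ℝ
  | 0, _ => big
  | t + 1, i =>
    if i ∈ down M k (e / (n ^ k + 1) ^ t % (n ^ k + 1)) then top / θ ^ (t + 1)
    else levelPrice M k θ top big e t i

/-- The down-set of the items priced below the block, according to the leading digit of `e`. -/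
noncomputable def lowItems (M : Market n m) (k L e : ℕ) : Finset (Fin n) :=
  down M k (e / (n ^ k + 1) ^ blockLen k L)

/-- The down-set of the items priced below the end of the block, according to the last digit of
`e`. -/
noncomputable def soldItems (M : Market n m) (k e : ℕ) : Finset (Fin n) :=
  down M k (e % (n ^ k + 1))

/-- A price that nobody is willing to pay, if `V` bounds all values. -/
noncomputable def prohibitive (k L : ℕ) (V : ℝ) (q : ℕ) : ℝ := V + 1 + base k L (q + L)

/-- The prices that `e` assigns to items not priced below the `q`-th block. -/
noncomputable def blockPrice (M : Market n m) (k L : ℕ) (V : ℝ) (q e : ℕ) : Fin n → ℝ :=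
  levelPrice M k (step L) (base k L (q + L)) (prohibitive k L V q) e (blockLen k L)

/-- The prices in the hypothetical market of the `q`-th block: items priced below the block are
free. -/
noncomputable def hypPrice (M : Market n m) (k L : ℕ) (V : ℝ) (q e : ℕ) (i : Fin n) : ℝ :=
  open Classical in if i ∈ lowItems M k L e then 0 else blockPrice M k L V q e i

/-- The extension by the `q`-th block of a price vector for the items priced below it. -/
noncomputable def newPrice (M : Market n m) (k L : ℕ) (V : ℝ) (q e : ℕ) (p : Fin n → ℝ)
    (i : Fin n) : ℝ :=
  open Classical in if i ∈ lowItems M k L e then p i else blockPrice M k L V q e i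

/-- The items that `e` prices below the end of the block are those not priced prohibitively. -/
def Consistent (M : Market n m) (k L : ℕ) (V : ℝ) (q e : ℕ) : Prop :=
  ∀ i, i ∉ soldItems M k e → prohibitive k L V q ≤ hypPrice M k L V q e i

/-- A bundle of at most `k` items of largest utility at prices `h`. -/
structure Favourite (k : ℕ) (v : Finset (Fin n) → ℝ) (h : Fin n → ℝ) (T : Finset (Fin n)) :
    Prop where
  card_le : T.card ≤ k
  le : ∀ T' : Finset (Fin n), T'.card ≤ k → v T' - bundlePrice h T' ≤ v T - bundlePrice h T

/-- The part of a payment `x` in the hypothetical market of the `q`-th block that is credited to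
the block: nothing if `x` is close to the lower end of the block, and at most its upper end. -/
noncomputable def counted (k L q : ℕ) (x : ℝ) : ℝ :=
  open Classical in if gap k L * base k L q ≤ x then min x (base k L (q + L)) else 0

theorem counted_nonneg (hk : 0 < k) (hL : 18 ≤ L) (q : ℕ) (x : ℝ) : 0 ≤ counted k L q x := by
  have h1 := base_pos hk hL q
  have h2 := base_pos hk hL (q + L)
  unfold counted
  split_ifs with h
  · exact le_min (le_trans (by positivity) h) h2.le
  · exact le_rfl

theorem counted_of_le {q : ℕ} {x : ℝ} (h : gap k L * base k L q ≤ x) :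
    counted k L q x = min x (base k L (q + L)) := if_pos h

theorem counted_of_not_le {q : ℕ} {x : ℝ} (h : ¬ gap k L * base k L q ≤ x) :
    counted k L q x = 0 := if_neg h

theorem prohibitive_pos (hk : 0 < k) (hL : 18 ≤ L) {V : ℝ} (hV : 0 ≤ V) (q : ℕ) :
    0 < prohibitive k L V q := by
  have := base_pos hk hL (q + L)
  unfold prohibitive
  linarith

theorem levelPrice_le_top {θ top big : ℝ} (hθ : 1 < θ) (htop : 0 < top) {e : ℕ}
    {i : Fin n} (hi : i ∈ soldItems M k e) (t : ℕ) :
    levelPrice M k θ top big e (t + 1) i ≤ top := by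
  have hle : ∀ t, top / θ ^ t ≤ top := fun t => div_le_self htop.le (one_le_pow₀ hθ.le)
  induction t with
  | zero =>
    simp only [levelPrice, pow_zero, Nat.div_one]
    rw [if_pos (show i ∈ down M k (e % (n ^ k + 1)) from hi)]
    exact hle _
  | succ t ih =>
    rw [levelPrice]
    split_ifs
    · exact hle _
    · exact ih

theorem div_pow_le_levelPrice {θ top big : ℝ} (hθ : 1 < θ) (htop : 0 < top) (hbig : top ≤ big)
    (e t : ℕ) (i : Fin n) : top / θ ^ t ≤ levelPrice M k θ top big e t i := by
  induction t with
  | zero => simpa [levelPrice] using hbig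
  | succ t ih =>
    rw [levelPrice]
    split_ifs
    · exact le_rfl
    · refine le_trans ?_ ih
      exact div_le_div_of_nonneg_left htop.le (by positivity)
        (pow_le_pow_right₀ hθ.le (Nat.le_succ t))

theorem base_le_blockPrice (hk : 0 < k) (hL : 18 ≤ L) {V : ℝ} (hV : 0 ≤ V) (q e : ℕ)
    (i : Fin n) : base k L q ≤ blockPrice M k L V q e i := by
  rw [← base_add_div hL q]
  refine div_pow_le_levelPrice (one_lt_step (by omega)) (base_pos hk hL _) ?_ _ _ _
  unfold prohibitive
  linarith

theorem blockPrice_pos (hk : 0 < k) (hL : 18 ≤ L) {V : ℝ} (hV : 0 ≤ V) (q e : ℕ) (i : Fin n) :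
    0 < blockPrice M k L V q e i :=
  (base_pos hk hL q).trans_le (base_le_blockPrice hk hL hV q e i)

theorem hypPrice_nonneg (hk : 0 < k) (hL : 18 ≤ L) {V : ℝ} (hV : 0 ≤ V) (q e : ℕ) (i : Fin n) :
    0 ≤ hypPrice M k L V q e i := by
  unfold hypPrice
  split_ifs
  · exact le_rfl
  · exact (blockPrice_pos hk hL hV q e i).le

theorem blockLen_pos (hk : 0 < k) (hL : 18 ≤ L) : 0 < blockLen k L := by
  have : 0 < L := by omega
  unfold blockLen zoneLen gap
  positivity

theorem blockPrice_le (hk : 0 < k) (hL : 18 ≤ L) {V : ℝ} {q e : ℕ} {i : Fin n}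
    (hi : i ∈ soldItems M k e) : blockPrice M k L V q e i ≤ base k L (q + L) := by
  obtain ⟨t, ht⟩ := Nat.exists_eq_succ_of_ne_zero (blockLen_pos hk hL).ne'
  unfold blockPrice
  rw [ht]
  exact levelPrice_le_top (one_lt_step (by omega)) (base_pos hk hL _) hi t

/-- A favourite bundle costs at most `V`, hence contains no prohibitively priced item. -/
theorem Favourite.price_lt (hM : M.Valid k H) (hL : 18 ≤ L) {V : ℝ}
    (hV : ∀ j (T : Finset (Fin n)), T.card ≤ k → M.val j T ≤ V) {q e : ℕ} {j : Fin m}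
    {T : Finset (Fin n)} (hT : Favourite k (M.val j) (hypPrice M k L V q e) T) {i : Fin n}
    (hi : i ∈ T) : hypPrice M k L V q e i < prohibitive k L V q := by
  have h0 : 0 ≤ V := (hM.val_nonneg j T).trans (hV j T hT.card_le)
  have h1 := le_bundlePrice (fun i => hypPrice_nonneg (M := M) hM.width_pos hL h0 q e i) hi
  have h2 := hT.le ∅ (by simp)
  rw [hM.empty, bundlePrice_empty] at h2
  have h3 := base_pos hM.width_pos hL (q + L)
  have h4 := hV j T hT.card_le
  unfold prohibitive
  linarith

/-- If actual prices `p` are slightly larger than hypothetical prices `h` and are then discounted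
by the factor `1 - δ`, a type pays almost as much as for her favourite bundle at prices `h`:
larger payments get larger discounts, so she does not switch to a much cheaper bundle. -/
theorem payment_of_favourite (hM : M.Valid k H) {j : Fin m} {T D : Finset (Fin n)}
    {h p : Fin n → ℝ} {β β' δ : ℝ} (hδ : 0 < δ) (hδ1 : δ < 1) (hβ : 0 ≤ β)
    (hT : Favourite k (M.val j) h T) (hh : ∀ i, 0 ≤ h i) (hTD : T ⊆ D)
    (hD : ∀ i ∈ D, h i ≤ p i ∧ p i ≤ h i + β) (hoff : ∀ i ∉ D, β' ≤ p i) (hp : ∀ i, 0 ≤ p i)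
    (hx : k * β ≤ δ * (δ * bundlePrice h T)) :
    (1 - δ) * ((1 - δ) * min (bundlePrice h T) β') ≤
      payment (M.val j) fun i => (1 - δ) * p i := by
  obtain ⟨U, hU⟩ := demand_nonempty (M.val j) fun i => (1 - δ) * p i
  refine le_trans ?_ (bundlePrice_le_payment hU)
  have hU' := mem_demand.1 hU
  simp only [bundlePrice_smul] at hU' ⊢
  have hhT := bundlePrice_nonneg hh T
  refine mul_le_mul_of_nonneg_left ?_ (by linarith)
  by_cases hUD : U ⊆ D
  · obtain ⟨U', hUU, hc, hv⟩ := hM.exists_small U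
    have h1 := hT.le U' hc
    have h2 := bundlePrice_mono_set hh hUU
    have h3 := hU' T
    have h4 : bundlePrice h U ≤ bundlePrice p U :=
      Finset.sum_le_sum fun i hi => (hD i (hUD hi)).1
    have h5 := bundlePrice_le_add hβ hT.card_le fun i hi => (hD i (hTD hi)).2
    rw [hv j] at h1
    have h6 : (1 - δ) * bundlePrice p T ≤ (1 - δ) * (bundlePrice h T + k * β) :=
      mul_le_mul_of_nonneg_left h5 (by linarith)
    have h7 : 0 ≤ δ * (k * β) := by positivity
    have h8 : δ * (bundlePrice h T - δ * bundlePrice h T) ≤ δ * bundlePrice p U := by nlinarith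
    have h9 := le_of_mul_le_mul_left h8 hδ
    calc (1 - δ) * min (bundlePrice h T) β' ≤ (1 - δ) * bundlePrice h T :=
          mul_le_mul_of_nonneg_left (min_le_left _ _) (by linarith)
      _ ≤ bundlePrice p U := by linarith
  · obtain ⟨i, hi, hiD⟩ := Finset.not_subset.1 hUD
    have h1 := le_bundlePrice hp hi
    have h2 := hoff i hiD
    have h3 : min (bundlePrice h T) β' ≤ bundlePrice p U := (min_le_right _ _).trans (h2.trans h1)
    have h4 := bundlePrice_nonneg hp U
    calc (1 - δ) * min (bundlePrice h T) β' ≤ (1 - δ) * bundlePrice p U :=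
          mul_le_mul_of_nonneg_left h3 (by linarith)
      _ ≤ bundlePrice p U := by nlinarith

/-- If hypothetical prices `h` are at most `1 - δ` times the prices `q`, but are not much smaller
than that, the favourite bundle of a type at prices `h` is almost as expensive as the bundle that
she buys at prices `q`. -/
theorem Favourite.price_ge {v : Finset (Fin n) → ℝ} {h q : Fin n → ℝ} {S T : Finset (Fin n)}
    {δ η b : ℝ} (hb : 0 ≤ b) (hT : Favourite k v h T) (hS : S ∈ demand v q) (hSk : S.card ≤ k)
    (hhS : ∀ i ∈ S, h i ≤ (1 - δ) * q i) (hhT : ∀ i ∈ T, q i ≤ (1 + η) * h i + b) :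
    δ * bundlePrice q S ≤ η * bundlePrice h T + k * b := by
  have h1 := hT.le S hSk
  have h2 := mem_demand.1 hS T
  have h3 : bundlePrice h S ≤ (1 - δ) * bundlePrice q S := by
    rw [← bundlePrice_smul]
    exact Finset.sum_le_sum hhS
  have h4 : bundlePrice q T ≤ (1 + η) * bundlePrice h T + k * b := by
    rw [← bundlePrice_smul]
    exact bundlePrice_le_add hb hT.card_le hhT
  linarith

end Block

/-! ### Soundness of the table entries -/

section Soundness

variable {n m k L : ℕ} {H V : ℝ} {M : Market n m}

/-- A table entry for the zone `q` and the down-set `D`: the prices `p` of the items of `D`, all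
below `base k L q`, guarantee almost the revenue `F`, however the remaining items are priced
above `base k L q`. The revenue is split into contributions of the types. The bound on these is
what allows later, larger payments to replace them instead of adding to them. -/
structure Good (M : Market n m) (k L q : ℕ) (D : Finset (Fin n)) (F : ℝ) (p : Fin n → ℝ) :
    Prop where
  price_nonneg : ∀ i, 0 ≤ p i
  price_le : ∀ i ∈ D, p i ≤ base k L q
  nonneg : 0 ≤ F
  earns : ∃ f : Fin m → ℝ, F ≤ ∑ j, M.prob j * f j ∧ ∀ j, 0 ≤ f j ∧ f j ≤ 2 * base k L q ∧
    ∀ p' : Fin n → ℝ, (∀ i ∈ D, p' i = p i) → (∀ i ∉ D, base k L q ≤ p' i) →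
      (1 - 4 * (1 / (L : ℝ))) * f j ≤ payment (M.val j) fun i => (1 - 1 / (L : ℝ)) * p' i

theorem inv_bounds (hL : 18 ≤ L) : 0 < 1 / (L : ℝ) ∧ 1 / (L : ℝ) ≤ 1 / 18 := by
  have h : (18 : ℝ) ≤ L := by exact_mod_cast hL
  exact ⟨by positivity, one_div_le_one_div_of_le (by norm_num) h⟩

theorem good_zero (hk : 0 < k) (hL : 18 ≤ L) (q : ℕ) (D : Finset (Fin n)) :
    Good M k L q D 0 fun _ => 0 := by
  have hb := base_pos hk hL q
  obtain ⟨hδ, hδ1⟩ := inv_bounds hL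
  refine ⟨fun _ => le_rfl, fun _ _ => hb.le, le_rfl, fun _ => 0, by simp, fun j =>
    ⟨le_rfl, by linarith, fun p' h1 h2 => ?_⟩⟩
  rw [mul_zero]
  refine payment_nonneg _ fun i => mul_nonneg (by linarith) ?_
  by_cases hi : i ∈ D
  · exact (h1 i hi).ge
  · exact hb.le.trans (h2 i hi)

/-- A payment at least `gap k L` times `β` exceeds the price `β` of `k` items by the factor
`L ^ 2`. -/
theorem gap_ineq (hL : 18 ≤ L) {β x : ℝ} (h : gap k L * β ≤ x) :
    k * β ≤ 1 / (L : ℝ) * (1 / (L : ℝ) * x) := by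
  have hL' : (0 : ℝ) < L := by exact_mod_cast (by omega : 0 < L)
  have h1 : 1 / (L : ℝ) * (1 / (L : ℝ) * (gap k L * β)) ≤ 1 / (L : ℝ) * (1 / (L : ℝ) * x) := by
    gcongr
  refine le_trans (le_of_eq ?_) h1
  unfold gap
  push_cast
  field_simp

/-- Extending a table entry by a block adds the counted payments of the block to the guaranteed
revenue. -/
theorem Good.extend (hM : M.Valid k H) (hL : 18 ≤ L) (hV0 : 0 ≤ V)
    (hV : ∀ j (T : Finset (Fin n)), T.card ≤ k → M.val j T ≤ V) {q e : ℕ} {F : ℝ}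
    {p : Fin n → ℝ} (hF : Good M k L q (lowItems M k L e) F p)
    (hcons : Consistent M k L V q e) {T : Fin m → Finset (Fin n)}
    (hT : ∀ j, Favourite k (M.val j) (hypPrice M k L V q e) (T j)) :
    Good M k L (q + L) (soldItems M k e)
      (F + ∑ j, M.prob j * counted k L q (bundlePrice (hypPrice M k L V q e) (T j)))
      (newPrice M k L V q e p) := by
  classical
  have hk := hM.width_pos
  obtain ⟨hδ, hδ1⟩ := inv_bounds hL
  have hb := base_pos hk hL q
  have hb' := base_pos hk hL (q + L)
  have hmono : base k L q ≤ base k L (q + L) := base_mono hk hL (by omega)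
  have htwo : 2 * base k L q ≤ base k L (q + L) := by
    have h1 := base_mul_zone_le hk hL (q := q) (q' := q + L) (by omega)
    have h2 := zone_ge hk hL
    nlinarith
  have hlow : ∀ i ∈ lowItems M k L e, i ∈ soldItems M k e := by
    intro i hi
    by_contra h
    have h1 := hcons i h
    rw [hypPrice, if_pos hi] at h1
    exact absurd (prohibitive_pos hk hL hV0 q) (by linarith)
  have hunsold : ∀ i ∉ soldItems M k e,
      base k L (q + L) ≤ newPrice M k L V q e p i := by
    intro i hi
    have h1 := hcons i hi
    have h2 : i ∉ lowItems M k L e := fun h => hi (hlow i h)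
    rw [hypPrice, if_neg h2] at h1
    rw [newPrice, if_neg h2]
    refine le_trans ?_ h1
    unfold prohibitive
    linarith
  obtain ⟨f, hFf, hf⟩ := hF.earns
  refine ⟨fun i => ?_, fun i hi => ?_, ?_, ?_⟩
  · unfold newPrice
    split_ifs
    · exact hF.price_nonneg i
    · exact (blockPrice_pos hk hL hV0 q e i).le
  · unfold newPrice
    split_ifs with h
    · exact (hF.price_le i h).trans hmono
    · exact blockPrice_le hk hL hi
  · exact add_nonneg hF.nonneg (Finset.sum_nonneg fun j _ =>
      mul_nonneg (hM.prob_nonneg j) (counted_nonneg hk hL q _))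
  refine ⟨fun j => f j + counted k L q (bundlePrice (hypPrice M k L V q e) (T j)), ?_,
    fun j => ?_⟩
  · simp only [mul_add, Finset.sum_add_distrib]
    linarith
  obtain ⟨hf0, hf2, hfp⟩ := hf j
  have hc0 := counted_nonneg hk hL q (bundlePrice (hypPrice M k L V q e) (T j))
  have hc1 : counted k L q (bundlePrice (hypPrice M k L V q e) (T j)) ≤ base k L (q + L) := by
    unfold counted
    split_ifs
    · exact min_le_right _ _
    · exact hb'.le
  refine ⟨by linarith, by linarith, fun p' hp1 hp2 => ?_⟩
  have hp'0 : ∀ i, 0 ≤ p' i := by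
    intro i
    by_cases hi : i ∈ soldItems M k e
    · rw [hp1 i hi]
      unfold newPrice
      split_ifs
      · exact hF.price_nonneg i
      · exact (blockPrice_pos hk hL hV0 q e i).le
    · exact hb'.le.trans (hp2 i hi)
  by_cases hcnt : gap k L * base k L q ≤ bundlePrice (hypPrice M k L V q e) (T j)
  · -- the payment credited to this block exceeds all earlier ones by far
    have h1 := payment_of_favourite hM hδ (by linarith) hb.le (hT j)
      (fun i => hypPrice_nonneg hk hL hV0 q e i) (D := soldItems M k e) (p := p')
      (β' := base k L (q + L))
      (fun i hi => by
        by_contra h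
        exact absurd ((hT j).price_lt hM hL hV hi) (not_lt.2 (hcons i h)))
      (fun i hi => by
        rw [hp1 i hi]
        by_cases hl : i ∈ lowItems M k L e
        · rw [hypPrice, newPrice, if_pos hl, if_pos hl]
          exact ⟨hF.price_nonneg i, by linarith [hF.price_le i hl]⟩
        · rw [hypPrice, newPrice, if_neg hl, if_neg hl]
          exact ⟨le_rfl, by linarith⟩)
      hp2 hp'0 (gap_ineq hL hcnt)
    refine le_trans ?_ h1
    have hgap : gap k L * base k L q ≤ base k L (q + L) := by
      have h2 := base_mul_zone_le hk hL (q := q) (q' := q + L) (by omega)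
      have h3 := two_mul_gap_le_zone (k := k) (L := L) (by omega)
      have h4 : (0 : ℝ) ≤ gap k L := by positivity
      nlinarith
    simp only [counted_of_le hcnt]
    have hx : gap k L * base k L q ≤
        min (bundlePrice (hypPrice M k L V q e) (T j)) (base k L (q + L)) := le_min hcnt hgap
    generalize min (bundlePrice (hypPrice M k L V q e) (T j)) (base k L (q + L)) = x at hx ⊢
    have hk1 : (1 : ℝ) ≤ k := by exact_mod_cast hk
    have h2 := gap_ineq hL hx
    have hx0 : 0 ≤ x := le_trans (by positivity) hx
    generalize 1 / (L : ℝ) = δ at *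
    have h3 : base k L q ≤ k * base k L q := le_mul_of_one_le_left hb.le hk1
    have h5 : f j ≤ 2 * δ * x := by nlinarith [mul_nonneg hδ.le hx0]
    have h6 : (1 - 4 * δ) * (f j + x) ≤ (1 - 4 * δ) * (2 * δ * x + x) :=
      mul_le_mul_of_nonneg_left (by linarith) (by linarith)
    nlinarith [mul_nonneg (mul_nonneg hδ.le hδ.le) hx0]
  · simp only [counted_of_not_le hcnt, add_zero]
    refine hfp p' (fun i hi => ?_) fun i hi => ?_
    · rw [hp1 i (hlow i hi), newPrice, if_pos hi]
    · by_cases hs : i ∈ soldItems M k e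
      · rw [hp1 i hs, newPrice, if_neg hi]
        exact base_le_blockPrice hk hL hV0 q e i
      · exact hmono.trans (hp2 i hs)

end Soundness

/-! ### Completeness of the enumeration of blocks -/

section Completeness

variable {n m k L : ℕ} {H V : ℝ} {M : Market n m}

theorem levelPrice_eq_big {θ top big x : ℝ} {e r : ℕ} {i : Fin n} (hθ : 1 < θ) (htop : 0 < top)
    (hdig : ∀ t < r, i ∈ down M k (e / (n ^ k + 1) ^ t % (n ^ k + 1)) ↔ x < top / θ ^ t)
    (hx : top ≤ x) : levelPrice M k θ top big e r i = big := by
  induction r with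
  | zero => rfl
  | succ r ih =>
    rw [levelPrice, if_neg, ih fun t ht => hdig t (by omega)]
    rw [hdig r (by omega), not_lt]
    exact (div_le_self htop.le (one_le_pow₀ hθ.le)).trans hx

/-- If digit `t` codes the items of price below `top / θ ^ t`, the level prices round the prices
down to the next level. -/
theorem levelPrice_round {θ top big x : ℝ} {e r : ℕ} {i : Fin n} (hθ : 1 < θ) (htop : 0 < top)
    (hdig : ∀ t < r + 1, i ∈ down M k (e / (n ^ k + 1) ^ t % (n ^ k + 1)) ↔ x < top / θ ^ t)
    (hx : x < top) :
    levelPrice M k θ top big e (r + 1) i ≤ max x (top / θ ^ (r + 1)) ∧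
      x < θ * levelPrice M k θ top big e (r + 1) i := by
  have hθ0 : 0 < θ := by linarith
  have hstep : ∀ t, θ * (top / θ ^ (t + 1)) = top / θ ^ t := by
    intro t
    rw [pow_succ]
    field_simp
  have hin : ∀ t, i ∈ down M k (e / (n ^ k + 1) ^ t % (n ^ k + 1)) → x < top / θ ^ t →
      levelPrice M k θ top big e (t + 1) i ≤ max x (top / θ ^ (t + 1)) ∧
        x < θ * levelPrice M k θ top big e (t + 1) i := by
    intro t h h'
    rw [levelPrice, if_pos h, hstep]
    exact ⟨le_max_right _ _, h'⟩
  induction r with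
  | zero =>
    have h : x < top / θ ^ 0 := by simpa using hx
    exact hin 0 ((hdig 0 (by omega)).2 h) h
  | succ r ih =>
    by_cases h : i ∈ down M k (e / (n ^ k + 1) ^ (r + 1) % (n ^ k + 1))
    · exact hin _ h ((hdig (r + 1) (by omega)).1 h)
    · obtain ⟨h1, h2⟩ := ih fun t ht => hdig t (by omega)
      have h3 := (hdig (r + 1) (by omega)).not.1 h
      rw [not_lt] at h3
      rw [levelPrice, if_neg h]
      rw [max_eq_left h3] at h1
      exact ⟨h1.trans (le_max_left _ _), h2⟩

/-- For monotone prices `q` there are codes of the sets of items below all thresholds, and for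
each block a number `e` that describes the prices `q`, discounted by the factor `1 - 1 / L` and
rounded down. -/
theorem Market.Valid.exists_block (hM : M.Valid k H) (hL : 18 ≤ L) (hV0 : 0 ≤ V)
    {q : Fin n → ℝ} (hq : ∀ i, 0 ≤ q i) (hqm : ∀ i i', M.rel i i' → q i ≤ q i') :
    ∃ cd : ℕ → ℕ, (∀ a, cd a < n ^ k + 1) ∧ ∀ a, ∃ e < (n ^ k + 1) ^ (blockLen k L + 1),
      e / (n ^ k + 1) ^ blockLen k L = cd a ∧ e % (n ^ k + 1) = cd (a + L) ∧
      Consistent M k L V a e ∧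
      ∀ T : Fin m → Finset (Fin n), (∀ j, Favourite k (M.val j) (hypPrice M k L V a e) (T j)) →
        (∀ j (T : Finset (Fin n)), T.card ≤ k → M.val j T ≤ V) →
        ∀ j, base k L a * zone k L ≤ payment (M.val j) q →
          payment (M.val j) q < base k L (a + L) →
          (1 - 3 * (1 / (L : ℝ))) * payment (M.val j) q ≤
            counted k L a (bundlePrice (hypPrice M k L V a e) (T j)) := by
  classical
  have hk := hM.width_pos
  have hLpos : 0 < L := by omega
  obtain ⟨hδ, hδ1⟩ := inv_bounds hL
  have hθ := one_lt_step hLpos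
  -- the digits of `e` are the codes of the sets of items of discounted price below each level
  have hcode : ∀ x : ℝ, ∃ c < n ^ k + 1, ∀ i, i ∈ down M k c ↔ (1 - 1 / (L : ℝ)) * q i < x := by
    intro x
    refine hM.exists_down (D := {i | (1 - 1 / (L : ℝ)) * q i < x}) fun i i' hr hi' => ?_
    exact lt_of_le_of_lt (mul_le_mul_of_nonneg_left (hqm i i' hr) (by linarith)) hi'
  choose code hcode_lt hcode_mem using hcode
  refine ⟨fun a => code (base k L a), fun a => hcode_lt _, fun a => ?_⟩
  obtain ⟨e, he, hdig, hfirst⟩ := exists_digits (blockLen k L)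
    (fun t => code (base k L (a + L) / step L ^ t)) fun t => hcode_lt _
  have hb := base_pos hk hL a
  have htop := base_pos hk hL (a + L)
  have hdiv := base_add_div (k := k) hL a
  have hlast : e % (n ^ k + 1) = code (base k L (a + L)) := by
    have := hdig 0 (blockLen_pos hk hL)
    simpa using this
  rw [hdiv] at hfirst
  have hlow : ∀ i, i ∈ lowItems M k L e ↔ (1 - 1 / (L : ℝ)) * q i < base k L a := by
    intro i
    rw [lowItems, hfirst, hcode_mem]
  have hsold : ∀ i, i ∈ soldItems M k e ↔ (1 - 1 / (L : ℝ)) * q i < base k L (a + L) := by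
    intro i
    rw [soldItems, hlast, hcode_mem]
  have hdig' : ∀ i, ∀ t < blockLen k L,
      i ∈ down M k (e / (n ^ k + 1) ^ t % (n ^ k + 1)) ↔
        (1 - 1 / (L : ℝ)) * q i < base k L (a + L) / step L ^ t := by
    intro i t ht
    rw [hdig t ht, hcode_mem]
  have hround : ∀ i, i ∉ lowItems M k L e → i ∈ soldItems M k e →
      hypPrice M k L V a e i ≤ (1 - 1 / (L : ℝ)) * q i ∧
        (1 - 1 / (L : ℝ)) * q i < step L * hypPrice M k L V a e i := by
    intro i hi hs
    obtain ⟨r, hr⟩ := Nat.exists_eq_succ_of_ne_zero (blockLen_pos hk hL).ne'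
    have h1 := levelPrice_round (M := M) (k := k) (big := prohibitive k L V a) (r := r) hθ htop
      (fun t ht => hdig' i t (by omega)) ((hsold i).1 hs)
    rw [hlow, not_lt] at hi
    rw [← Nat.succ_eq_add_one, ← hr, hdiv, max_eq_left hi] at h1
    rw [hypPrice, if_neg (by rw [hlow, not_lt]; exact hi)]
    exact h1
  have hcons : Consistent M k L V a e := by
    intro i hi
    have hl : i ∉ lowItems M k L e := by
      rw [hlow, not_lt]
      rw [hsold, not_lt] at hi
      exact (base_mono hk hL (by omega)).trans hi
    rw [hypPrice, if_neg hl]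
    rw [hsold, not_lt] at hi
    exact (levelPrice_eq_big hθ htop (hdig' i) hi).ge
  refine ⟨e, he, hfirst, hlast, hcons, fun T hT hV j hlo hhi => ?_⟩
  obtain ⟨S, hS, hSk, hpay⟩ := hM.exists_small_payment j hq
  rw [← hpay] at hlo hhi ⊢
  have hsold_of : ∀ i, q i < base k L (a + L) → i ∈ soldItems M k e := by
    intro i hi
    rw [hsold]
    have : 0 ≤ 1 / (L : ℝ) * q i := mul_nonneg hδ.le (hq i)
    linarith
  -- rounding a price down loses at most the factor `(1 - δ) / (1 + δ ^ 2)`, where `δ = 1 / L`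
  have hmain := (hT j).price_ge (δ := 1 / (L : ℝ)) (b := 2 * base k L a)
    (η := 1 / (L : ℝ) * (1 + 1 / (L : ℝ)) / (1 - 1 / (L : ℝ))) (by linarith) hS hSk
    (fun i hi => by
      by_cases hl : i ∈ lowItems M k L e
      · rw [hypPrice, if_pos hl]
        exact mul_nonneg (by linarith) (hq i)
      · exact (hround i hl (hsold_of i ((le_bundlePrice hq hi).trans_lt hhi))).1)
    (fun i hi => by
      by_cases hl : i ∈ lowItems M k L e
      · rw [hypPrice, if_pos hl]
        rw [hlow] at hl
        have : 1 / (L : ℝ) * q i ≤ 1 / 18 * q i := mul_le_mul_of_nonneg_right hδ1 (hq i)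
        linarith [hq i]
      · have hs : i ∈ soldItems M k e := by
          by_contra h
          exact absurd ((hT j).price_lt hM hL hV hi) (not_lt.2 (hcons i h))
        have h1 := (hround i hl hs).2
        have h2 : 1 + 1 / (L : ℝ) * (1 + 1 / (L : ℝ)) / (1 - 1 / (L : ℝ)) =
            step L / (1 - 1 / (L : ℝ)) := by
          have h3 : (1 - 1 / (L : ℝ)) ≠ 0 := by linarith
          have h4 : step L = 1 + 1 / (L : ℝ) * (1 / (L : ℝ)) := by
            unfold step
            rw [one_div_mul_one_div]
          rw [h4]
          generalize 1 / (L : ℝ) = δ at *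
          field_simp
          ring
        rw [h2]
        have h3 : q i ≤ step L / (1 - 1 / (L : ℝ)) * hypPrice M k L V a e i := by
          rw [div_mul_eq_mul_div, le_div_iff₀ (by linarith)]
          linarith
        linarith)
  have hgz := two_mul_gap_le_zone (k := k) (L := L) hLpos
  have hgap : gap k L * (2 * base k L a) ≤ bundlePrice q S := by nlinarith
  have hkb := gap_ineq hL hgap
  have hqS := bundlePrice_nonneg hq S
  have hhT := bundlePrice_nonneg (fun i => hypPrice_nonneg (M := M) hk hL hV0 a e i) (T j)
  have hge : (1 - 3 * (1 / (L : ℝ))) * bundlePrice q S ≤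
      bundlePrice (hypPrice M k L V a e) (T j) := by
    generalize bundlePrice (hypPrice M k L V a e) (T j) = x at *
    generalize bundlePrice q S = y at *
    generalize 1 / (L : ℝ) = δ at *
    have h1 : δ * y ≤ δ * (1 + δ) / (1 - δ) * x + δ * (δ * y) := hmain.trans (by linarith)
    have h2 : δ * ((1 - δ) * y) ≤ δ * ((1 + δ) / (1 - δ) * x) := by
      calc δ * ((1 - δ) * y) = δ * y - δ * (δ * y) := by ring
        _ ≤ δ * (1 + δ) / (1 - δ) * x := by linarith
        _ = _ := by ring
    have h3 := le_of_mul_le_mul_left h2 hδ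
    rw [div_mul_eq_mul_div, le_div_iff₀ (by linarith)] at h3
    have h4 : (1 + δ) * ((1 - 3 * δ) * y) ≤ (1 + δ) * x := by
      nlinarith [mul_nonneg (mul_nonneg hδ.le hδ.le) hqS]
    exact le_of_mul_le_mul_left h4 (by linarith)
  have hcnt : gap k L * base k L a ≤ bundlePrice (hypPrice M k L V a e) (T j) := by
    refine le_trans ?_ hge
    have : 1 / (L : ℝ) * bundlePrice q S ≤ 1 / 18 * bundlePrice q S :=
      mul_le_mul_of_nonneg_right hδ1 hqS
    linarith
  rw [counted_of_le hcnt]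
  refine le_min hge (le_trans ?_ hhi.le)
  have : 0 ≤ 1 / (L : ℝ) * bundlePrice q S := mul_nonneg hδ.le hqS
  linarith

end Completeness

/-! ### The dynamic program -/

section Table

variable {n m k L : ℕ} {H V : ℝ} {M : Market n m}

/-- The value `x` that the dynamic program computes for the zone `q` and the block described by
`e`, given the table `F` of values. -/
def IsTotal (M : Market n m) (k L : ℕ) (V : ℝ) (q e : ℕ) (F : ℕ → ℝ) (x : ℝ) : Prop :=
  ∃ T : Fin m → Finset (Fin n), (∀ j, Favourite k (M.val j) (hypPrice M k L V q e) (T j)) ∧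
    (Consistent M k L V q e →
      x = F (q * (n ^ k + 1) + e / (n ^ k + 1) ^ blockLen k L) +
        ∑ j, M.prob j * counted k L q (bundlePrice (hypPrice M k L V q e) (T j))) ∧
    (¬ Consistent M k L V q e → x = 0)

/-- The invariant of the dynamic program when the zones before `q` are done and, for the zone
`q`, the blocks described by numbers less than `e`. Row `q * (n ^ k + 1) + c` of the table
belongs to the zone `q` and the down-set with code `c`; `F` holds its value and `P` its prices.
The prices `out` witness the largest value `best` found so far. -/
structure Inv (M : Market n m) (k L : ℕ) (V : ℝ) (q e : ℕ) (F P : ℕ → ℝ) (best : ℝ)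
    (out : Fin n → ℝ) : Prop where
  good : ∀ q' c, c < n ^ k + 1 → Good M k L q' (down M k c) (F (q' * (n ^ k + 1) + c))
    fun i => P ((q' * (n ^ k + 1) + c) * n + i)
  le_best : ∀ a, F a ≤ best
  best_nonneg : 0 ≤ best
  out_nonneg : ∀ i, 0 ≤ out i
  earns : (1 - 4 * (1 / (L : ℝ))) * best ≤ revenue M.val M.prob out
  done : ∀ q' e', e' < (n ^ k + 1) ^ (blockLen k L + 1) → (q' < q ∨ q' = q ∧ e' < e) →
    Consistent M k L V q' e' → ∃ T : Fin m → Finset (Fin n),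
      (∀ j, Favourite k (M.val j) (hypPrice M k L V q' e') (T j)) ∧
      F (q' * (n ^ k + 1) + e' / (n ^ k + 1) ^ blockLen k L) +
        ∑ j, M.prob j * counted k L q' (bundlePrice (hypPrice M k L V q' e') (T j)) ≤
      F ((q' + L) * (n ^ k + 1) + e' % (n ^ k + 1))

theorem inv_zero (hM : M.Valid k H) (hL : 18 ≤ L) :
    Inv M k L V 0 0 (fun _ => 0) (fun _ => 0) 0 fun _ => 0 where
  good q' c _ := good_zero hM.width_pos hL q' _
  le_best _ := le_rfl
  best_nonneg := le_rfl
  out_nonneg _ := le_rfl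
  earns := by
    rw [mul_zero]
    exact Finset.sum_nonneg fun j _ =>
      mul_nonneg (hM.prob_nonneg j) (payment_nonneg _ fun _ => le_rfl)
  done q' e' _ h := by omega

theorem Inv.next_zone {q : ℕ} {F P : ℕ → ℝ} {best : ℝ} {out : Fin n → ℝ}
    (h : Inv M k L V q ((n ^ k + 1) ^ (blockLen k L + 1)) F P best out) :
    Inv M k L V (q + 1) 0 F P best out :=
  { h with done := fun q' e' he' hq' => h.done q' e' he' (by omega) }

/-- Distinct pairs of a row and a column have distinct addresses. -/
theorem row_eq {N q q' c c' : ℕ} (hc : c < N) (hc' : c' < N) (h : q * N + c = q' * N + c') :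
    q = q' ∧ c = c' := by
  have hN : 0 < N := by omega
  have h1 : (q * N + c) / N = q := by
    rw [mul_comm, Nat.mul_add_div hN, Nat.div_eq_of_lt hc, add_zero]
  have h2 : (q' * N + c') / N = q' := by
    rw [mul_comm, Nat.mul_add_div hN, Nat.div_eq_of_lt hc', add_zero]
  have h3 : q = q' := by rw [← h1, h, h2]
  subst h3
  omega

/-- One step of the dynamic program preserves the invariant. The row of the table reached by the
block and the best prices are replaced if the new value exceeds theirs. -/
theorem Inv.next (hM : M.Valid k H) (hL : 18 ≤ L) (hV0 : 0 ≤ V)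
    (hV : ∀ j (T : Finset (Fin n)), T.card ≤ k → M.val j T ≤ V) {q e : ℕ}
    {F P F' P' : ℕ → ℝ} {best best' : ℝ} {out out' : Fin n → ℝ}
    (h : Inv M k L V q e F P best out) (he : e < (n ^ k + 1) ^ (blockLen k L + 1)) {x : ℝ}
    (hx : IsTotal M k L V q e F x) {p : Fin n → ℝ}
    (hp : p = newPrice M k L V q e fun i =>
      P ((q * (n ^ k + 1) + e / (n ^ k + 1) ^ blockLen k L) * n + i))
    {a : ℕ} (ha : a = (q + L) * (n ^ k + 1) + e % (n ^ k + 1))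
    (hFP : (x ≤ F a ∧ F' = F ∧ P' = P) ∨ (F a < x ∧ F' = Function.update F a x ∧
      (∀ i : Fin n, P' (a * n + i) = p i) ∧
      ∀ b, b ≠ a → ∀ i : Fin n, P' (b * n + i) = P (b * n + i)))
    (hbo : (x ≤ best ∧ best' = best ∧ out' = out) ∨
      (best < x ∧ best' = x ∧ out' = fun i => (1 - 1 / (L : ℝ)) * p i)) :
    Inv M k L V q (e + 1) F' P' best' out' := by
  classical
  have hk := hM.width_pos
  have hn := hM.card_pos
  obtain ⟨hδ, hδ1⟩ := inv_bounds hL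
  set N := n ^ k + 1 with hN
  have hNpos : 0 < N := by omega
  have hlast : e % N < N := Nat.mod_lt _ hNpos
  have hfirst : e / N ^ blockLen k L < N := by
    rw [Nat.div_lt_iff_lt_mul (by positivity), ← pow_succ']
    exact he
  have hFa : 0 ≤ F a := by
    rw [ha]
    exact (h.good _ _ hlast).nonneg
  -- a positive new value is guaranteed by the new prices
  have hgood : 0 < x → Good M k L (q + L) (down M k (e % N)) x p := by
    intro hx0
    obtain ⟨T, hT, h1, h2⟩ := hx
    have hc : Consistent M k L V q e := by
      by_contra hc
      rw [h2 hc] at hx0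
      exact lt_irrefl _ hx0
    rw [hp, h1 hc]
    exact (h.good q _ hfirst).extend hM hL hV0 hV hc hT
  have hFF' : ∀ b, F b ≤ F' b := by
    intro b
    rcases hFP with ⟨_, rfl, _⟩ | ⟨h1, rfl, _⟩
    · exact le_rfl
    · rcases eq_or_ne b a with rfl | hb
      · rw [Function.update_self]
        exact h1.le
      · rw [Function.update_of_ne hb]
  have hxF' : x ≤ F' a := by
    rcases hFP with ⟨h1, rfl, _⟩ | ⟨h1, rfl, _⟩
    · exact h1
    · rw [Function.update_self]
  have hsame : ∀ q' ≤ q, ∀ c < N, F' (q' * N + c) = F (q' * N + c) := by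
    intro q' hq' c hc
    rcases hFP with ⟨_, rfl, _⟩ | ⟨_, rfl, _⟩
    · rfl
    · refine Function.update_of_ne (fun h => ?_) _ _
      have := (row_eq hc hlast (h.trans ha)).1
      omega
  have hbest : best ≤ best' ∧ x ≤ best' := by
    rcases hbo with ⟨h1, rfl, _⟩ | ⟨h1, rfl, _⟩
    · exact ⟨le_rfl, h1⟩
    · exact ⟨h1.le, le_rfl⟩
  refine ⟨fun q' c hc => ?_, fun b => ?_, h.best_nonneg.trans hbest.1, fun i => ?_, ?_, ?_⟩
  · rcases hFP with ⟨_, rfl, rfl⟩ | ⟨h1, rfl, h2, h3⟩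
    · exact h.good q' c hc
    · rcases eq_or_ne (q' * N + c) a with hb | hb
      · obtain ⟨rfl, rfl⟩ := row_eq hc hlast (hb.trans ha)
        rw [hb, Function.update_self]
        rw [show (fun i : Fin n => P' (a * n + i)) = p from funext h2]
        exact hgood (by linarith)
      · rw [Function.update_of_ne hb]
        rw [show (fun i : Fin n => P' ((q' * N + c) * n + i)) =
          fun i : Fin n => P ((q' * N + c) * n + i) from funext (h3 _ hb)]
        exact h.good q' c hc
  · rcases hFP with ⟨_, rfl, _⟩ | ⟨_, rfl, _⟩
    · exact (h.le_best b).trans hbest.1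
    · rcases eq_or_ne b a with rfl | hb
      · rw [Function.update_self]
        exact hbest.2
      · rw [Function.update_of_ne hb]
        exact (h.le_best b).trans hbest.1
  · rcases hbo with ⟨_, _, rfl⟩ | ⟨h1, _, rfl⟩
    · exact h.out_nonneg i
    · exact mul_nonneg (by linarith) ((hgood (by linarith [h.best_nonneg])).price_nonneg i)
  · rcases hbo with ⟨_, rfl, rfl⟩ | ⟨h1, rfl, rfl⟩
    · exact h.earns
    · have hx0 : 0 < best' := by linarith [h.best_nonneg]
      obtain ⟨f, hf, hfj⟩ := (hgood hx0).earns
      have hoff : ∀ i ∉ down M k (e % N), base k L (q + L) ≤ p i := by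
        intro i hi
        obtain ⟨T, hT, _, h2⟩ := hx
        have hc : Consistent M k L V q e := by
          by_contra hc
          rw [h2 hc] at hx0
          exact lt_irrefl _ hx0
        have h3 := hc i hi
        have hl : i ∉ lowItems M k L e := by
          intro hl
          rw [hypPrice, if_pos hl] at h3
          exact absurd (prohibitive_pos hk hL hV0 q) (by linarith)
        rw [hypPrice, if_neg hl] at h3
        rw [hp, newPrice, if_neg hl]
        refine le_trans ?_ h3
        unfold prohibitive
        linarith
      calc (1 - 4 * (1 / (L : ℝ))) * best'
          ≤ (1 - 4 * (1 / (L : ℝ))) * ∑ j, M.prob j * f j :=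
            mul_le_mul_of_nonneg_left hf (by linarith)
        _ = ∑ j, M.prob j * ((1 - 4 * (1 / (L : ℝ))) * f j) := by
            rw [Finset.mul_sum]
            exact Finset.sum_congr rfl fun j _ => by ring
        _ ≤ _ := Finset.sum_le_sum fun j _ => mul_le_mul_of_nonneg_left
            ((hfj j).2.2 p (fun _ _ => rfl) hoff) (hM.prob_nonneg j)
  · intro q' e' he' hq' hc
    have hfirst' : e' / N ^ blockLen k L < N := by
      rw [Nat.div_lt_iff_lt_mul (by positivity), ← pow_succ']
      exact he'
    by_cases hnew : q' = q ∧ e' = e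
    · obtain ⟨rfl, rfl⟩ := hnew
      obtain ⟨T, hT, h1, _⟩ := hx
      refine ⟨T, hT, ?_⟩
      rw [hsame q' le_rfl _ hfirst, ← h1 hc, ← ha]
      exact hxF'
    · obtain ⟨T, hT, h1⟩ := h.done q' e' he' (by omega) hc
      refine ⟨T, hT, ?_⟩
      rw [hsame q' (by omega) _ hfirst']
      exact h1.trans (hFF' _)

/-- Each payment lies above the first zone of `L - 1` of the blocks that contain it. -/
theorem sum_counted_ge (hk : 0 < k) (hL : 18 ≤ L) {Q : ℕ} {x : ℝ} {f : ℕ → ℝ}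
    (hxQ : x < base k L Q) (hf0 : ∀ q, 0 ≤ f q)
    (hf : ∀ q < Q, base k L q * zone k L ≤ x → x < base k L (q + L) →
      (1 - 3 * (1 / (L : ℝ))) * x ≤ f q) :
    (L - 1) * ((1 - 3 * (1 / (L : ℝ))) * (x - 1 / ((L : ℝ) * k))) ≤
      ∑ q ∈ Finset.range Q, f q := by
  classical
  have hL' : (18 : ℝ) ≤ L := by exact_mod_cast hL
  have hk' : (0 : ℝ) < k := by exact_mod_cast hk
  obtain ⟨hδ, hδ1⟩ := inv_bounds hL
  have hμ : 0 < 1 / ((L : ℝ) * k) := by positivity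
  have hbL : base k L L = 1 / ((L : ℝ) * k) := by
    have := base_add_eq hk hL 0
    simpa using this
  rcases lt_or_ge x (1 / ((L : ℝ) * k)) with h | h
  · refine le_trans ?_ (Finset.sum_nonneg fun q _ => hf0 q)
    exact mul_nonpos_of_nonneg_of_nonpos (by linarith)
      (mul_nonpos_of_nonneg_of_nonpos (by linarith) (by linarith))
  · have hex : ∃ q, x < base k L q := ⟨Q, hxQ⟩
    obtain ⟨q0, hq0⟩ : ∃ q0, Nat.find hex = q0 := ⟨_, rfl⟩
    have h1 : x < base k L q0 := hq0 ▸ Nat.find_spec hex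
    have h2 : ∀ q < q0, base k L q ≤ x := fun q hq => not_lt.1 (Nat.find_min hex (hq0 ▸ hq))
    have h3 : L < q0 := by
      by_contra hlt
      have := base_mono hk hL (not_lt.1 hlt)
      rw [hbL] at this
      linarith
    have h4 : q0 ≤ Q := hq0 ▸ Nat.find_min' hex hxQ
    have hsub : Finset.Ico (q0 - L) (q0 - 1) ⊆ Finset.range Q := by
      intro q hq
      simp only [Finset.mem_Ico, Finset.mem_range] at hq ⊢
      omega
    calc (L - 1) * ((1 - 3 * (1 / (L : ℝ))) * (x - 1 / ((L : ℝ) * k)))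
        ≤ (L - 1) * ((1 - 3 * (1 / (L : ℝ))) * x) := by
          refine mul_le_mul_of_nonneg_left (mul_le_mul_of_nonneg_left (by linarith) ?_) ?_ <;>
            linarith
      _ = ∑ _q ∈ Finset.Ico (q0 - L) (q0 - 1), (1 - 3 * (1 / (L : ℝ))) * x := by
          rw [Finset.sum_const, Nat.card_Ico, nsmul_eq_mul]
          have : q0 - 1 - (q0 - L) = L - 1 := by omega
          rw [this, Nat.cast_sub (by omega), Nat.cast_one]
      _ ≤ ∑ q ∈ Finset.Ico (q0 - L) (q0 - 1), f q := by
          refine Finset.sum_le_sum fun q hq => ?_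
          rw [Finset.mem_Ico] at hq
          refine hf q (by omega) ?_ ?_
          · exact (base_mul_zone_le hk hL (by omega : q < q0 - 1)).trans (h2 _ (by omega))
          · exact h1.trans_le (base_mono hk hL (by omega))
      _ ≤ _ := Finset.sum_le_sum_of_subset_of_nonneg hsub fun q _ _ => hf0 q

/-- When the zones are exhausted, the best value is almost the revenue of any monotone prices. -/
theorem Inv.best_ge (hM : M.Valid k H) (hL : 18 ≤ L) (hV0 : 0 ≤ V)
    (hV : ∀ j (T : Finset (Fin n)), T.card ≤ k → M.val j T ≤ V) {Q : ℕ} {F P : ℕ → ℝ}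
    {best : ℝ} {out : Fin n → ℝ} (h : Inv M k L V Q 0 F P best out) (hQ : V < base k L Q)
    {q : Fin n → ℝ} (hq : ∀ i, 0 ≤ q i) (hqm : ∀ i i', M.rel i i' → q i ≤ q i') :
    (L - 1) * ((1 - 3 * (1 / (L : ℝ))) * (revenue M.val M.prob q - 1 / ((L : ℝ) * k))) ≤
      L * best := by
  classical
  have hk := hM.width_pos
  obtain ⟨cd, hcd, hblock⟩ := hM.exists_block hL hV0 hq hqm
  choose e he hfirst hlast hcons hcount using hblock
  have hT : ∀ a, ∃ T : Fin m → Finset (Fin n), a < Q →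
      (∀ j, Favourite k (M.val j) (hypPrice M k L V a (e a)) (T j)) ∧
      F (a * (n ^ k + 1) + cd a) +
        ∑ j, M.prob j * counted k L a (bundlePrice (hypPrice M k L V a (e a)) (T j)) ≤
      F ((a + L) * (n ^ k + 1) + cd (a + L)) := by
    intro a
    by_cases ha : a < Q
    · obtain ⟨T, h1, h2⟩ := h.done a (e a) (he a) (.inl ha) (hcons a)
      rw [hfirst, hlast] at h2
      exact ⟨T, fun _ => ⟨h1, h2⟩⟩
    · exact ⟨fun _ => ∅, fun h => absurd h ha⟩
  choose T hT using hT
  -- the values along the `L` interleaved sequences of blocks telescope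
  have htel : ∀ Q' ≤ Q, ∑ a ∈ Finset.range Q', ∑ j, M.prob j *
        counted k L a (bundlePrice (hypPrice M k L V a (e a)) (T a j)) ≤
      ∑ l ∈ Finset.range L, F ((Q' + l) * (n ^ k + 1) + cd (Q' + l)) := by
    intro Q' hQ'
    induction Q' with
    | zero =>
      simp only [Finset.range_zero, Finset.sum_empty]
      exact Finset.sum_nonneg fun l _ => (h.good _ _ (hcd _)).nonneg
    | succ a ih =>
      rw [Finset.sum_range_succ]
      have h1 := (hT a (by omega)).2
      have h2 := ih (by omega)
      have h3 := Finset.sum_range_succ (fun l => F ((a + l) * (n ^ k + 1) + cd (a + l))) L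
      have h4 := Finset.sum_range_succ' (fun l => F ((a + l) * (n ^ k + 1) + cd (a + l))) L
      have h5 : ∑ l ∈ Finset.range L, F ((a + (l + 1)) * (n ^ k + 1) + cd (a + (l + 1))) =
          ∑ l ∈ Finset.range L, F ((a + 1 + l) * (n ^ k + 1) + cd (a + 1 + l)) :=
        Finset.sum_congr rfl fun l _ => by rw [show a + (l + 1) = a + 1 + l by ring]
      rw [h5, add_zero] at h4
      linarith
  have hsum : ∑ l ∈ Finset.range L, F ((Q + l) * (n ^ k + 1) + cd (Q + l)) ≤ L * best := by
    calc ∑ l ∈ Finset.range L, F ((Q + l) * (n ^ k + 1) + cd (Q + l))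
        ≤ ∑ _l ∈ Finset.range L, best := Finset.sum_le_sum fun l _ => h.le_best _
      _ = L * best := by simp
  refine le_trans ?_ ((htel Q le_rfl).trans hsum)
  rw [Finset.sum_comm]
  have hone : 1 / ((L : ℝ) * k) = ∑ j, M.prob j * (1 / ((L : ℝ) * k)) := by
    rw [← Finset.sum_mul, hM.prob_sum, one_mul]
  rw [revenue, hone, ← Finset.sum_sub_distrib, Finset.mul_sum, Finset.mul_sum]
  refine Finset.sum_le_sum fun j _ => ?_
  rw [← Finset.mul_sum]
  obtain ⟨S, hS, hSk, hpay⟩ := hM.exists_small_payment j hq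
  have hpayV : payment (M.val j) q < base k L Q := by
    rw [← hpay]
    exact ((hM.payment_le_val j hS).trans (hV j S hSk)).trans_lt hQ
  have h1 := sum_counted_ge hk hL hpayV
    (f := fun a => counted k L a (bundlePrice (hypPrice M k L V a (e a)) (T a j)))
    (fun a => counted_nonneg hk hL a _)
    (fun a ha h1 h2 => hcount a (T a) (hT a ha).1 hV j h1 h2)
  calc _ = M.prob j * ((L - 1) * ((1 - 3 * (1 / (L : ℝ))) *
        (payment (M.val j) q - 1 / ((L : ℝ) * k)))) := by ring
    _ ≤ _ := mul_le_mul_of_nonneg_left h1 (hM.prob_nonneg j)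

theorem revenue_mono_payment (hM : M.Valid k H) {q q' : Fin n → ℝ}
    (h : ∀ j, payment (M.val j) q ≤ payment (M.val j) q') :
    revenue M.val M.prob q ≤ revenue M.val M.prob q' :=
  Finset.sum_le_sum fun j _ => mul_le_mul_of_nonneg_left (h j) (hM.prob_nonneg j)

/-- When the zones are exhausted, the prices found are almost optimal. -/
theorem Inv.approx (hM : M.Valid k H) (hL : 18 ≤ L) {ε : ℝ} (hLε : 18 ≤ L * ε) (hV0 : 0 ≤ V)
    (hV : ∀ j (T : Finset (Fin n)), T.card ≤ k → M.val j T ≤ V) {Q : ℕ} {F P : ℕ → ℝ}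
    {best : ℝ} {out : Fin n → ℝ} (h : Inv M k L V Q 0 F P best out) (hQ : V < base k L Q)
    {q : Fin n → ℝ} (hq : ∀ i, 0 ≤ q i) :
    revenue M.val M.prob q ≤ (1 + ε) * revenue M.val M.prob out := by
  have hL0 : (0 : ℝ) < L := by exact_mod_cast (by omega : 0 < L)
  have hk0 : (0 : ℝ) < k := by exact_mod_cast hM.width_pos
  obtain ⟨hδ, hδ1⟩ := inv_bounds hL
  -- it suffices to consider prices with revenue at least `1 / k`
  wlog hbig : 1 / (k : ℝ) ≤ revenue M.val M.prob q generalizing q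
  · have hconst : 1 / (k : ℝ) ≤ revenue M.val M.prob fun _ => 1 / (k : ℝ) := by
      calc 1 / (k : ℝ) = ∑ j, M.prob j * (1 / (k : ℝ)) := by
            rw [← Finset.sum_mul, hM.prob_sum, one_mul]
        _ ≤ _ := Finset.sum_le_sum fun j _ =>
            mul_le_mul_of_nonneg_left (hM.payment_const j) (hM.prob_nonneg j)
    exact (not_le.1 hbig).le.trans (hconst.trans (this (fun _ => by positivity) hconst))
  obtain ⟨q', hq', hqm', hpay⟩ := hM.exists_monotone_prices hq
  have h1 := revenue_mono_payment hM hpay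
  have h2 := h.best_ge hM hL hV0 hV hQ hq' hqm'
  have h3 := h.earns
  have h4 : 1 / ((L : ℝ) * k) = 1 / (L : ℝ) * (1 / (k : ℝ)) := by rw [one_div_mul_one_div]
  have h5 : (L : ℝ) * (1 / L) = 1 := by field_simp
  have hε : 18 * (1 / (L : ℝ)) ≤ ε := by
    rw [mul_one_div, div_le_iff₀ hL0]
    linarith
  rw [h4] at h2
  refine h1.trans ?_
  have hR : 1 / (k : ℝ) ≤ revenue M.val M.prob q' := hbig.trans h1
  have hk1 : 0 < 1 / (k : ℝ) := by positivity
  generalize revenue M.val M.prob q' = R at *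
  generalize revenue M.val M.prob out = A at *
  generalize 1 / (k : ℝ) = κ at *
  generalize 1 / (L : ℝ) = δ at *
  have hR0 : 0 < R := by linarith
  have h6 : (L - 1) * ((1 - 3 * δ) * ((1 - δ) * R)) ≤ L * best := by
    refine le_trans (mul_le_mul_of_nonneg_left (mul_le_mul_of_nonneg_left ?_ (by linarith)) ?_) h2
    · nlinarith
    · have : (18 : ℝ) ≤ L := by exact_mod_cast hL
      linarith
  have h7 : (1 - δ) * ((1 - 3 * δ) * ((1 - δ) * R)) ≤ best := by
    have := mul_le_mul_of_nonneg_left h6 hδ.le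
    calc (1 - δ) * ((1 - 3 * δ) * ((1 - δ) * R))
        = δ * ((L - 1) * ((1 - 3 * δ) * ((1 - δ) * R))) := by
          linear_combination (-((1 - 3 * δ) * ((1 - δ) * R))) * h5
      _ ≤ δ * (L * best) := this
      _ = best := by linear_combination best * h5
  have h8 : (1 - 5 * δ) * R ≤ best := by
    refine le_trans ?_ h7
    have : 1 - 5 * δ ≤ (1 - δ) * ((1 - 3 * δ) * (1 - δ)) := by
      nlinarith [mul_nonneg hδ.le hδ.le, mul_nonneg (mul_nonneg hδ.le hδ.le) hδ.le]
    calc (1 - 5 * δ) * R ≤ (1 - δ) * ((1 - 3 * δ) * (1 - δ)) * R :=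
          mul_le_mul_of_nonneg_right this hR0.le
      _ = _ := by ring
  have h9 : (1 - 9 * δ) * R ≤ A := by
    have h10 : (1 - 4 * δ) * ((1 - 5 * δ) * R) ≤ (1 - 4 * δ) * best :=
      mul_le_mul_of_nonneg_left h8 (by linarith)
    nlinarith [mul_nonneg (mul_nonneg hδ.le hδ.le) hR0.le]
  have hA : 0 ≤ A := le_trans (mul_nonneg (by linarith) hR0.le) h9
  calc R ≤ (1 + 18 * δ) * ((1 - 9 * δ) * R) := by
        nlinarith [mul_nonneg hδ.le hR0.le, mul_nonneg (mul_nonneg hδ.le hR0.le)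
          (by linarith : (0 : ℝ) ≤ 1 - 18 * δ)]
    _ ≤ (1 + 18 * δ) * A := mul_le_mul_of_nonneg_left h9 (by linarith)
    _ ≤ (1 + ε) * A := mul_le_mul_of_nonneg_right (by linarith) hA

end Table

/-! ### Memory layout -/

-- Natural scalars: the parameters of the scheme, the offset `nRow` of the current zone in the
-- table, the loop counters `iE`, …, `iMul`, and scratch variables.
local notation "nL" => (2 : ℕ)
local notation "nSq" => (3 : ℕ)
local notation "nGap" => (4 : ℕ)
local notation "nZone" => (5 : ℕ)
local notation "nBlock" => (6 : ℕ)
local notation "nK" => (7 : ℕ)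
local notation "nN" => (8 : ℕ)
local notation "nE" => (9 : ℕ)
local notation "nShift" => (10 : ℕ)
local notation "nRow" => (11 : ℕ)
local notation "iE" => (12 : ℕ)
local notation "iT" => (13 : ℕ)
local notation "iI" => (14 : ℕ)
local notation "iJ" => (15 : ℕ)
local notation "iC" => (16 : ℕ)
local notation "iMul" => (17 : ℕ)
local notation "nY" => (18 : ℕ)
local notation "nQ" => (19 : ℕ)
local notation "nLast" => (20 : ℕ)
local notation "nA" => (21 : ℕ)
local notation "nB" => (22 : ℕ)
local notation "nC" => (23 : ℕ)
-- Natural tables of membership in bundles and in down-sets.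
local notation "tMem" => (24 : ℕ)
local notation "tDown" => (25 : ℕ)
-- Real input and output arrays, followed by real scalars.
local notation "rProb" => (1 : ℕ)
local notation "rVal" => (2 : ℕ)
local notation "rOut" => (3 : ℕ)
local notation "rStep" => (4 : ℕ)
local notation "rZone" => (5 : ℕ)
local notation "rBase" => (6 : ℕ)
local notation "rTop" => (7 : ℕ)
local notation "rV" => (8 : ℕ)
local notation "rBig" => (9 : ℕ)
local notation "rX" => (10 : ℕ)
local notation "rTot" => (11 : ℕ)
local notation "rUtil" => (12 : ℕ)
local notation "rPay" => (13 : ℕ)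
local notation "rSum" => (14 : ℕ)
local notation "rBest" => (15 : ℕ)
-- The hypothetical prices and the new prices of the current block, and the table of the dynamic
-- program, consisting of values and of rows of prices.
local notation "tHyp" => (16 : ℕ)
local notation "tNew" => (17 : ℕ)
local notation "tF" => (18 : ℕ)
local notation "tP" => (19 : ℕ)

/-- The number of items. -/
abbrev inN : NExp := .get 0 (.const 0)

/-- The width. -/
abbrev inK : NExp := .get 0 (.const 1)

/-- The number of types. -/
abbrev inM : NExp := .get 0 (.const 2)

section Body

variable {n m k L Y : ℕ} {H V : ℝ} {M : Market n m}

/-- The input and the quantities computed once and for all are in place. -/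
structure Ready (M : Market n m) (k L : ℕ) (V : ℝ) (s : Memory) : Prop where
  items : s.nat 0 0 = n
  width : s.nat 0 1 = k
  types : s.nat 0 2 = m
  prob : ∀ j : Fin m, s.real rProb j = M.prob j
  val : ∀ (j : Fin m) (c : Fin (n ^ k)), s.real rVal (n ^ k * j + c) = M.val j (codedBundle c)
  len : s.nat nL 0 = L
  gap : s.nat nGap 0 = gap k L
  block : s.nat nBlock 0 = blockLen k L
  bundles : s.nat nK 0 = n ^ k
  codes : s.nat nN 0 = n ^ k + 1
  blocks : s.nat nE 0 = (n ^ k + 1) ^ (blockLen k L + 1)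
  shift : s.nat nShift 0 = (n ^ k + 1) * L
  step : s.real rStep 0 = step L
  zone : s.real rZone 0 = zone k L
  bound : s.real rV 0 = V
  mem : ∀ (c : Fin (n ^ k)) (i : Fin n), (i ∈ codedBundle c → s.nat tMem (c * n + i) = 1) ∧
    (i ∉ codedBundle c → s.nat tMem (c * n + i) = 0)
  down : ∀ c < n ^ k + 1, ∀ i : Fin n, (i ∈ down M k c → s.nat tDown (c * n + i) = 1) ∧
    (i ∉ down M k c → s.nat tDown (c * n + i) = 0)

theorem Ready.of_same {s s' : Memory} (h : Ready M k L V s) {P : Prog} (hs : SameOff P s s')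
    (hn : ∀ a ∈ [0, nL, nGap, nBlock, nK, nN, nE, nShift, tMem, tDown], a ∉ P.natWrites)
    (hr : ∀ a ∈ [rProb, rVal, rStep, rZone, rV], a ∉ P.realWrites) : Ready M k L V s' := by
  simp only [List.mem_cons, List.not_mem_nil, or_false, forall_eq_or_imp, forall_eq] at hn hr
  obtain ⟨h0, h1, h2, h3, h4, h5, h6, h7, h8, h9⟩ := hn
  obtain ⟨g1, g2, g3, g4, g5⟩ := hr
  constructor
  · rw [hs.nat _ h0, h.items]
  · rw [hs.nat _ h0, h.width]
  · rw [hs.nat _ h0, h.types]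
  · intro j; rw [hs.real _ g1, h.prob]
  · intro j c; rw [hs.real _ g2, h.val]
  · rw [hs.nat _ h1, h.len]
  · rw [hs.nat _ h2, h.gap]
  · rw [hs.nat _ h3, h.block]
  · rw [hs.nat _ h4, h.bundles]
  · rw [hs.nat _ h5, h.codes]
  · rw [hs.nat _ h6, h.blocks]
  · rw [hs.nat _ h7, h.shift]
  · rw [hs.real _ g3, h.step]
  · rw [hs.real _ g4, h.zone]
  · rw [hs.real _ g5, h.bound]
  · intro c i; rw [hs.nat _ h8]; exact h.mem c i
  · intro c hc i; rw [hs.nat _ h9]; exact h.down c hc i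

end Body

/-! ### The step of the dynamic program -/

section Body

variable {n m k L Y : ℕ} {H V : ℝ} {M : Market n m}

/-- All items start with a prohibitive price. -/
def resetPrices : Prog :=
  .seq (.letR rBig (.add (.add (rvar rV) (.ofNat (.const 1))) (rvar rTop)))
    (.for iI inN (.setR tHyp (nvar iI) (rvar rBig)))

theorem resetPrices_spec {s : Memory} (h : Ready M k L V s) (hn : n ≤ Y) {q : ℕ}
    (htop : s.real rTop 0 = base k L (q + L)) : Ends Y resetPrices s fun s' =>
      s'.real rBig 0 = prohibitive k L V q ∧
        ∀ i : Fin n, s'.real tHyp i = prohibitive k L V q := by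
  refine Ends.seq (Ends.setR fun _ => ?_)
  refine Ends.for (B := n) (fun t s' => s'.real rBig 0 = prohibitive k L V q ∧
    ∀ i : Fin n, (i : ℕ) < t → s'.real tHyp i = prohibitive k L V q) (by decide) (by decide)
    (by decide) (by simp [h.items]) hn ?_ ?_ ?_
  · simp [prohibitive, h.bound, htop]
  · intro t s' ht hs hi ⟨h1, h2⟩
    refine Ends.setR fun _ => ?_
    simp only [NExp.eval, RExp.eval, hi, h1, setNat_real, setReal_real_self]
    refine ⟨by simp [h1], fun i hit => ?_⟩
    rcases eq_or_ne (i : ℕ) t with rfl | hne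
    · simp
    · rw [Function.update_of_ne hne]
      exact h2 i (by omega)
  · exact fun s' _ hI => ⟨hI.1, fun i => hI.2 i i.2⟩

/-- Reads the digits of the description of a block and lowers the prices accordingly. The leading
digit is left in `nY`. -/
def readLevels : Prog :=
  .seq (.letN nY (nvar iE)) (.seq (.letR rX (rvar rTop))
    (.for iT (nvar nBlock)
      (.seq (.divMod nY nQ (nvar nN))
      (.seq (.letR rX (.div (rvar rX) (rvar rStep)))
      (.seq (.mul iMul nA (nvar nY) inN)
      (.seq (.for iI inN
        (.ite (.leN (.const 1) (.get tDown (.add (nvar nA) (nvar iI))))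
          (.setR tHyp (nvar iI) (rvar rX)) .skip))
        (.letN nY (nvar nQ))))))))

theorem readLevels_spec {s : Memory} (h : Ready M k L V s) (hn : n ≤ Y) (hb : blockLen k L ≤ Y)
    {q e : ℕ} (heY : e ≤ Y) (he : s.nat iE 0 = e) (htop : s.real rTop 0 = base k L (q + L))
    (hhyp : ∀ i : Fin n, s.real tHyp i = prohibitive k L V q) : Ends Y readLevels s fun s' =>
      s'.nat nY 0 = e / (n ^ k + 1) ^ blockLen k L ∧
        ∀ i : Fin n, s'.real tHyp i = blockPrice M k L V q e i := by
  refine Ends.seq (Ends.setN fun hs1 => Ends.seq (Ends.setR fun hs2 => ?_))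
  refine Ends.for (B := blockLen k L) (fun t s' => s'.nat nY 0 = e / (n ^ k + 1) ^ t ∧
    s'.real rX 0 = base k L (q + L) / step L ^ t ∧ ∀ i : Fin n, s'.real tHyp i =
      levelPrice M k (step L) (base k L (q + L)) (prohibitive k L V q) e t i)
    (by decide) (by decide) (by decide) (by simp [h.block]) hb ?_ ?_ ?_
  · refine ⟨by simp [he], by simp [htop], fun i => ?_⟩
    simp [hhyp, levelPrice]
  · intro t s1 ht hs hit ⟨h1, h2, h3⟩
    have hR1 : Ready M k L V s1 := ((h.of_same hs1 (by decide) (by decide)).of_same hs2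
      (by decide) (by decide)).of_same hs (by decide) (by decide)
    refine Ends.seq (Ends.divMod (by decide) (by decide) (by simp [hR1.codes]) ?_ ?_)
    · rw [h1]
      exact (Nat.div_le_self _ _).trans heY
    intro s2 hs2 h4 h5 _
    have hR2 := hR1.of_same hs2 (by decide) (by decide)
    simp only [NExp.eval, hR1.codes, h1] at h4 h5
    refine Ends.seq (Ends.setR fun hs3 => ?_)
    refine Ends.seq (Ends.mul (by decide) (by decide) (by decide) (by simp [hR2.items, hn]) ?_)
    intro s4 hs4 h6 _
    have hR4 := (hR2.of_same hs3 (by decide) (by decide)).of_same hs4 (by decide) (by decide)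
    have hX : s4.real rX 0 = base k L (q + L) / step L ^ (t + 1) := by
      rw [hs4.real _ (by decide)]
      simp only [NExp.eval, RExp.eval, setReal_real_self, Function.update_self, hR2.step]
      rw [hs2.real _ (by decide), h2, div_div, pow_succ]
    have hH4 : s4.real tHyp = s1.real tHyp := by
      rw [hs4.real _ (by decide), hs3.real _ (by decide), hs2.real _ (by decide)]
    have hQ4 : s4.nat nQ 0 = e / (n ^ k + 1) ^ (t + 1) := by
      rw [hs4.nat _ (by decide), hs3.nat _ (by decide), h5, Nat.div_div_eq_div_mul, pow_succ]
    simp only [NExp.eval, setReal_nat, h4, hR2.items] at h6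
    refine Ends.seq ?_
    refine Ends.for (B := n) (fun l s' => ∀ i : Fin n,
      ((i : ℕ) < l → s'.real tHyp i = levelPrice M k (step L) (base k L (q + L))
        (prohibitive k L V q) e (t + 1) i) ∧
      (l ≤ (i : ℕ) → s'.real tHyp i = levelPrice M k (step L) (base k L (q + L))
        (prohibitive k L V q) e t i)) (by decide) (by decide)
      (by decide) (by simp [hR4.items]) hn ?_ ?_ ?_
    · intro i
      refine ⟨by omega, fun _ => ?_⟩
      rw [setNat_real, hH4]
      exact h3 i
    · intro l s5 hl hs5 hi5 hI
      have hR5 := hR4.of_same hs5 (by decide) (by decide)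
      have hA5 : s5.nat nA 0 = e / (n ^ k + 1) ^ t % (n ^ k + 1) * n := by
        rw [hs5.nat _ (by decide), h6]
      have hX5 : s5.real rX 0 = base k L (q + L) / step L ^ (t + 1) := by
        rw [hs5.real _ (by decide), hX]
      have hd := hR5.down (e / (n ^ k + 1) ^ t % (n ^ k + 1)) (Nat.mod_lt _ (by omega)) ⟨l, hl⟩
      simp only at hd
      refine Ends.ite (fun hb => ?_) fun hb => ?_
      · simp only [BExp.Holds, NExp.eval, hA5, hi5] at hb
        refine Ends.setR fun _ => ?_
        simp only [NExp.eval, RExp.eval, hi5, hX5, setNat_real, setReal_real_self]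
        intro i
        refine ⟨fun hil => ?_, fun hil => ?_⟩
        · rcases eq_or_ne (i : ℕ) l with rfl | hne
          · rw [Function.update_self, levelPrice, if_pos]
            by_contra hc
            have := hd.2 hc
            omega
          · rw [Function.update_of_ne hne]
            exact (hI i).1 (by omega)
        · rw [Function.update_of_ne (by omega)]
          exact (hI i).2 (by omega)
      · simp only [BExp.Holds, NExp.eval, hA5, hi5] at hb
        refine Ends.skip fun _ i => ?_
        simp only [setNat_real]
        refine ⟨fun hil => ?_, fun hil => (hI i).2 (by omega)⟩
        rcases eq_or_ne (i : ℕ) l with rfl | hne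
        · rw [levelPrice, if_neg]
          · exact (hI i).2 le_rfl
          · intro hc
            have := hd.1 hc
            omega
        · exact (hI i).1 (by omega)
    · intro s5 hs5 hI _
      refine Ends.setN fun _ => ?_
      refine ⟨?_, ?_, fun i => ?_⟩
      · simp [hs5.nat nQ (by decide), hQ4]
      · simp only [setNat_real]
        rw [hs5.real _ (by decide), hX]
      · simp only [setNat_real]
        exact (hI i).1 i.2
  · exact fun s' _ hI => ⟨hI.1, hI.2.2⟩

end Body

section Body

variable {n m k L Y : ℕ} {H V : ℝ} {M : Market n m}

/-- Items below the block become free in the hypothetical market and keep their old prices in the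
new price vector. -/
def applyLow : Prog :=
  .seq (.mul iMul nA (nvar nY) inN) (.seq (.mul iMul nB (.add (nvar nRow) (nvar nY)) inN)
    (.for iI inN
      (.seq (.setR tNew (nvar iI) (.get tHyp (nvar iI)))
        (.ite (.leN (.const 1) (.get tDown (.add (nvar nA) (nvar iI))))
          (.seq (.setR tHyp (nvar iI) (.ofNat (.const 0)))
            (.setR tNew (nvar iI) (.get tP (.add (nvar nB) (nvar iI)))))
          .skip))))

theorem applyLow_spec {s : Memory} (h : Ready M k L V s) (hn : n ≤ Y) {q e : ℕ}
    (hlt : e / (n ^ k + 1) ^ blockLen k L < n ^ k + 1)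
    (hy : s.nat nY 0 = e / (n ^ k + 1) ^ blockLen k L) (hrow : s.nat nRow 0 = q * (n ^ k + 1))
    (hhyp : ∀ i : Fin n, s.real tHyp i = blockPrice M k L V q e i) : Ends Y applyLow s fun s' =>
      ∀ i : Fin n, s'.real tHyp i = hypPrice M k L V q e i ∧
        s'.real tNew i = newPrice M k L V q e (fun i => s.real tP
          ((q * (n ^ k + 1) + e / (n ^ k + 1) ^ blockLen k L) * n + i)) i := by
  refine Ends.seq (Ends.mul (by decide) (by decide) (by decide) (by simp [h.items, hn]) ?_)
  intro s1 hs1 hA _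
  have hR1 := h.of_same hs1 (by decide) (by decide)
  refine Ends.seq (Ends.mul (by decide) (by decide) (by decide) (by simp [hR1.items, hn]) ?_)
  intro s2 hs2 hB _
  have hR2 := hR1.of_same hs2 (by decide) (by decide)
  simp only [NExp.eval, h.items, hy] at hA
  simp only [NExp.eval, hR1.items, hs1.nat nRow (by decide), hs1.nat nY (by decide), hy,
    hrow] at hB
  have hHyp2 : s2.real tHyp = s.real tHyp := by
    rw [hs2.real _ (by decide), hs1.real _ (by decide)]
  have hP2 : s2.real tP = s.real tP := by
    rw [hs2.real _ (by decide), hs1.real _ (by decide)]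
  refine Ends.for (B := n) (fun l s' => ∀ i : Fin n,
    ((i : ℕ) < l → s'.real tHyp i = hypPrice M k L V q e i ∧
        s'.real tNew i = newPrice M k L V q e (fun i => s.real tP
          ((q * (n ^ k + 1) + e / (n ^ k + 1) ^ blockLen k L) * n + i)) i) ∧
    (l ≤ (i : ℕ) → s'.real tHyp i = blockPrice M k L V q e i))
    (by decide) (by decide) (by decide) (by simp [hR2.items]) hn ?_ ?_ ?_
  · intro i
    exact ⟨by omega, fun _ => by rw [setNat_real, hHyp2, hhyp]⟩
  · intro l s3 hl hs3 hi3 hI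
    have hR3 := hR2.of_same hs3 (by decide) (by decide)
    have hA3 : s3.nat nA 0 = e / (n ^ k + 1) ^ blockLen k L * n := by
      rw [hs3.nat _ (by decide), hs2.nat _ (by decide), hA]
    have hB3 : s3.nat nB 0 = (q * (n ^ k + 1) + e / (n ^ k + 1) ^ blockLen k L) * n := by
      rw [hs3.nat _ (by decide), hB]
    have hP3 : s3.real tP = s.real tP := by rw [hs3.real _ (by decide), hP2]
    have hd := hR3.down _ hlt ⟨l, hl⟩
    have hHl := (hI ⟨l, hl⟩).2 le_rfl
    simp only at hd hHl
    refine Ends.seq (Ends.setR fun _ => ?_)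
    refine Ends.ite (fun hb => ?_) fun hb => ?_
    · simp only [BExp.Holds, NExp.eval, setReal_nat, hA3, hi3] at hb
      have hin : (⟨l, hl⟩ : Fin n) ∈ lowItems M k L e := by
        by_contra hc
        have := hd.2 hc
        omega
      refine Ends.seq (Ends.setR fun _ => Ends.setR fun _ i => ?_)
      simp only [NExp.eval, RExp.eval, setReal_nat, hi3, hB3, setNat_real]
      simp only [ne_eq, not_false_eq_true, Nat.reduceEqDiff,
        setReal_real_self, setReal_real_of_ne, hP3]
      refine ⟨fun hil => ?_, fun hil => ?_⟩
      · rcases eq_or_ne (i : ℕ) l with rfl | hne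
        · simp only [Function.update_self, Nat.cast_zero]
          rw [hypPrice, newPrice, if_pos hin, if_pos hin]
          exact ⟨rfl, rfl⟩
        · simp only [Function.update_of_ne hne]
          exact (hI i).1 (by omega)
      · simp only [Function.update_of_ne (show (i : ℕ) ≠ l by omega)]
        exact (hI i).2 (by omega)
    · simp only [BExp.Holds, NExp.eval, setReal_nat, hA3, hi3] at hb
      have hin : (⟨l, hl⟩ : Fin n) ∉ lowItems M k L e := by
        intro hc
        have := hd.1 hc
        omega
      refine Ends.skip fun _ i => ?_
      simp only [NExp.eval, RExp.eval, hi3, setNat_real]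
      simp only [ne_eq, not_false_eq_true, Nat.reduceEqDiff,
        setReal_real_self, setReal_real_of_ne]
      refine ⟨fun hil => ?_, fun hil => (hI i).2 (by omega)⟩
      rcases eq_or_ne (i : ℕ) l with rfl | hne
      · simp only [Function.update_self]
        rw [hypPrice, newPrice, if_neg hin, if_neg hin]
        exact ⟨hHl, hHl⟩
      · simp only [Function.update_of_ne hne]
        exact (hI i).1 (by omega)
  · exact fun s' _ hI i => (hI i).1 i.2

/-- Finds a favourite bundle of type `iJ` and its price in the hypothetical market. -/
def chooseBundle : Prog :=
  .seq (.letR rUtil (.ofNat (.const 0))) (.seq (.letR rPay (.ofNat (.const 0)))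
  (.seq (.mul iMul nC (nvar nK) (nvar iJ))
    (.for iC (nvar nK)
      (.seq (.letR rSum (.ofNat (.const 0)))
      (.seq (.mul iMul nA (nvar iC) inN)
      (.seq (.for iI inN (.letR rSum (.add (rvar rSum)
          (.mul (.ofNat (.get tMem (.add (nvar nA) (nvar iI)))) (.get tHyp (nvar iI))))))
        (.ite (.leR (.sub (.get rVal (.add (nvar nC) (nvar iC))) (rvar rSum)) (rvar rUtil)) .skip
          (.seq (.letR rUtil (.sub (.get rVal (.add (nvar nC) (nvar iC))) (rvar rSum)))
            (.letR rPay (rvar rSum))))))))))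

theorem sum_range_eq_bundlePrice (h : Fin n → ℝ) (S : Finset (Fin n)) (g : ℕ → ℝ)
    (hg : ∀ i : Fin n, (i ∈ S → g i = h i) ∧ (i ∉ S → g i = 0)) :
    ∑ i ∈ Finset.range n, g i = bundlePrice h S := by
  classical
  rw [Finset.sum_range, bundlePrice, ← Finset.sum_subset (Finset.subset_univ S)
    fun i _ hi => (hg i).2 hi]
  exact Finset.sum_congr rfl fun i hi => (hg i).1 hi

theorem chooseBundle_spec {s : Memory} (h : Ready M k L V s) (hM : M.Valid k H) (hn : n ≤ Y)
    (hm : m ≤ Y) (hK : n ^ k ≤ Y) {q e : ℕ} (j : Fin m) (hj : s.nat iJ 0 = j)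
    (hhyp : ∀ i : Fin n, s.real tHyp i = hypPrice M k L V q e i) :
    Ends Y chooseBundle s fun s' => ∃ T, Favourite k (M.val j) (hypPrice M k L V q e) T ∧
      s'.real rPay 0 = bundlePrice (hypPrice M k L V q e) T := by
  refine Ends.seq (Ends.setR fun hs1 => Ends.seq (Ends.setR fun hs2 => ?_))
  have h' := (h.of_same hs1 (by decide) (by decide)).of_same hs2 (by decide) (by decide)
  refine Ends.seq (Ends.mul (by decide) (by decide) (by decide) ?_ ?_)
  · simp only [NExp.eval, setReal_nat, hj]
    omega
  intro s3 hs3 hC _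
  have hR3 := h'.of_same hs3 (by decide) (by decide)
  simp only [NExp.eval, setReal_nat, hj, h.bundles] at hC
  have hH3 : s3.real tHyp = s.real tHyp := by
    rw [hs3.real _ (by decide), hs2.real _ (by decide), hs1.real _ (by decide)]
  refine Ends.for (B := n ^ k) (fun c s' => ∃ T : Finset (Fin n), T.card ≤ k ∧
    s'.real rUtil 0 = M.val j T - bundlePrice (hypPrice M k L V q e) T ∧
    s'.real rPay 0 = bundlePrice (hypPrice M k L V q e) T ∧ 0 ≤ s'.real rUtil 0 ∧
    ∀ c' : Fin (n ^ k), (c' : ℕ) < c → M.val j (codedBundle c') -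
      bundlePrice (hypPrice M k L V q e) (codedBundle c') ≤ s'.real rUtil 0)
    (by decide) (by decide) (by decide) (by simp [hR3.bundles]) hK ?_ ?_ ?_
  · refine ⟨∅, by simp, ?_, ?_, ?_, by omega⟩
    · simp [hs3.real rUtil (by decide), hM.empty]
    · simp [hs3.real rPay (by decide)]
    · simp [hs3.real rUtil (by decide)]
  · intro c s4 hc hs4 hi4 ⟨T, hTk, hTu, hTp, hu0, hall⟩
    have hR4 := hR3.of_same hs4 (by decide) (by decide)
    refine Ends.seq (Ends.setR fun hs5 => ?_)
    have hR5 := hR4.of_same hs5 (by decide) (by decide)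
    refine Ends.seq (Ends.mul (by decide) (by decide) (by decide) (by simp [hR4.items, hn]) ?_)
    intro s6 hs6 hA _
    have hR6 := hR5.of_same hs6 (by decide) (by decide)
    simp only [NExp.eval, setReal_nat, hi4, hR4.items] at hA
    have hH6 : s6.real tHyp = s.real tHyp := by
      rw [hs6.real _ (by decide), hs5.real _ (by decide), hs4.real _ (by decide), hH3]
    refine Ends.seq ?_
    refine Ends.for (B := n) (fun l s' => s'.real rSum 0 =
      ∑ i ∈ Finset.range l, (s6.nat tMem (c * n + i) : ℝ) * s6.real tHyp i)
      (by decide) (by decide) (by decide) (by simp [hR6.items]) hn ?_ ?_ ?_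
    · simp [hs6.real rSum (by decide)]
    · intro l s7 hl hs7 hi7 hI
      refine Ends.setR fun _ => ?_
      simp only [NExp.eval, RExp.eval, setNat_real, setReal_real_self, Function.update_self, hI,
        hi7, hs7.nat nA (by decide), hs7.nat tMem (by decide), hs7.real tHyp (by decide), hA,
        Finset.sum_range_succ]
    · intro s7 hs7 hI _
      have hR7 := hR6.of_same hs7 (by decide) (by decide)
      rw [sum_range_eq_bundlePrice (hypPrice M k L V q e) (codedBundle ⟨c, hc⟩)] at hI
      swap
      · intro i
        have := hR6.mem ⟨c, hc⟩ i
        refine ⟨fun hi => ?_, fun hi => ?_⟩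
        · rw [this.1 hi, hH6, hhyp, Nat.cast_one, one_mul]
        · rw [this.2 hi, Nat.cast_zero, zero_mul]
      have hu7 : s7.real rUtil = s4.real rUtil := by
        rw [hs7.real _ (by decide), hs6.real _ (by decide), hs5.real _ (by decide)]
      have hp7 : s7.real rPay = s4.real rPay := by
        rw [hs7.real _ (by decide), hs6.real _ (by decide), hs5.real _ (by decide)]
      have hC7 : s7.nat nC 0 = n ^ k * j := by
        rw [hs7.nat _ (by decide), hs6.nat _ (by decide), hs5.nat _ (by decide),
          hs4.nat _ (by decide), hC]
      have hi7 : s7.nat iC 0 = c := by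
        rw [hs7.nat _ (by decide), hs6.nat _ (by decide), hs5.nat _ (by decide), hi4]
      have hv := hR7.val j ⟨c, hc⟩
      simp only at hv
      refine Ends.ite (fun hb => ?_) fun hb => ?_
      · simp only [BExp.Holds, RExp.eval, NExp.eval, hC7, hi7, hv, hI, hu7] at hb
        refine Ends.skip fun _ => ⟨T, hTk, ?_⟩
        simp only [setNat_real, hu7, hp7]
        refine ⟨hTu, hTp, hu0, fun c' hc' => ?_⟩
        rcases eq_or_ne (c' : ℕ) c with rfl | hne
        · exact hb
        · exact hall c' (by omega)
      · simp only [BExp.Holds, RExp.eval, NExp.eval, hC7, hi7, hv, hI, hu7, not_le] at hb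
        refine Ends.seq (Ends.setR fun _ => Ends.setR fun _ =>
          ⟨codedBundle ⟨c, hc⟩, card_codedBundle _, ?_⟩)
        simp only [NExp.eval, RExp.eval, setNat_real, ne_eq, not_false_eq_true,
          Nat.reduceEqDiff, setReal_real_self, setReal_real_of_ne, Function.update_self, hC7,
          hi7, hv, hI, true_and]
        refine ⟨by linarith, fun c' hc' => ?_⟩
        rcases eq_or_ne (c' : ℕ) c with rfl | hne
        · exact le_rfl
        · exact (hall c' (by omega)).trans hb.le
  · rintro s4 _ ⟨T, hTk, hTu, hTp, hu0, hall⟩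
    refine ⟨T, ⟨hTk, fun T' hT' => ?_⟩, hTp⟩
    rw [← hTu]
    rcases T'.eq_empty_or_nonempty with rfl | hne
    · rw [hM.empty, bundlePrice_empty, sub_zero]
      exact hu0
    · obtain ⟨c, rfl⟩ := exists_codedBundle hne hT'
      exact hall c c.2

/-- Adds the credited payments of all types to the value of the row that the block starts from. -/
def addTypes : Prog :=
  .seq (.letR rTot (.get tF (.add (nvar nRow) (nvar nY))))
    (.for iJ inM (.seq chooseBundle
      (.ite (.leR (.mul (.ofNat (nvar nGap)) (rvar rBase)) (rvar rPay))
        (.ite (.leR (rvar rPay) (rvar rTop))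
          (.letR rTot (.add (rvar rTot) (.mul (.get rProb (nvar iJ)) (rvar rPay))))
          (.letR rTot (.add (rvar rTot) (.mul (.get rProb (nvar iJ)) (rvar rTop)))))
        .skip)))

theorem addTypes_spec {s : Memory} (h : Ready M k L V s) (hM : M.Valid k H) (hn : n ≤ Y)
    (hm : m ≤ Y) (hK : n ^ k ≤ Y) {q e y : ℕ}
    (hhyp : ∀ i : Fin n, s.real tHyp i = hypPrice M k L V q e i)
    (hrow : s.nat nRow 0 = q * (n ^ k + 1)) (hy : s.nat nY 0 = y)
    (hbase : s.real rBase 0 = base k L q) (htop : s.real rTop 0 = base k L (q + L)) :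
    Ends Y addTypes s fun s' => ∃ T : Fin m → Finset (Fin n),
      (∀ j, Favourite k (M.val j) (hypPrice M k L V q e) (T j)) ∧
      s'.real rTot 0 = s.real tF (q * (n ^ k + 1) + y) +
        ∑ j, M.prob j * counted k L q (bundlePrice (hypPrice M k L V q e) (T j)) := by
  classical
  refine Ends.seq (Ends.setR fun hs1 => ?_)
  have hR1 := h.of_same hs1 (by decide) (by decide)
  refine Ends.for (B := m) (fun l s' => ∃ T : Fin m → Finset (Fin n),
      (∀ j : Fin m, (j : ℕ) < l → Favourite k (M.val j) (hypPrice M k L V q e) (T j)) ∧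
      s'.real rTot 0 = s.real tF (q * (n ^ k + 1) + y) +
        ∑ j : Fin m, if (j : ℕ) < l then
          M.prob j * counted k L q (bundlePrice (hypPrice M k L V q e) (T j)) else 0)
    (by decide) (by decide) (by decide) (by simp [h.types]) hm ?_ ?_ ?_
  · refine ⟨fun _ => ∅, fun _ h => absurd h (by omega), ?_⟩
    simp [hrow, hy]
  · intro l s2 hl hs2 hi2 ⟨T, hT, htot⟩
    have hR2 := hR1.of_same hs2 (by decide) (by decide)
    refine Ends.seq ((chooseBundle_spec hR2 hM hn hm hK ⟨l, hl⟩ hi2 (q := q) (e := e)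
      fun i => ?_).mono ?_)
    · rw [hs2.real _ (by decide), hs1.real _ (by decide), hhyp]
    intro s3 hs3 ⟨S, hS, hpay⟩ _
    have hR3 := hR2.of_same hs3 (by decide) (by decide)
    have htot3 : s3.real rTot = s2.real rTot := hs3.real _ (by decide)
    have hi3 : s3.nat iJ 0 = l := by rw [hs3.nat _ (by decide), hi2]
    have hbase3 : s3.real rBase 0 = base k L q := by
      rw [hs3.real _ (by decide), hs2.real _ (by decide), hs1.real _ (by decide), hbase]
    have htop3 : s3.real rTop 0 = base k L (q + L) := by
      rw [hs3.real _ (by decide), hs2.real _ (by decide), hs1.real _ (by decide), htop]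
    have hprob := hR3.prob ⟨l, hl⟩
    simp only at hprob
    -- the invariant is restored once the credited payment of type `l` is added
    have key : ∀ x : ℝ, x = s2.real rTot 0 + M.prob ⟨l, hl⟩ * counted k L q
          (bundlePrice (hypPrice M k L V q e) S) →
        ∃ T : Fin m → Finset (Fin n),
          (∀ j : Fin m, (j : ℕ) < l + 1 →
            Favourite k (M.val j) (hypPrice M k L V q e) (T j)) ∧
          x = s.real tF (q * (n ^ k + 1) + y) +
            ∑ j : Fin m, if (j : ℕ) < l + 1 then
              M.prob j * counted k L q (bundlePrice (hypPrice M k L V q e) (T j)) else 0 := by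
      intro x hx
      refine ⟨Function.update T ⟨l, hl⟩ S, fun j hj => ?_, ?_⟩
      · rcases eq_or_ne j ⟨l, hl⟩ with rfl | hne
        · rw [Function.update_self]
          exact hS
        · rw [Function.update_of_ne hne]
          have : (j : ℕ) ≠ l := fun h => hne (Fin.ext h)
          exact hT j (by omega)
      · rw [hx, htot, add_assoc]
        congr 1
        rw [← Finset.add_sum_erase _ _ (Finset.mem_univ (⟨l, hl⟩ : Fin m)),
          ← Finset.add_sum_erase _ _ (Finset.mem_univ (⟨l, hl⟩ : Fin m))]
        simp only [lt_irrefl, if_false, Nat.lt_succ_self, if_true, Function.update_self, zero_add]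
        rw [add_comm]
        congr 1
        refine Finset.sum_congr rfl fun j hj => ?_
        have hne := Finset.ne_of_mem_erase hj
        have : (j : ℕ) ≠ l := fun h => hne (Fin.ext h)
        rw [Function.update_of_ne hne]
        by_cases hjl : (j : ℕ) < l
        · rw [if_pos hjl, if_pos (by omega)]
        · rw [if_neg hjl, if_neg (by omega)]
    refine Ends.ite (fun hb => ?_) fun hb => ?_
    · simp only [BExp.Holds, RExp.eval, NExp.eval, hR3.gap, hbase3, hpay] at hb
      refine Ends.ite (fun hc => ?_) fun hc => ?_
      · simp only [BExp.Holds, RExp.eval, NExp.eval, htop3, hpay] at hc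
        refine Ends.setR fun _ => ?_
        simp only [RExp.eval, NExp.eval, setNat_real, setReal_real_self, Function.update_self]
        refine key _ ?_
        rw [htot3, hi3, hprob, hpay, counted_of_le hb, min_eq_left hc]
      · simp only [BExp.Holds, RExp.eval, NExp.eval, htop3, hpay, not_le] at hc
        refine Ends.setR fun _ => ?_
        simp only [RExp.eval, NExp.eval, setNat_real, setReal_real_self, Function.update_self]
        refine key _ ?_
        rw [htot3, hi3, hprob, htop3, counted_of_le hb, min_eq_right hc.le]
    · simp only [BExp.Holds, RExp.eval, NExp.eval, hR3.gap, hbase3, hpay] at hb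
      refine Ends.skip fun _ => ?_
      simp only [setNat_real]
      refine key _ ?_
      rw [htot3, counted_of_not_le hb, mul_zero, add_zero]
  · rintro s2 _ ⟨T, hT, htot⟩
    refine ⟨T, fun j => hT j j.2, ?_⟩
    rw [htot]
    simp

end Body

section Body

variable {n m k L Y : ℕ} {H V : ℝ} {M : Market n m}

/-- Reads the last digit of the description of a block. -/
def readLast : Prog :=
  .seq (.letN nY (nvar iE)) (.seq (.divMod nY nQ (nvar nN)) (.letN nLast (nvar nY)))

theorem readLast_spec {s : Memory} (h : Ready M k L V s) {e : ℕ} (heY : e ≤ Y)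
    (he : s.nat iE 0 = e) : Ends Y readLast s fun s' => s'.nat nLast 0 = e % (n ^ k + 1) := by
  refine Ends.seq (Ends.setN fun hs1 => ?_)
  have hR1 := h.of_same hs1 (by decide) (by decide)
  refine Ends.seq (Ends.divMod (by decide) (by decide) (by simp [h.codes]) (by simp [he, heY]) ?_)
  intro s2 hs2 h1 _ _
  refine Ends.setN ?_
  simp [h1, he, h.codes]

/-- Discards the value of a block description that is not consistent. -/
def checkConsistent : Prog :=
  .seq (.mul iMul nA (nvar nLast) inN)
    (.for iI inN
      (.ite (.and (.leN (.get tDown (.add (nvar nA) (nvar iI))) (.const 0))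
          (.not (.leR (rvar rBig) (.get tHyp (nvar iI)))))
        (.letR rTot (.ofNat (.const 0))) .skip))

theorem checkConsistent_spec {s : Memory} (h : Ready M k L V s) (hn : n ≤ Y) {q e : ℕ}
    (hlast : s.nat nLast 0 = e % (n ^ k + 1)) (hbig : s.real rBig 0 = prohibitive k L V q)
    (hhyp : ∀ i : Fin n, s.real tHyp i = hypPrice M k L V q e i) :
    Ends Y checkConsistent s fun s' =>
      (Consistent M k L V q e → s'.real rTot 0 = s.real rTot 0) ∧
      (¬ Consistent M k L V q e → s'.real rTot 0 = 0) := by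
  refine Ends.seq (Ends.mul (by decide) (by decide) (by decide) (by simp [h.items, hn]) ?_)
  intro s1 hs1 hA _
  have hR1 := h.of_same hs1 (by decide) (by decide)
  simp only [NExp.eval, h.items, hlast] at hA
  refine Ends.for (B := n) (fun l s' =>
      ((∀ i : Fin n, (i : ℕ) < l → i ∉ soldItems M k e →
        prohibitive k L V q ≤ hypPrice M k L V q e i) → s'.real rTot 0 = s.real rTot 0) ∧
      ((¬ ∀ i : Fin n, (i : ℕ) < l → i ∉ soldItems M k e →
        prohibitive k L V q ≤ hypPrice M k L V q e i) → s'.real rTot 0 = 0))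
    (by decide) (by decide) (by decide) (by simp [hR1.items]) hn ?_ ?_ ?_
  · refine ⟨fun _ => ?_, fun hc => absurd (fun i hi => absurd hi (by omega)) hc⟩
    rw [setNat_real, hs1.real _ (by decide)]
  · intro l s2 hl hs2 hi2 ⟨h1, h2⟩
    have hR2 := hR1.of_same hs2 (by decide) (by decide)
    have hA2 : s2.nat nA 0 = e % (n ^ k + 1) * n := by rw [hs2.nat _ (by decide), hA]
    have hH2 : s2.real tHyp l = hypPrice M k L V q e ⟨l, hl⟩ := by
      rw [hs2.real _ (by decide), hs1.real _ (by decide)]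
      exact hhyp ⟨l, hl⟩
    have hbig2 : s2.real rBig 0 = prohibitive k L V q := by
      rw [hs2.real _ (by decide), hs1.real _ (by decide), hbig]
    have hd := hR2.down (e % (n ^ k + 1)) (Nat.mod_lt _ (by omega)) ⟨l, hl⟩
    simp only at hd
    refine Ends.ite (fun hb => ?_) fun hb => ?_
    · simp only [BExp.Holds, RExp.eval, NExp.eval, hA2, hi2, hH2, hbig2] at hb
      refine Ends.setR fun _ => ⟨fun hc => ?_, fun _ => by simp⟩
      refine absurd (hc ⟨l, hl⟩ (Nat.lt_succ_self l) fun hin => ?_) hb.2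
      have := hd.1 hin
      omega
    · simp only [BExp.Holds, RExp.eval, NExp.eval, hA2, hi2, hH2, hbig2] at hb
      have hiff : (∀ i : Fin n, (i : ℕ) < l + 1 → i ∉ soldItems M k e →
          prohibitive k L V q ≤ hypPrice M k L V q e i) ↔
          ∀ i : Fin n, (i : ℕ) < l → i ∉ soldItems M k e →
            prohibitive k L V q ≤ hypPrice M k L V q e i := by
        refine ⟨fun h i hi => h i (by omega), fun h i hi hs => ?_⟩
        rcases eq_or_ne (i : ℕ) l with rfl | hne
        · by_contra hlt
          exact hb ⟨(hd.2 hs).le, hlt⟩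
        · exact h i (by omega) hs
      refine Ends.skip fun _ => ?_
      rw [hiff, setNat_real]
      exact ⟨h1, h2⟩
  · intro s2 _ hI
    have hiff : Consistent M k L V q e ↔ ∀ i : Fin n, (i : ℕ) < n → i ∉ soldItems M k e →
        prohibitive k L V q ≤ hypPrice M k L V q e i :=
      ⟨fun h i _ => h i, fun h i => h i i.2⟩
    rw [hiff]
    exact hI

/-- Updates the row of the table that the block leads to. -/
def store : Prog :=
  .seq (.letN nB (.add (.add (nvar nRow) (nvar nShift)) (nvar nLast)))
    (.ite (.leR (rvar rTot) (.get tF (nvar nB))) .skip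
      (.seq (.setR tF (nvar nB) (rvar rTot)) (.seq (.mul iMul nA (nvar nB) inN)
        (.for iI inN (.setR tP (.add (nvar nA) (nvar iI)) (.get tNew (nvar iI)))))))

theorem store_spec {s : Memory} (h : Ready M k L V s) (hn : n ≤ Y) {q c : ℕ}
    (hrow : s.nat nRow 0 = q * (n ^ k + 1)) (hlast : s.nat nLast 0 = c) :
    Ends Y store s fun s' =>
      (s.real rTot 0 ≤ s.real tF ((q + L) * (n ^ k + 1) + c) ∧ s'.real tF = s.real tF ∧
        s'.real tP = s.real tP) ∨
      (s.real tF ((q + L) * (n ^ k + 1) + c) < s.real rTot 0 ∧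
        s'.real tF = Function.update (s.real tF) ((q + L) * (n ^ k + 1) + c) (s.real rTot 0) ∧
        (∀ i : Fin n, s'.real tP (((q + L) * (n ^ k + 1) + c) * n + i) = s.real tNew i) ∧
        ∀ b, b ≠ (q + L) * (n ^ k + 1) + c → ∀ i : Fin n,
          s'.real tP (b * n + i) = s.real tP (b * n + i)) := by
  obtain ⟨a, ha⟩ : ∃ a, a = (q + L) * (n ^ k + 1) + c := ⟨_, rfl⟩
  rw [← ha]
  refine Ends.seq (Ends.setN fun hs1 => ?_)
  have hR1 := h.of_same hs1 (by decide) (by decide)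
  have hB1 : ((s.nat nRow 0 + s.nat nShift 0) + s.nat nLast 0) = a := by
    rw [hrow, hlast, h.shift, ha]
    ring
  simp only [NExp.eval, hB1] at hs1 hR1 ⊢
  refine Ends.ite (fun hb => ?_) fun hb => ?_
  · simp only [BExp.Holds, RExp.eval, NExp.eval, setNat_real, setNat_nat_self,
      Function.update_self] at hb
    exact Ends.skip (Or.inl ⟨hb, rfl, rfl⟩)
  · simp only [BExp.Holds, RExp.eval, NExp.eval, setNat_real, setNat_nat_self,
      Function.update_self, not_le] at hb
    refine Ends.seq (Ends.setR fun hs2 => ?_)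
    have hR2 := hR1.of_same hs2 (by decide) (by decide)
    refine Ends.seq (Ends.mul (by decide) (by decide) (by decide) ?_ ?_)
    · simp [h.items, hn]
    intro s3 hs3 hA _
    have hR3 := hR2.of_same hs3 (by decide) (by decide)
    replace hA : s3.nat nA 0 = a * n := by simpa [h.items] using hA
    have hF3 : s3.real tF = Function.update (s.real tF) a (s.real rTot 0) := by
      rw [hs3.real _ (by decide)]
      simp
    have hN3 : s3.real tNew = s.real tNew := by
      rw [hs3.real _ (by decide), hs2.real _ (by decide), hs1.real _ (by decide)]
    have hP3 : s3.real tP = s.real tP := by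
      rw [hs3.real _ (by decide), hs2.real _ (by decide), hs1.real _ (by decide)]
    refine Ends.for (B := n) (fun l s' =>
      (∀ i : Fin n, (i : ℕ) < l → s'.real tP (a * n + i) = s.real tNew i) ∧
      ∀ b, b ≠ a → ∀ i : Fin n, s'.real tP (b * n + i) = s.real tP (b * n + i))
      (by decide) (by decide) (by decide) (by simp [hR3.items]) hn ?_ ?_ ?_
    · refine ⟨by omega, fun b _ i => ?_⟩
      rw [setNat_real, hP3]
    · intro l s4 hl hs4 hi4 ⟨h1, h2⟩
      refine Ends.setR fun _ => ?_
      simp only [RExp.eval, NExp.eval, setNat_real, setReal_real_self, hs4.nat nA (by decide), hA,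
        hi4, hs4.real tNew (by decide), hN3]
      refine ⟨fun i hi => ?_, fun b hb i => ?_⟩
      · rcases eq_or_ne (i : ℕ) l with rfl | hne
        · rw [Function.update_self]
        · rw [Function.update_of_ne (by omega)]
          exact h1 i (by omega)
      · rw [Function.update_of_ne fun heq => hb (row_eq i.2 hl heq).1]
        exact h2 b hb i
    · intro s4 hs4 ⟨h1, h2⟩
      refine Or.inr ⟨hb, ?_, fun i => h1 i i.2, h2⟩
      rw [hs4.real _ (by decide), hF3]

/-- Updates the best value found so far and the output prices. -/
def record : Prog :=
  .ite (.leR (rvar rTot) (rvar rBest)) .skip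
    (.seq (.letR rBest (rvar rTot)) (.for iI inN (.setR rOut (nvar iI)
      (.mul (.sub (.ofNat (.const 1)) (.div (.ofNat (.const 1)) (.ofNat (nvar nL))))
        (.get tNew (nvar iI))))))

theorem record_spec {s : Memory} (h : Ready M k L V s) (hn : n ≤ Y) :
    Ends Y record s fun s' =>
      (s.real rTot 0 ≤ s.real rBest 0 ∧ s'.real rBest 0 = s.real rBest 0 ∧
        (fun i : Fin n => s'.real rOut i) = fun i : Fin n => s.real rOut i) ∨
      (s.real rBest 0 < s.real rTot 0 ∧ s'.real rBest 0 = s.real rTot 0 ∧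
        (fun i : Fin n => s'.real rOut i) =
          fun i : Fin n => (1 - 1 / (L : ℝ)) * s.real tNew i) := by
  refine Ends.ite (fun hb => Ends.skip (Or.inl ⟨hb, rfl, rfl⟩)) fun hb => ?_
  simp only [BExp.Holds, RExp.eval, NExp.eval, not_le] at hb
  refine Ends.seq (Ends.setR fun hs1 => ?_)
  have hR1 := h.of_same hs1 (by decide) (by decide)
  refine Ends.for (B := n) (fun l s' => ∀ i : Fin n, (i : ℕ) < l →
      s'.real rOut i = (1 - 1 / (L : ℝ)) * s.real tNew i)
    (by decide) (by decide) (by decide) (by simp [h.items]) hn ?_ ?_ ?_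
  · exact fun i hi => absurd hi (by omega)
  · intro l s2 hl hs2 hi2 hI
    have hR2 := hR1.of_same hs2 (by decide) (by decide)
    have hN2 : s2.real tNew = s.real tNew := by
      rw [hs2.real _ (by decide), hs1.real _ (by decide)]
    refine Ends.setR fun _ => ?_
    simp only [RExp.eval, NExp.eval, setNat_real, setReal_real_self, hi2, hR2.len, hN2,
      Nat.cast_one]
    intro i hi
    rcases eq_or_ne (i : ℕ) l with rfl | hne
    · rw [Function.update_self]
    · rw [Function.update_of_ne hne]
      exact hI i (by omega)
  · intro s2 hs2 hI
    refine Or.inr ⟨hb, ?_, funext fun i => hI i i.2⟩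
    rw [hs2.real _ (by decide)]
    simp

/-- Processes the block described by `iE` at the current zone. -/
def processBlock : Prog :=
  .seq resetPrices (.seq readLast (.seq readLevels (.seq applyLow (.seq addTypes
    (.seq checkConsistent (.seq store record))))))

/-- The state of the dynamic program at zone `q`, before block description `e`. -/
structure DPState (M : Market n m) (k L : ℕ) (V : ℝ) (q e : ℕ) (s : Memory) : Prop where
  ready : Ready M k L V s
  row : s.nat nRow 0 = q * (n ^ k + 1)
  low : s.real rBase 0 = base k L q
  high : s.real rTop 0 = base k L (q + L)
  inv : Inv M k L V q e (s.real tF) (s.real tP) (s.real rBest 0) fun i : Fin n => s.real rOut i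

theorem processBlock_spec {s : Memory} (hM : M.Valid k H) (hL : 18 ≤ L) (hV0 : 0 ≤ V)
    (hV : ∀ j (T : Finset (Fin n)), T.card ≤ k → M.val j T ≤ V) (hn : n ≤ Y) (hm : m ≤ Y)
    (hK : n ^ k ≤ Y) (hb : blockLen k L ≤ Y) (hE : (n ^ k + 1) ^ (blockLen k L + 1) ≤ Y)
    {q e : ℕ} (h : DPState M k L V q e s) (he : e < (n ^ k + 1) ^ (blockLen k L + 1))
    (hie : s.nat iE 0 = e) : Ends Y processBlock s (DPState M k L V q (e + 1)) := by
  have hfirst : e / (n ^ k + 1) ^ blockLen k L < n ^ k + 1 := by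
    rw [Nat.div_lt_iff_lt_mul (by positivity), ← pow_succ']
    exact he
  refine Ends.seq ((resetPrices_spec h.ready hn h.high).mono ?_)
  intro s1 hs1 ⟨hbig, hreset⟩ _
  have hR1 := h.ready.of_same hs1 (by decide) (by decide)
  refine Ends.seq ((readLast_spec hR1 (by omega : e ≤ Y)
    (by rw [hs1.nat _ (by decide), hie])).mono ?_)
  intro s2 hs2 hlast _
  have hR2 := hR1.of_same hs2 (by decide) (by decide)
  refine Ends.seq ((readLevels_spec hR2 hn hb (by omega : e ≤ Y) (q := q)
    (by rw [hs2.nat _ (by decide), hs1.nat _ (by decide), hie])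
    (by rw [hs2.real _ (by decide), hs1.real _ (by decide), h.high])
    (fun i => by rw [hs2.real _ (by decide), hreset])).mono ?_)
  intro s3 hs3 ⟨hy, hblock⟩ _
  have hR3 := hR2.of_same hs3 (by decide) (by decide)
  refine Ends.seq ((applyLow_spec hR3 hn hfirst hy (q := q) (by rw [hs3.nat _ (by decide),
    hs2.nat _ (by decide), hs1.nat _ (by decide), h.row]) hblock).mono ?_)
  intro s4 hs4 hprices _
  have hR4 := hR3.of_same hs4 (by decide) (by decide)
  have hP3 : s3.real tP = s.real tP := by
    rw [hs3.real _ (by decide), hs2.real _ (by decide), hs1.real _ (by decide)]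
  have hrow4 : s4.nat nRow 0 = q * (n ^ k + 1) := by
    rw [hs4.nat _ (by decide), hs3.nat _ (by decide), hs2.nat _ (by decide),
      hs1.nat _ (by decide), h.row]
  rw [hP3] at hprices
  refine Ends.seq ((addTypes_spec hR4 hM hn hm hK (q := q) (e := e) (fun i => (hprices i).1) hrow4
    (by rw [hs4.nat _ (by decide), hy])
    (by rw [hs4.real _ (by decide), hs3.real _ (by decide), hs2.real _ (by decide),
      hs1.real _ (by decide), h.low])
    (by rw [hs4.real _ (by decide), hs3.real _ (by decide), hs2.real _ (by decide),
      hs1.real _ (by decide), h.high])).mono ?_)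
  intro s5 hs5 ⟨T, hT, htot⟩ _
  have hR5 := hR4.of_same hs5 (by decide) (by decide)
  have hF4 : s4.real tF = s.real tF := by
    rw [hs4.real _ (by decide), hs3.real _ (by decide), hs2.real _ (by decide),
      hs1.real _ (by decide)]
  rw [hF4] at htot
  have hlast5 : s5.nat nLast 0 = e % (n ^ k + 1) := by
    rw [hs5.nat _ (by decide), hs4.nat _ (by decide), hs3.nat _ (by decide), hlast]
  refine Ends.seq ((checkConsistent_spec hR5 hn (q := q) hlast5
    (by rw [hs5.real _ (by decide), hs4.real _ (by decide), hs3.real _ (by decide),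
      hs2.real _ (by decide), hbig])
    (fun i => by rw [hs5.real _ (by decide), (hprices i).1])).mono ?_)
  intro s6 hs6 ⟨hc1, hc2⟩ _
  have hR6 := hR5.of_same hs6 (by decide) (by decide)
  rw [htot] at hc1
  have htotal : IsTotal M k L V q e (s.real tF) (s6.real rTot 0) := ⟨T, hT, hc1, hc2⟩
  refine Ends.seq ((store_spec hR6 hn (q := q) (by rw [hs6.nat _ (by decide),
    hs5.nat _ (by decide), hrow4]) (by rw [hs6.nat _ (by decide), hlast5])).mono ?_)
  intro s7 hs7 hstore _
  have hR7 := hR6.of_same hs7 (by decide) (by decide)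
  refine (record_spec hR7 hn).mono ?_
  intro s8 hs8 hrec
  have hR8 := hR7.of_same hs8 (by decide) (by decide)
  have hF6 : s6.real tF = s.real tF := by
    rw [hs6.real _ (by decide), hs5.real _ (by decide), hF4]
  have hP6 : s6.real tP = s.real tP := by
    rw [hs6.real _ (by decide), hs5.real _ (by decide), hs4.real _ (by decide), hP3]
  have hbest7 : s7.real rBest = s.real rBest := by
    rw [hs7.real _ (by decide), hs6.real _ (by decide), hs5.real _ (by decide),
      hs4.real _ (by decide), hs3.real _ (by decide), hs2.real _ (by decide),
      hs1.real _ (by decide)]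
  have hout7 : s7.real rOut = s.real rOut := by
    rw [hs7.real _ (by decide), hs6.real _ (by decide), hs5.real _ (by decide),
      hs4.real _ (by decide), hs3.real _ (by decide), hs2.real _ (by decide),
      hs1.real _ (by decide)]
  have hnew6 : s6.real tNew = s4.real tNew := by
    rw [hs6.real _ (by decide), hs5.real _ (by decide)]
  have hnew7 : s7.real tNew = s4.real tNew := by rw [hs7.real _ (by decide), hnew6]
  have htot7 : s7.real rTot = s6.real rTot := hs7.real _ (by decide)
  rw [hF6, hP6, hnew6] at hstore
  rw [hbest7, hout7, htot7, hnew7] at hrec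
  refine ⟨hR8, ?_, ?_, ?_, ?_⟩
  · rw [hs8.nat _ (by decide), hs7.nat _ (by decide), hs6.nat _ (by decide),
      hs5.nat _ (by decide), hrow4]
  · rw [hs8.real _ (by decide), hs7.real _ (by decide), hs6.real _ (by decide),
      hs5.real _ (by decide), hs4.real _ (by decide), hs3.real _ (by decide),
      hs2.real _ (by decide), hs1.real _ (by decide), h.low]
  · rw [hs8.real _ (by decide), hs7.real _ (by decide), hs6.real _ (by decide),
      hs5.real _ (by decide), hs4.real _ (by decide), hs3.real _ (by decide),
      hs2.real _ (by decide), hs1.real _ (by decide), h.high]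
  · refine h.inv.next hM hL hV0 hV he htotal (p := fun i : Fin n => s4.real tNew i)
      (funext fun i => (hprices i).2) rfl ?_ hrec
    rw [hs8.real tF (by decide), hs8.real tP (by decide)]
    exact hstore

/-- The dynamic program: zones are processed in order as long as their prices do not exceed all
values. -/
def processZones : Prog :=
  .loop (.leR (rvar rBase) (rvar rV))
    (.seq (.for iE (nvar nE) processBlock)
      (.seq (.letN nRow (.add (nvar nRow) (nvar nN)))
        (.seq (.letR rBase (.mul (rvar rBase) (rvar rZone)))
          (.letR rTop (.mul (rvar rTop) (rvar rZone))))))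

theorem processZones_spec {s : Memory} (hM : M.Valid k H) (hL : 18 ≤ L) (hV0 : 0 ≤ V)
    (hV : ∀ j (T : Finset (Fin n)), T.card ≤ k → M.val j T ≤ V) (hn : n ≤ Y) (hm : m ≤ Y)
    (hK : n ^ k ≤ Y) (hb : blockLen k L ≤ Y) (hE : (n ^ k + 1) ^ (blockLen k L + 1) ≤ Y)
    (hQ : ∀ q, base k L q ≤ V → q < Y) (h : DPState M k L V 0 0 s) :
    Ends Y processZones s fun s' => ∃ q, V < base k L q ∧ DPState M k L V q 0 s' := by
  refine Ends.loop (fun q s' => DPState M k L V q 0 s') h ?_ ?_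
  · intro q s1 _ h1 hb1
    simp only [BExp.Holds, RExp.eval, NExp.eval, h1.low, h1.ready.bound] at hb1
    refine ⟨hQ q hb1, Ends.seq ?_⟩
    refine Ends.for (B := (n ^ k + 1) ^ (blockLen k L + 1))
      (fun e s' => DPState M k L V q e s') (by decide) (by decide) (by decide)
      (by simp [h1.ready.blocks]) hE ?_ ?_ ?_
    · refine ⟨h1.ready.of_same (P := .letN iE (.const 0))
        (Runs.setN iE (.const 0) (.const 0) s1).sameOff (by decide) (by decide), ?_, ?_, ?_, ?_⟩
      · simpa using h1.row
      · simpa using h1.low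
      · simpa using h1.high
      · simpa using h1.inv
    · intro e s2 he _ hie h2
      refine (processBlock_spec hM hL hV0 hV hn hm hK hb hE h2 he hie).mono ?_
      intro s3 _ h3 _
      refine ⟨h3.ready.of_same (P := .letN iE (.const (e + 1)))
        (Runs.setN iE (.const 0) (.const (e + 1)) s3).sameOff
        (by simp [Prog.natWrites]) (by simp [Prog.realWrites]), ?_, ?_, ?_, ?_⟩
      · simpa using h3.row
      · simpa using h3.low
      · simpa using h3.high
      · simpa using h3.inv
    · intro s2 _ h2 _
      refine Ends.seq (Ends.setN fun hs3 => Ends.seq (Ends.setR fun hs4 => Ends.setR ?_))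
      have hR3 := h2.ready.of_same hs3 (by decide) (by decide)
      have hR4 := hR3.of_same hs4 (by decide) (by decide)
      refine ⟨hR4.of_same (Runs.setR rTop (.const 0) (.mul (rvar rTop) (rvar rZone)) _).sameOff
        (by decide) (by decide), ?_, ?_, ?_, ?_⟩
      · simp [h2.row, h2.ready.codes]
        ring
      · simp [h2.low, h2.ready.zone, base_succ]
      · simp [h2.high, h2.ready.zone]
        rw [← base_succ, show q + L + 1 = q + 1 + L by ring]
      · simpa using h2.inv.next_zone
  · intro q s1 _ h1 hb1
    simp only [BExp.Holds, RExp.eval, NExp.eval, h1.low, h1.ready.bound, not_le] at hb1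
    exact ⟨q, hb1, h1⟩

end Body

/-! ### Preparation of the dynamic program -/

section Setup

variable {n m k L Y : ℕ} {H V ε : ℝ} {M : Market n m}

/-- The reciprocal of the accuracy of the dynamic program. -/
noncomputable def accuracy (ε : ℝ) : ℕ := max 18 ⌈18 / ε⌉₊

theorem accuracy_ge (ε : ℝ) : 18 ≤ accuracy ε := le_max_left _ _

theorem accuracy_mul_ge (hε : 0 < ε) : 18 ≤ accuracy ε * ε := by
  rw [← div_le_iff₀ hε]
  exact (Nat.le_ceil _).trans (by exact_mod_cast le_max_right _ _)

theorem accuracy_le (hε : 0 < ε) : (accuracy ε : ℝ) ≤ 19 + 18 * (1 / ε) := by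
  have h1 := Nat.ceil_lt_add_one (show 0 ≤ 18 / ε by positivity)
  have h2 : 0 < 1 / ε := by positivity
  have h3 : 18 / ε = 18 * (1 / ε) := by ring
  unfold accuracy
  push_cast
  refine max_le (by linarith) (by linarith)

/-- Computes the accuracy of the dynamic program. -/
def setupLen : Prog :=
  .seq (.letN nL (.const 18))
    (.loop (.not (.leR (.ofNat (.const 18)) (.mul (.ofNat (nvar nL)) (.get 0 (.const 0)))))
      (.letN nL (.add (nvar nL) (.const 1))))

theorem setupLen_spec {s : Memory} (hε : 0 < ε) (h : s.real 0 0 = ε) (hY : accuracy ε ≤ Y) :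
    Ends Y setupLen s fun s' => s'.nat nL 0 = accuracy ε := by
  refine Ends.seq (Ends.setN fun _ => ?_)
  refine Ends.loop (fun i s' => s'.nat nL 0 = 18 + i ∧ 18 + i ≤ accuracy ε) ?_ ?_ ?_
  · exact ⟨by simp, accuracy_ge ε⟩
  · intro i s1 hs1 ⟨h1, h2⟩ hb
    have hε1 : s1.real 0 0 = ε := by
      rw [hs1.real _ (by decide)]
      simpa using h
    simp only [BExp.Holds, RExp.eval, NExp.eval, h1, hε1, not_le] at hb
    have h3 : 18 + i < accuracy ε := by
      refine lt_of_le_of_ne h2 fun heq => ?_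
      have := accuracy_mul_ge hε
      rw [← heq] at this
      push_cast at hb this
      linarith
    exact ⟨by omega, Ends.setN ⟨by simp [h1]; ring, by omega⟩⟩
  · intro i s1 hs1 ⟨h1, h2⟩ hb
    have hε1 : s1.real 0 0 = ε := by
      rw [hs1.real _ (by decide)]
      simpa using h
    simp only [BExp.Holds, RExp.eval, NExp.eval, h1, hε1, not_not] at hb
    have h3 : ⌈18 / ε⌉₊ ≤ 18 + i := by
      rw [Nat.ceil_le, div_le_iff₀ hε]
      exact_mod_cast hb
    rw [h1]
    exact le_antisymm h2 (max_le (by omega) h3)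

/-- Computes the numbers of levels, bundles, codes and block descriptions. -/
def setupNat : Prog :=
  .seq (.mul iMul nSq (nvar nL) (nvar nL)) (.seq (.mul iMul nGap (nvar nSq) inK)
  (.seq (.mul iMul nZone (.add (nvar nGap) (nvar nGap)) (nvar nSq))
  (.seq (.mul iMul nBlock (nvar nZone) (nvar nL))
  (.seq (.letN nK (.const 1))
  (.seq (.for iT inK (.seq (.mul iMul nA (nvar nK) inN) (.letN nK (nvar nA))))
  (.seq (.letN nN (.add (nvar nK) (.const 1)))
  (.seq (.letN nE (.const 1))
  (.seq (.for iT (.add (nvar nBlock) (.const 1))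
    (.seq (.mul iMul nA (nvar nE) (nvar nN)) (.letN nE (nvar nA))))
    (.mul iMul nShift (nvar nN) (nvar nL))))))))))

theorem setupNat_spec {s : Memory} (hn : s.nat 0 0 = n) (hk : s.nat 0 1 = k)
    (hL : s.nat nL 0 = L) (hnY : n ≤ Y) (hkY : k ≤ Y) (hLY : L * L ≤ Y) (hLY' : L ≤ Y)
    (hNY : n ^ k + 1 ≤ Y) (hbY : blockLen k L + 1 ≤ Y) : Ends Y setupNat s fun s' =>
      s'.nat nGap 0 = gap k L ∧ s'.nat nZone 0 = zoneLen k L ∧ s'.nat nBlock 0 = blockLen k L ∧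
      s'.nat nK 0 = n ^ k ∧ s'.nat nN 0 = n ^ k + 1 ∧
      s'.nat nE 0 = (n ^ k + 1) ^ (blockLen k L + 1) ∧ s'.nat nShift 0 = (n ^ k + 1) * L := by
  refine Ends.seq (Ends.mul (by decide) (by decide) (by decide) (by simp [hL, hLY']) ?_)
  intro s1 hs1 h1 _
  simp only [NExp.eval, hL] at h1
  have e1 : s1.nat 0 = s.nat 0 := hs1.nat _ (by decide)
  have l1 : s1.nat nL 0 = L := by rw [hs1.nat _ (by decide), hL]
  refine Ends.seq (Ends.mul (by decide) (by decide) (by decide) (by simp [e1, hk, hkY]) ?_)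
  intro s2 hs2 h2 _
  replace h2 : s2.nat nGap 0 = gap k L := by simpa [h1, e1, hk, gap] using h2
  have e2 : s2.nat 0 = s.nat 0 := (hs2.nat _ (by decide)).trans e1
  have q2 : s2.nat nSq 0 = L * L := by rw [hs2.nat _ (by decide), h1]
  have l2 : s2.nat nL 0 = L := by rw [hs2.nat _ (by decide), l1]
  refine Ends.seq (Ends.mul (by decide) (by decide) (by decide) (by simp [q2, hLY]) ?_)
  intro s3 hs3 h3 _
  replace h3 : s3.nat nZone 0 = zoneLen k L := by simpa [h2, q2, zoneLen] using h3
  have e3 : s3.nat 0 = s.nat 0 := (hs3.nat _ (by decide)).trans e2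
  have l3 : s3.nat nL 0 = L := by rw [hs3.nat _ (by decide), l2]
  refine Ends.seq (Ends.mul (by decide) (by decide) (by decide) (by simp [l3, hLY']) ?_)
  intro s4 hs4 h4 _
  replace h4 : s4.nat nBlock 0 = blockLen k L := by simpa [h3, l3, blockLen] using h4
  have e4 : s4.nat 0 = s.nat 0 := (hs4.nat _ (by decide)).trans e3
  refine Ends.seq (Ends.setN fun hs5 => Ends.seq ?_)
  refine Ends.for (B := k) (fun t s' => s'.nat nK 0 = n ^ t ∧ s'.nat 0 = s.nat 0)
    (by decide) (by decide) (by decide) (by simp [e4, hk]) hkY ?_ ?_ ?_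
  · simp [e4]
  · intro t s6 ht hs6 hi6 ⟨g1, g2⟩
    refine Ends.seq (Ends.mul (by decide) (by decide) (by decide) (by simp [g2, hn, hnY]) ?_)
    intro s7 hs7 h7 _
    have e7 : s7.nat 0 = s.nat 0 := (hs7.nat _ (by decide)).trans g2
    refine Ends.setN fun _ => ?_
    simp [h7, g1, g2, hn, e7, pow_succ]
  intro s6 hs6 ⟨g6, e6⟩ _
  have c6 : s6.nat nGap 0 = gap k L ∧ s6.nat nZone 0 = zoneLen k L ∧
      s6.nat nBlock 0 = blockLen k L ∧ s6.nat nL 0 = L := by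
    rw [hs6.nat nGap (by decide), hs6.nat nZone (by decide), hs6.nat nBlock (by decide),
      hs6.nat nL (by decide), hs5.nat nGap (by decide), hs5.nat nZone (by decide),
      hs5.nat nBlock (by decide), hs5.nat nL (by decide), hs4.nat nGap (by decide),
      hs4.nat nZone (by decide), hs4.nat nL (by decide), hs3.nat nGap (by decide)]
    exact ⟨h2, h3, h4, l3⟩
  obtain ⟨a6, b6, d6, l6⟩ := c6
  refine Ends.seq (Ends.setN fun hs7 => Ends.seq (Ends.setN fun hs8 => Ends.seq ?_))
  refine Ends.for (B := blockLen k L + 1)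
    (fun t s' => s'.nat nE 0 = (n ^ k + 1) ^ t ∧ s'.nat nN 0 = n ^ k + 1)
    (by decide) (by decide) (by decide) (by simp [d6]) hbY ?_ ?_ ?_
  · simp [g6]
  · intro t s9 ht hs9 hi9 ⟨g1, g2⟩
    refine Ends.seq (Ends.mul (by decide) (by decide) (by decide) (by simp [g2, hNY]) ?_)
    intro s10 hs10 h10 _
    have e10 : s10.nat nN 0 = n ^ k + 1 := by rw [hs10.nat _ (by decide), g2]
    refine Ends.setN fun _ => ?_
    simp [h10, g1, g2, e10, pow_succ]
  intro s9 hs9 ⟨g9, e9⟩ _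
  have c9 : s9.nat nGap 0 = gap k L ∧ s9.nat nZone 0 = zoneLen k L ∧
      s9.nat nBlock 0 = blockLen k L ∧ s9.nat nL 0 = L ∧ s9.nat nK 0 = n ^ k := by
    rw [hs9.nat nGap (by decide), hs9.nat nZone (by decide), hs9.nat nBlock (by decide),
      hs9.nat nL (by decide), hs9.nat nK (by decide)]
    simp [a6, b6, d6, l6, g6]
  obtain ⟨a9, b9, d9, l9, k9⟩ := c9
  refine Ends.mul (by decide) (by decide) (by decide) (by simp [l9, hLY']) ?_
  intro s10 hs10 h10
  rw [hs10.nat nGap (by decide), hs10.nat nZone (by decide), hs10.nat nBlock (by decide),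
    hs10.nat nK (by decide), hs10.nat nN (by decide), hs10.nat nE (by decide)]
  refine ⟨a9, b9, d9, k9, e9, g9, ?_⟩
  simpa [e9, l9] using h10

/-- Computes the ratios of levels and zones, the bounds of the first block, and the sum of all
values. -/
def setupReal : Prog :=
  .seq (.letR rStep (.add (.ofNat (.const 1))
    (.div (.ofNat (.const 1)) (.mul (.ofNat (nvar nL)) (.ofNat (nvar nL))))))
  (.seq (.letR rZone (.ofNat (.const 1)))
  (.seq (.for iT (nvar nZone) (.letR rZone (.mul (rvar rZone) (rvar rStep))))
  (.seq (.letR rTop (.div (.ofNat (.const 1)) (.mul (.ofNat (nvar nL)) (.ofNat inK))))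
  (.seq (.letR rBase (rvar rTop))
  (.seq (.for iT (nvar nL) (.letR rBase (.div (rvar rBase) (rvar rZone))))
  (.seq (.mul iMul nA (nvar nK) inM)
  (.seq (.letR rV (.ofNat (.const 0)))
    (.for iT (nvar nA) (.letR rV (.add (rvar rV) (.get rVal (nvar iT))))))))))))

theorem setupReal_spec {s : Memory} (hk : s.nat 0 1 = k) (hm : s.nat 0 2 = m)
    (hL : s.nat nL 0 = L) (hz : s.nat nZone 0 = zoneLen k L) (hK : s.nat nK 0 = n ^ k)
    (hk0 : 0 < k) (hL18 : 18 ≤ L)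
    (hmY : m ≤ Y) (hzY : zoneLen k L ≤ Y) (hLY : L ≤ Y) (hKY : n ^ k * m ≤ Y) :
    Ends Y setupReal s fun s' =>
      s'.real rStep 0 = step L ∧ s'.real rZone 0 = zone k L ∧ s'.real rBase 0 = base k L 0 ∧
      s'.real rTop 0 = base k L (0 + L) ∧
      s'.real rV 0 = ∑ x ∈ Finset.range (n ^ k * m), s.real rVal x := by
  refine Ends.seq (Ends.setR fun hs1 => Ends.seq (Ends.setR fun hs2 => Ends.seq ?_))
  refine Ends.for (B := zoneLen k L) (fun t s' => s'.real rZone 0 = step L ^ t ∧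
    s'.real rStep 0 = step L) (by decide) (by decide) (by decide) (by simp [hz]) hzY ?_ ?_ ?_
  · simp [hL, step]
  · intro t s3 ht hs3 hi3 ⟨g1, g2⟩
    refine Ends.setR fun _ => ?_
    simp [g1, g2, pow_succ]
  intro s3 hs3 ⟨z3, t3⟩ _
  have c3 : s3.nat nL 0 = L ∧ s3.nat 0 = s.nat 0 ∧ s3.nat nK 0 = n ^ k ∧
      s3.real rVal = s.real rVal := by
    rw [hs3.nat nL (by decide), hs3.nat 0 (by decide), hs3.nat nK (by decide),
      hs3.real rVal (by decide)]
    simp [hL, hK]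
  obtain ⟨l3, e3, k3, v3⟩ := c3
  refine Ends.seq (Ends.setR fun hs4 => Ends.seq (Ends.setR fun hs5 => Ends.seq ?_))
  refine Ends.for (B := L) (fun t s' =>
    s'.real rBase 0 = 1 / ((L : ℝ) * k) / zone k L ^ t ∧ s'.real rZone 0 = zone k L ∧
    s'.real rTop 0 = 1 / ((L : ℝ) * k)) (by decide) (by decide) (by decide) (by simp [l3]) hLY
    ?_ ?_ ?_
  · simp [l3, e3, hk, z3, zone]
  · intro t s6 ht hs6 hi6 ⟨g1, g2, g3⟩
    refine Ends.setR fun _ => ?_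
    simp [g1, g2, g3, pow_succ, div_div]
  intro s6 hs6 ⟨b6, z6, p6⟩ _
  have c6 : s6.nat 0 = s.nat 0 ∧ s6.nat nK 0 = n ^ k ∧ s6.real rVal = s.real rVal ∧
      s6.real rStep 0 = step L := by
    rw [hs6.nat 0 (by decide), hs6.nat nK (by decide), hs6.real rVal (by decide),
      hs6.real rStep (by decide)]
    simp [e3, k3, v3, t3]
  obtain ⟨e6, k6, v6, t6⟩ := c6
  refine Ends.seq (Ends.mul (by decide) (by decide) (by decide) (by simp [e6, hm, hmY]) ?_)
  intro s7 hs7 h7 _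
  replace h7 : s7.nat nA 0 = n ^ k * m := by simpa [k6, e6, hm] using h7
  refine Ends.seq (Ends.setR fun hs8 => ?_)
  refine Ends.for (B := n ^ k * m) (fun t s' =>
    s'.real rV 0 = ∑ x ∈ Finset.range t, s.real rVal x) (by decide) (by decide) (by decide)
    (by simp [h7]) hKY ?_ ?_ ?_
  · simp
  · intro t s9 ht hs9 hi9 hI
    have v9 : s9.real rVal = s.real rVal := by
      rw [hs9.real _ (by decide), hs8.real _ (by decide), hs7.real _ (by decide), v6]
    refine Ends.setR fun _ => ?_
    simp [hI, hi9, v9, Finset.sum_range_succ]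
  · intro s9 hs9 hI
    refine ⟨?_, ?_, ?_, ?_, hI⟩
    · rw [hs9.real _ (by decide), hs8.real _ (by decide), hs7.real _ (by decide), t6]
    · rw [hs9.real _ (by decide), hs8.real _ (by decide), hs7.real _ (by decide), z6]
    · rw [hs9.real _ (by decide), hs8.real _ (by decide), hs7.real _ (by decide), b6]
      simp [base]
    · rw [hs9.real _ (by decide), hs8.real _ (by decide), hs7.real _ (by decide), p6,
        base_add_eq hk0 hL18]
      simp

/-- The table `g` with rows of length `n` contains the truth values of `p`. -/
def Codes (n : ℕ) (g : ℕ → ℕ) (p : ℕ → ℕ → Prop) : Prop :=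
  ∀ c i, i < n → (p c i → g (c * n + i) = 1) ∧ (¬ p c i → g (c * n + i) = 0)

theorem Codes.congr {g : ℕ → ℕ} {p p' : ℕ → ℕ → Prop} (h : Codes n g p)
    (hp : ∀ c i, i < n → (p' c i ↔ p c i)) : Codes n g p' := by
  intro c i hi
  rw [hp c i hi]
  exact h c i hi

theorem Codes.update {g : ℕ → ℕ} {p p' : ℕ → ℕ → Prop} {c i : ℕ} (h : Codes n g p) (hi : i < n)
    (hp : ∀ c' i', i' < n → (p' c' i' ↔ p c' i' ∨ c' = c ∧ i' = i)) :
    Codes n (Function.update g (c * n + i) 1) p' := by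
  intro c' i' hi'
  rw [hp c' i' hi']
  by_cases heq : c' = c ∧ i' = i
  · obtain ⟨rfl, rfl⟩ := heq
    simp
  · rw [Function.update_of_ne fun hne => heq (row_eq hi' hi hne)]
    simp only [heq, or_false]
    exact h c' i' hi'

/-- Tabulates the bundles and the down-sets. The row of the code `n ^ k` keeps its zeros. -/
def setupTables : Prog :=
  .for iC (nvar nK) (.seq (.mul iMul nA (nvar iC) inN) (.seq (.letN nY (nvar iC))
    (.for iT inK (.seq (.divMod nY nQ inN)
      (.seq (.setN tMem (.add (nvar nA) (nvar nY)) (.const 1))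
      (.seq (.for iI inN (.seq (.mul iMul nB (nvar iI) inN)
          (.ite (.leN (.const 1) (.get 1 (.add (nvar nB) (nvar nY))))
            (.setN tDown (.add (nvar nA) (nvar iI)) (.const 1)) .skip)))
        (.letN nY (nvar nQ))))))))

theorem setupTables_spec {s : Memory} (hn : s.nat 0 0 = n) (hk : s.nat 0 1 = k)
    (hK : s.nat nK 0 = n ^ k) (hn0 : 0 < n) (hnY : n ≤ Y) (hkY : k ≤ Y) (hKY : n ^ k ≤ Y)
    (hmem : s.nat tMem = fun _ => 0) (hdown : s.nat tDown = fun _ => 0) :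
    Ends Y setupTables s fun s' =>
      Codes n (s'.nat tMem) (fun c i => c < n ^ k ∧ ∃ l < k, c / n ^ l % n = i) ∧
      Codes n (s'.nat tDown) (fun c i => c < n ^ k ∧
        ∃ l < k, 1 ≤ s.nat 1 (i * n + c / n ^ l % n)) := by
  refine Ends.for (B := n ^ k) (fun b s' =>
      Codes n (s'.nat tMem) (fun c i => c < b ∧ ∃ l < k, c / n ^ l % n = i) ∧
      Codes n (s'.nat tDown) (fun c i => c < b ∧
        ∃ l < k, 1 ≤ s.nat 1 (i * n + c / n ^ l % n)))
    (by decide) (by decide) (by decide) (by simp [hK]) hKY ?_ ?_ ?_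
  · constructor <;> intro c i _ <;> simp [hmem, hdown]
  · intro b s1 hb hs1 hi1 ⟨hM1, hD1⟩
    have e1 : s1.nat 0 = s.nat 0 := hs1.nat _ (by decide)
    have r1 : s1.nat 1 = s.nat 1 := hs1.nat _ (by decide)
    refine Ends.seq (Ends.mul (by decide) (by decide) (by decide) (by simp [e1, hn, hnY]) ?_)
    intro s2 hs2 hA _
    replace hA : s2.nat nA 0 = b * n := by simpa [hi1, e1, hn] using hA
    refine Ends.seq (Ends.setN fun hs3 => ?_)
    have e2 : s2.nat 0 = s.nat 0 := (hs2.nat _ (by decide)).trans e1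
    have hM2 : s2.nat tMem = s1.nat tMem := hs2.nat _ (by decide)
    have hD2 : s2.nat tDown = s1.nat tDown := hs2.nat _ (by decide)
    have r2 : s2.nat 1 = s.nat 1 := (hs2.nat _ (by decide)).trans r1
    have hi2 : s2.nat iC 0 = b := by rw [hs2.nat _ (by decide), hi1]
    refine Ends.for (B := k) (fun t s' => s'.nat nY 0 = b / n ^ t ∧
      Codes n (s'.nat tMem) (fun c i => ∃ l < k, (c < b ∨ c = b ∧ l < t) ∧ c / n ^ l % n = i) ∧
      Codes n (s'.nat tDown) (fun c i => ∃ l < k, (c < b ∨ c = b ∧ l < t) ∧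
        1 ≤ s.nat 1 (i * n + c / n ^ l % n)))
      (by decide) (by decide) (by decide) (by simp [e2, hk]) hkY ?_ ?_ ?_
    · refine ⟨by simp [hi2], ?_, ?_⟩
      · simp only [ne_eq, not_false_eq_true, Nat.reduceEqDiff, setNat_nat_of_ne, hM2]
        exact hM1.congr fun c i _ => by grind
      · simp only [ne_eq, not_false_eq_true, Nat.reduceEqDiff, setNat_nat_of_ne, hD2]
        exact hD1.congr fun c i _ => by grind
    · intro t s4 ht hs4 hi4 ⟨hy4, hM4, hD4⟩
      have e4 : s4.nat 0 = s.nat 0 := by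
        rw [hs4.nat _ (by decide), hs3.nat _ (by decide), e2]
      have r4 : s4.nat 1 = s.nat 1 := by
        rw [hs4.nat _ (by decide), hs3.nat _ (by decide), r2]
      have hA4 : s4.nat nA 0 = b * n := by
        rw [hs4.nat _ (by decide), hs3.nat _ (by decide), hA]
      refine Ends.seq (Ends.divMod (by decide) (by decide) (by simp [e4, hn, hn0]) ?_ ?_)
      · rw [hy4]
        exact (Nat.div_le_self _ _).trans (by omega)
      intro s5 hs5 hy5 hq5 _
      simp only [NExp.eval, e4, hn, hy4] at hy5 hq5
      have e5 : s5.nat 0 = s.nat 0 := (hs5.nat _ (by decide)).trans e4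
      have r5 : s5.nat 1 = s.nat 1 := (hs5.nat _ (by decide)).trans r4
      have hA5 : s5.nat nA 0 = b * n := by rw [hs5.nat _ (by decide), hA4]
      have hM5 : s5.nat tMem = s4.nat tMem := hs5.nat _ (by decide)
      have hD5 : s5.nat tDown = s4.nat tDown := hs5.nat _ (by decide)
      refine Ends.seq (Ends.setN fun hs6 => Ends.seq ?_)
      refine Ends.for (B := n) (fun i₀ s' =>
        Codes n (s'.nat tMem) (fun c i => ∃ l < k, (c < b ∨ c = b ∧ l < t + 1) ∧
          c / n ^ l % n = i) ∧
        Codes n (s'.nat tDown) (fun c i => ∃ l < k,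
          (c < b ∨ c = b ∧ (l < t ∨ l = t ∧ i < i₀)) ∧ 1 ≤ s.nat 1 (i * n + c / n ^ l % n)))
        (by decide) (by decide) (by decide) (by simp [e5, hn]) hnY ?_ ?_ ?_
      · simp only [NExp.eval, ne_eq, not_false_eq_true, Nat.reduceEqDiff, setNat_nat_of_ne,
          setNat_nat_self, hA5, hy5, hM5, hD5]
        refine ⟨hM4.update (Nat.mod_lt _ hn0) fun c i _ => ?_, hD4.congr fun c i _ => ?_⟩
        · constructor
          · rintro ⟨l, hl, h | ⟨rfl, h⟩, h'⟩
            · exact Or.inl ⟨l, hl, Or.inl h, h'⟩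
            · rcases Nat.lt_succ_iff_lt_or_eq.1 h with h | rfl
              · exact Or.inl ⟨l, hl, Or.inr ⟨rfl, h⟩, h'⟩
              · exact Or.inr ⟨rfl, h'.symm⟩
          · rintro (⟨l, hl, h | ⟨rfl, h⟩, h'⟩ | ⟨rfl, rfl⟩)
            · exact ⟨l, hl, Or.inl h, h'⟩
            · exact ⟨l, hl, Or.inr ⟨rfl, by omega⟩, h'⟩
            · exact ⟨t, ht, Or.inr ⟨rfl, by omega⟩, rfl⟩
        · simp
      · intro i₀ s7 hi₀ hs7 hi7 ⟨hM7, hD7⟩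
        have e7 : s7.nat 0 = s.nat 0 := by
          rw [hs7.nat _ (by decide), hs6.nat _ (by decide), e5]
        have r7 : s7.nat 1 = s.nat 1 := by
          rw [hs7.nat _ (by decide), hs6.nat _ (by decide), r5]
        have hA7 : s7.nat nA 0 = b * n := by
          rw [hs7.nat _ (by decide), hs6.nat _ (by decide), hA5]
        have hy7 : s7.nat nY 0 = b / n ^ t % n := by
          rw [hs7.nat _ (by decide), hs6.nat _ (by decide), hy5]
        refine Ends.seq (Ends.mul (by decide) (by decide) (by decide) (by simp [e7, hn, hnY]) ?_)
        intro s8 hs8 hB _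
        replace hB : s8.nat nB 0 = i₀ * n := by simpa [hi7, e7, hn] using hB
        have r8 : s8.nat 1 = s.nat 1 := (hs8.nat _ (by decide)).trans r7
        have hA8 : s8.nat nA 0 = b * n := by rw [hs8.nat _ (by decide), hA7]
        have hy8 : s8.nat nY 0 = b / n ^ t % n := by rw [hs8.nat _ (by decide), hy7]
        have hi8 : s8.nat iI 0 = i₀ := by rw [hs8.nat _ (by decide), hi7]
        have hM8 : s8.nat tMem = s7.nat tMem := hs8.nat _ (by decide)
        have hD8 : s8.nat tDown = s7.nat tDown := hs8.nat _ (by decide)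
        refine Ends.ite (fun hc => ?_) fun hc => ?_
        · simp only [BExp.Holds, NExp.eval, hB, hy8, r8] at hc
          refine Ends.setN fun _ => ?_
          simp only [NExp.eval, ne_eq, not_false_eq_true, Nat.reduceEqDiff, setNat_nat_of_ne,
            setNat_nat_self, hA8, hi8, hM8, hD8]
          refine ⟨hM7, hD7.update hi₀ fun c i _ => ?_⟩
          constructor
          · rintro ⟨l, hl, h | ⟨rfl, h | ⟨rfl, h⟩⟩, h'⟩
            · exact Or.inl ⟨l, hl, Or.inl h, h'⟩
            · exact Or.inl ⟨l, hl, Or.inr ⟨rfl, Or.inl h⟩, h'⟩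
            · rcases Nat.lt_succ_iff_lt_or_eq.1 h with h | rfl
              · exact Or.inl ⟨l, hl, Or.inr ⟨rfl, Or.inr ⟨rfl, h⟩⟩, h'⟩
              · exact Or.inr ⟨rfl, rfl⟩
          · rintro (⟨l, hl, h | ⟨rfl, h | ⟨rfl, h⟩⟩, h'⟩ | ⟨rfl, rfl⟩)
            · exact ⟨l, hl, Or.inl h, h'⟩
            · exact ⟨l, hl, Or.inr ⟨rfl, Or.inl h⟩, h'⟩
            · exact ⟨l, hl, Or.inr ⟨rfl, Or.inr ⟨rfl, by omega⟩⟩, h'⟩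
            · exact ⟨t, ht, Or.inr ⟨rfl, Or.inr ⟨rfl, by omega⟩⟩, hc⟩
        · simp only [BExp.Holds, NExp.eval, hB, hy8, r8] at hc
          refine Ends.skip fun _ => ?_
          simp only [ne_eq, not_false_eq_true, Nat.reduceEqDiff, setNat_nat_of_ne, hM8, hD8]
          refine ⟨hM7, hD7.congr fun c i _ => ?_⟩
          constructor
          · rintro ⟨l, hl, h | ⟨rfl, h | ⟨rfl, h⟩⟩, h'⟩
            · exact ⟨l, hl, Or.inl h, h'⟩
            · exact ⟨l, hl, Or.inr ⟨rfl, Or.inl h⟩, h'⟩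
            · rcases Nat.lt_succ_iff_lt_or_eq.1 h with h | rfl
              · exact ⟨l, hl, Or.inr ⟨rfl, Or.inr ⟨rfl, h⟩⟩, h'⟩
              · exact absurd h' hc
          · rintro ⟨l, hl, h | ⟨rfl, h | ⟨rfl, h⟩⟩, h'⟩
            · exact ⟨l, hl, Or.inl h, h'⟩
            · exact ⟨l, hl, Or.inr ⟨rfl, Or.inl h⟩, h'⟩
            · exact ⟨l, hl, Or.inr ⟨rfl, Or.inr ⟨rfl, by omega⟩⟩, h'⟩
      · intro s7 hs7 ⟨hM7, hD7⟩ _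
        refine Ends.setN fun _ => ?_
        have hq7 : s7.nat nQ 0 = b / n ^ (t + 1) := by
          rw [hs7.nat _ (by decide), hs6.nat _ (by decide), hq5, Nat.div_div_eq_div_mul, pow_succ]
        refine ⟨by simp [hq7], ?_, ?_⟩
        · simpa using hM7
        · simp only [NExp.eval, ne_eq, not_false_eq_true, Nat.reduceEqDiff, setNat_nat_of_ne]
          refine hD7.congr fun c i hi => ?_
          simp only [hi, and_true, Nat.lt_succ_iff_lt_or_eq]
    · intro s4 hs4 ⟨_, hM4, hD4⟩ _
      simp only [ne_eq, not_false_eq_true, Nat.reduceEqDiff, setNat_nat_of_ne]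
      refine ⟨hM4.congr fun c i _ => ?_, hD4.congr fun c i _ => ?_⟩
      · constructor
        · rintro ⟨h, l, hl, h'⟩
          exact ⟨l, hl, by omega, h'⟩
        · rintro ⟨l, hl, h, h'⟩
          exact ⟨by omega, l, hl, h'⟩
      · constructor
        · rintro ⟨h, l, hl, h'⟩
          exact ⟨l, hl, by omega, h'⟩
        · rintro ⟨l, hl, h, h'⟩
          exact ⟨by omega, l, hl, h'⟩
  · exact fun s1 _ hI => hI

end Setup

/-! ### The input and the number of zones -/

section Input

variable {n m k L Y : ℕ} {H V ε : ℝ} {M : Market n m}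

theorem mem_codedBundle {c : Fin (n ^ k)} {i : Fin n} :
    i ∈ codedBundle c ↔ ∃ l < k, (c : ℕ) / n ^ l % n = i := by
  unfold codedBundle
  simp only [Finset.mem_image, Finset.mem_univ, true_and]
  constructor
  · rintro ⟨l, rfl⟩
    exact ⟨l, l.2, rfl⟩
  · rintro ⟨l, hl, h⟩
    exact ⟨⟨l, hl⟩, Fin.ext h⟩

theorem inputMemory_rel (i i' : Fin n) :
    1 ≤ (inputMemory M k ε).nat 1 (i * n + i') ↔ M.rel i i' := by
  classical
  have h : (i : ℕ) * n + i' = finProdFinEquiv (i, i') := by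
    simp only [finProdFinEquiv_apply_val]
    ring
  have hlt : (i : ℕ) * n + i' < n * n := by rw [h]; exact Fin.is_lt _
  have h2 : finProdFinEquiv.symm (⟨(i : ℕ) * n + i', hlt⟩ : Fin (n * n)) = (i, i') := by
    rw [Equiv.symm_apply_eq]
    exact Fin.ext h
  simp only [inputMemory, one_ne_zero, if_false, if_true, hlt, dif_pos, h2]
  split_ifs with hr <;> simp [hr]

theorem inputMemory_val (j : Fin m) (c : Fin (n ^ k)) :
    (inputMemory M k ε).real rVal (n ^ k * j + c) = M.val j (codedBundle c) := by
  have h : n ^ k * j + c = (finProdFinEquiv (j, c) : ℕ) := by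
    simp only [finProdFinEquiv_apply_val]
    ring
  have hlt : n ^ k * j + c < m * n ^ k := by rw [h]; exact Fin.is_lt _
  have h2 : finProdFinEquiv.symm (⟨n ^ k * j + c, hlt⟩ : Fin (m * n ^ k)) = (j, c) := by
    rw [Equiv.symm_apply_eq]
    exact Fin.ext h
  simp only [inputMemory, OfNat.ofNat_ne_zero, OfNat.ofNat_ne_one, if_false, if_true, hlt,
    dif_pos, h2]

theorem inputMemory_prob (j : Fin m) : (inputMemory M k ε).real rProb j = M.prob j := by
  simp [inputMemory]

theorem inputMemory_val_mem (hM : M.Valid k H) (x : ℕ) :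
    0 ≤ (inputMemory M k ε).real rVal x ∧ (inputMemory M k ε).real rVal x ≤ H := by
  have hH := hM.one_le_bound
  simp only [inputMemory, OfNat.ofNat_ne_zero, OfNat.ofNat_ne_one, if_false, if_true]
  split_ifs with h
  · rcases hM.range (finProdFinEquiv.symm (⟨x, h⟩ : Fin (m * n ^ k))).1
      (codedBundle (finProdFinEquiv.symm (⟨x, h⟩ : Fin (m * n ^ k))).2) with h1 | h1
    · simp only [h1]
      exact ⟨le_rfl, by linarith⟩
    · exact ⟨by linarith [h1.1], h1.2⟩
  · exact ⟨le_rfl, by linarith⟩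

theorem mem_down {c : ℕ} {i : Fin n} : i ∈ down M k c ↔ c < n ^ k ∧
    ∃ l < k, 1 ≤ (inputMemory M k ε).nat 1 (i * n + c / n ^ l % n) := by
  classical
  have hn : 0 < n := i.pos
  unfold down
  split_ifs with hc
  · simp only [Finset.mem_filter, Finset.mem_univ, true_and, hc, mem_codedBundle]
    constructor
    · rintro ⟨i', ⟨l, hl, h⟩, hr⟩
      exact ⟨l, hl, by rw [h]; exact (inputMemory_rel i i').2 hr⟩
    · rintro ⟨l, hl, h⟩
      exact ⟨⟨c / n ^ l % n, Nat.mod_lt _ hn⟩, ⟨l, hl, rfl⟩, (inputMemory_rel i _).1 h⟩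
  · simp [hc]

/-- The sum of all values in the input, used as an upper bound for the values. -/
noncomputable def valueSum (M : Market n m) (k : ℕ) (ε : ℝ) : ℝ :=
  ∑ x ∈ Finset.range (n ^ k * m), (inputMemory M k ε).real rVal x

theorem valueSum_nonneg (hM : M.Valid k H) (ε : ℝ) : 0 ≤ valueSum M k ε :=
  Finset.sum_nonneg fun x _ => (inputMemory_val_mem hM x).1

theorem valueSum_le (hM : M.Valid k H) (ε : ℝ) : valueSum M k ε ≤ n ^ k * m * H := by
  refine (Finset.sum_le_card_nsmul _ _ H fun x _ => (inputMemory_val_mem hM x).2).trans ?_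
  simp

theorem val_le_valueSum (hM : M.Valid k H) (ε : ℝ) (j : Fin m) (T : Finset (Fin n))
    (hT : T.card ≤ k) : M.val j T ≤ valueSum M k ε := by
  rcases T.eq_empty_or_nonempty with rfl | hne
  · rw [hM.empty]
    exact valueSum_nonneg hM ε
  · obtain ⟨c, rfl⟩ := exists_codedBundle hne hT
    rw [← inputMemory_val (ε := ε) j c]
    refine Finset.single_le_sum (f := fun x => (inputMemory M k ε).real rVal x)
      (fun x _ => (inputMemory_val_mem hM x).1) (Finset.mem_range.2 ?_)
    have h1 := c.2
    have h2 : (j : ℕ) + 1 ≤ m := j.2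
    calc n ^ k * j + c < n ^ k * j + n ^ k := by omega
      _ = n ^ k * (j + 1) := by ring
      _ ≤ n ^ k * m := Nat.mul_le_mul_left _ h2

/-- The number of zones is logarithmic in the bound on the values. -/
theorem zone_count (hM : M.Valid k H) (hL : 18 ≤ L) {ε : ℝ} {q : ℕ}
    (h : base k L q ≤ valueSum M k ε) :
    (q : ℝ) ≤ L + (n ^ k + m + Real.log H + L * k) := by
  have hk : (0 : ℝ) < k := by exact_mod_cast hM.width_pos
  have hL0 : (0 : ℝ) < L := by exact_mod_cast (by omega : 0 < L)
  have hH := hM.one_le_bound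
  have hlog := Real.log_nonneg hH
  rcases lt_or_ge q L with hq | hq
  · have h1 : (q : ℝ) < L := by exact_mod_cast hq
    have : (0 : ℝ) ≤ n ^ k + m + Real.log H + L * k := by positivity
    linarith
  · obtain ⟨d, rfl⟩ := Nat.exists_eq_add_of_le' hq
    have h1 := h.trans (valueSum_le hM ε)
    rw [base_add_eq hM.width_pos hL, one_div_mul_eq_div, div_le_iff₀ (by positivity)] at h1
    -- each zone multiplies prices by at least `exp 1`
    have h2 : Real.exp d ≤ zone k L ^ d := by
      rw [← Real.exp_one_pow d]
      exact pow_le_pow_left₀ (Real.exp_pos 1).le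
        ((Real.exp_one_lt_d9.le.trans (by norm_num)).trans (zone_ge hM.width_pos hL)) d
    have hx : ∀ x : ℝ, x ≤ Real.exp x := fun x => by linarith [Real.add_one_le_exp x]
    have h3 : (n : ℝ) ^ k * m * H * (L * k) ≤
        Real.exp (n ^ k + m + Real.log H + L * k) := by
      rw [Real.exp_add, Real.exp_add, Real.exp_add, Real.exp_log (by linarith)]
      have := hx (n ^ k)
      have := hx m
      have := hx (L * k)
      gcongr
    have h4 := Real.exp_le_exp.1 (h2.trans (h1.trans h3))
    push_cast
    linarith

/-- Everything that precedes the dynamic program. -/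
def setup : Prog := .seq setupLen (.seq setupNat (.seq setupReal setupTables))

theorem setup_spec (hM : M.Valid k H) (hε : 0 < ε) (hn : n ≤ Y) (hm : m ≤ Y)
    (hK : n ^ k + 1 ≤ Y) (hKm : n ^ k * m ≤ Y) (hb : blockLen k (accuracy ε) + 1 ≤ Y) :
    Ends Y setup (inputMemory M k ε)
      (DPState M k (accuracy ε) (valueSum M k ε) 0 0) := by
  have hk0 := hM.width_pos
  have hn0 := hM.card_pos
  have hL := accuracy_ge ε
  have hL0 : 0 < accuracy ε := by omega
  have hkY : k ≤ Y := hM.width_le.trans hn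
  have hz : zoneLen k (accuracy ε) ≤ Y :=
    (Nat.le_mul_of_pos_right _ hL0).trans ((Nat.le_succ _).trans hb)
  have hLL : accuracy ε * accuracy ε ≤ Y := by
    refine le_trans (Nat.le_mul_of_pos_left _ ?_) hz
    have := sq_le_gap (L := accuracy ε) hk0
    have : 0 < accuracy ε * accuracy ε := by positivity
    omega
  have hLY : accuracy ε ≤ Y := (Nat.le_mul_of_pos_right _ hL0).trans hLL
  generalize hs0 : inputMemory M k ε = s
  have i0 : s.nat 0 0 = n ∧ s.nat 0 1 = k ∧ s.nat 0 2 = m ∧ s.real 0 0 = ε := by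
    subst hs0; simp [inputMemory]
  have iN : ∀ a, 2 ≤ a → s.nat a = fun _ => 0 := by
    intro a ha
    subst hs0
    funext x
    simp [inputMemory, show a ≠ 0 by omega, show a ≠ 1 by omega]
  have iR : ∀ a, 3 ≤ a → s.real a = fun _ => 0 := by
    intro a ha
    subst hs0
    funext x
    simp [inputMemory, show a ≠ 0 by omega, show a ≠ 1 by omega, show a ≠ 2 by omega]
  refine Ends.seq ((setupLen_spec hε i0.2.2.2 hLY).mono ?_)
  intro s1 hs1 h1 _
  have e1 : s1.nat 0 = s.nat 0 := hs1.nat _ (by decide)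
  refine Ends.seq ((setupNat_spec (n := n) (k := k) (by rw [e1]; exact i0.1)
    (by rw [e1]; exact i0.2.1) h1 hn hkY hLL hLY hK hb).mono ?_)
  intro s2 hs2 ⟨hgap, hzone, hblock, hbun, hcodes, hblocks, hshift⟩ _
  have e2 : s2.nat 0 = s.nat 0 := (hs2.nat _ (by decide)).trans e1
  have l2 : s2.nat nL 0 = accuracy ε := by rw [hs2.nat _ (by decide), h1]
  refine Ends.seq ((setupReal_spec (n := n) (k := k) (m := m) (by rw [e2]; exact i0.2.1)
    (by rw [e2]; exact i0.2.2.1) l2 hzone hbun hk0 hL hm hz hLY hKm).mono ?_)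
  intro s3 hs3 ⟨hstep, hzr, hbase, htop, hsum⟩ _
  have e3 : s3.nat 0 = s.nat 0 := (hs3.nat _ (by decide)).trans e2
  have t3 : ∀ a ∈ [1, nRow, tMem, tDown], s3.nat a = s.nat a := by
    intro a ha
    simp only [List.mem_cons, List.not_mem_nil, or_false] at ha
    rcases ha with rfl | rfl | rfl | rfl <;>
      rw [hs3.nat _ (by decide), hs2.nat _ (by decide), hs1.nat _ (by decide)]
  refine (setupTables_spec (n := n) (k := k) (by rw [e3]; exact i0.1) (by rw [e3]; exact i0.2.1)
    (by rw [hs3.nat _ (by decide), hbun]) hn0 hn hkY (by omega)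
    (by rw [t3 tMem (by simp)]; exact iN _ (by norm_num))
    (by rw [t3 tDown (by simp)]; exact iN _ (by norm_num))).mono ?_
  intro s4 hs4 ⟨hMem, hDown⟩
  rw [t3 1 (by simp)] at hDown
  have e4 : s4.nat 0 = s.nat 0 := (hs4.nat _ (by decide)).trans e3
  have r4 : ∀ a ∈ [rProb, rVal, rOut, rBest, tF, tP], s4.real a = s.real a := by
    intro a ha
    simp only [List.mem_cons, List.not_mem_nil, or_false] at ha
    rcases ha with rfl | rfl | rfl | rfl | rfl | rfl <;>
      rw [hs4.real _ (by decide), hs3.real _ (by decide), hs2.real _ (by decide),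
        hs1.real _ (by decide)]
  refine ⟨⟨?_, ?_, ?_, ?_, ?_, ?_, ?_, ?_, ?_, ?_, ?_, ?_, ?_, ?_, ?_, ?_, ?_⟩, ?_, ?_, ?_, ?_⟩
  · rw [e4]; exact i0.1
  · rw [e4]; exact i0.2.1
  · rw [e4]; exact i0.2.2.1
  · intro j
    rw [r4 rProb (by simp), ← hs0]
    exact inputMemory_prob j
  · intro j c
    rw [r4 rVal (by simp), ← hs0]
    exact inputMemory_val j c
  · rw [hs4.nat _ (by decide), hs3.nat _ (by decide), l2]
  · rw [hs4.nat _ (by decide), hs3.nat _ (by decide), hgap]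
  · rw [hs4.nat _ (by decide), hs3.nat _ (by decide), hblock]
  · rw [hs4.nat _ (by decide), hs3.nat _ (by decide), hbun]
  · rw [hs4.nat _ (by decide), hs3.nat _ (by decide), hcodes]
  · rw [hs4.nat _ (by decide), hs3.nat _ (by decide), hblocks]
  · rw [hs4.nat _ (by decide), hs3.nat _ (by decide), hshift]
  · rw [hs4.real _ (by decide), hstep]
  · rw [hs4.real _ (by decide), hzr]
  · rw [hs4.real _ (by decide), hsum, hs2.real _ (by decide), hs1.real _ (by decide), valueSum,
      hs0]
  · intro c i
    have h := hMem c i i.2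
    simp only [c.2, true_and, ← mem_codedBundle] at h
    exact h
  · intro c _ i
    have h := hDown c i i.2
    beta_reduce at h
    rw [← hs0, ← mem_down] at h
    exact h
  · rw [hs4.nat _ (by decide), t3 nRow (by simp), iN _ (by norm_num)]
    simp
  · rw [hs4.real _ (by decide), hbase]
  · rw [hs4.real _ (by decide), htop]
  · rw [r4 rBest (by simp), r4 rOut (by simp), r4 tF (by simp), r4 tP (by simp),
      iR rBest (by norm_num), iR rOut (by norm_num), iR tF (by norm_num), iR tP (by norm_num)]
    exact inv_zero hM hL

end Input

/-! ### Markets with a single item -/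

section Single

variable {m Y : ℕ} {H ε : ℝ} {M : Market 1 m}

theorem payment_single (hM : M.Valid 1 H) (j : Fin m) {p : Fin 1 → ℝ} (hp : 0 ≤ p 0) :
    payment (M.val j) p = if p 0 ≤ M.val j Finset.univ then p 0 else 0 := by
  have hS : ∀ S : Finset (Fin 1), S = ∅ ∨ S = Finset.univ := by decide
  have hu : bundlePrice p Finset.univ = p 0 := by simp [bundlePrice]
  obtain ⟨S, hS', hpay⟩ := exists_mem_demand_eq_payment (M.val j) p
  have h1 := mem_demand.1 hS' ∅
  have h2 := mem_demand.1 hS' Finset.univ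
  rw [hM.empty, bundlePrice_empty] at h1
  rw [hu] at h2
  split_ifs with h
  · have hd : Finset.univ ∈ demand (M.val j) p := by
      refine mem_demand.2 fun T => ?_
      rcases hS T with rfl | rfl
      · rw [hM.empty, bundlePrice_empty, hu]
        linarith
      · exact le_rfl
    have h3 := bundlePrice_le_payment hd
    rw [hu] at h3
    refine le_antisymm ?_ h3
    rw [← hpay]
    rcases hS S with rfl | rfl
    · simpa using hp
    · exact hu.le
  · rw [← hpay]
    rcases hS S with rfl | rfl
    · simp
    · rw [hu] at h1
      linarith

theorem revenue_single (hM : M.Valid 1 H) {p : Fin 1 → ℝ} (hp : 0 ≤ p 0) :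
    revenue M.val M.prob p =
      ∑ l, M.prob l * if p 0 ≤ M.val l Finset.univ then p 0 else 0 :=
  Finset.sum_congr rfl fun l _ => by rw [payment_single hM l hp]

/-- With a single item it suffices to consider the values as prices. -/
theorem revenue_single_le (hM : M.Valid 1 H) {p : Fin 1 → ℝ} (hp : 0 ≤ p 0) :
    revenue M.val M.prob p ≤ 0 ∨
      ∃ j, revenue M.val M.prob p ≤ revenue M.val M.prob fun _ => M.val j Finset.univ := by
  classical
  rcases (Finset.univ.filter fun j => p 0 ≤ M.val j Finset.univ).eq_empty_or_nonempty with h | h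
  · refine Or.inl ?_
    rw [revenue_single hM hp]
    refine Finset.sum_nonpos fun l _ => ?_
    have hl : l ∉ Finset.univ.filter fun j => p 0 ≤ M.val j Finset.univ :=
      h ▸ Finset.notMem_empty l
    rw [if_neg fun hp => hl (Finset.mem_filter.2 ⟨Finset.mem_univ l, hp⟩), mul_zero]
  · obtain ⟨j, hj, hmin⟩ := Finset.exists_min_image _ (fun j => M.val j Finset.univ) h
    simp only [Finset.mem_filter, Finset.mem_univ, true_and] at hj hmin
    refine Or.inr ⟨j, ?_⟩
    rw [revenue_single hM hp, revenue_single hM (hM.val_nonneg j _)]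
    refine Finset.sum_le_sum fun l _ => mul_le_mul_of_nonneg_left ?_ (hM.prob_nonneg l)
    split_ifs with h1 h2 h2
    · exact hj
    · exact absurd (hmin l h1) h2
    · exact hM.val_nonneg j _
    · exact le_rfl

/-- Prices a single item at the value of some type. -/
def singleItem : Prog :=
  .for iJ inM (.seq (.letR rTot (.ofNat (.const 0)))
    (.seq (.for iC inM (.ite (.leR (.get rVal (nvar iJ)) (.get rVal (nvar iC)))
        (.letR rTot (.add (rvar rTot) (.mul (.get rProb (nvar iC)) (.get rVal (nvar iJ)))))
        .skip))
      (.ite (.leR (rvar rTot) (rvar rBest)) .skip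
        (.seq (.letR rBest (rvar rTot)) (.letR rOut (.get rVal (nvar iJ)))))))

theorem inputMemory_val_single (j : Fin m) :
    (inputMemory M 1 ε).real rVal j = M.val j Finset.univ := by
  have h := inputMemory_val (M := M) (k := 1) (ε := ε) j ⟨0, by norm_num⟩
  have h2 : codedBundle (⟨0, by norm_num⟩ : Fin (1 ^ 1)) = (Finset.univ : Finset (Fin 1)) := by
    have h3 : ∀ S : Finset (Fin 1), S.Nonempty → S = Finset.univ := by decide
    exact h3 _ ⟨_, Finset.mem_image_of_mem _ (Finset.mem_univ 0)⟩
  rw [h2] at h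
  simpa using h

theorem singleItem_spec (hM : M.Valid 1 H) (hm : m ≤ Y) :
    Ends Y singleItem (inputMemory M 1 ε) fun s' => 0 ≤ outputPrices 1 s' 0 ∧
      ∀ q : Fin 1 → ℝ, 0 ≤ q 0 →
        revenue M.val M.prob q ≤ revenue M.val M.prob (outputPrices 1 s') := by
  have i0 : (inputMemory M 1 ε).nat 0 2 = m := by simp [inputMemory]
  refine Ends.for (B := m) (fun t s' => 0 ≤ s'.real rOut 0 ∧
    s'.real rBest 0 = revenue M.val M.prob (fun _ => s'.real rOut 0) ∧
    ∀ j : Fin m, (j : ℕ) < t →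
      (revenue M.val M.prob fun _ => M.val j Finset.univ) ≤ s'.real rBest 0)
    (by decide) (by decide) (by decide) (by simp [i0]) hm ?_ ?_ ?_
  · have h1 : (inputMemory M 1 ε).real rOut 0 = 0 := by simp [inputMemory]
    have h2 : (inputMemory M 1 ε).real rBest 0 = 0 := by simp [inputMemory]
    simp only [setNat_real, h1, h2]
    refine ⟨le_rfl, ?_, by omega⟩
    rw [revenue_single hM le_rfl]
    simp
  · intro t s1 ht hs1 hi1 ⟨h1, h2, h3⟩
    have hv : ∀ j : Fin m, s1.real rVal j = M.val j Finset.univ := by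
      intro j
      rw [hs1.real _ (by decide), inputMemory_val_single]
    have hw : ∀ j : Fin m, s1.real rProb j = M.prob j := by
      intro j
      rw [hs1.real _ (by decide), inputMemory_prob]
    have hvt := hv ⟨t, ht⟩
    simp only at hvt
    have hm1 : s1.nat 0 2 = m := by rw [hs1.nat _ (by decide), i0]
    refine Ends.seq (Ends.setR fun hs2 => Ends.seq ?_)
    refine Ends.for (B := m) (fun l s' => s'.real rTot 0 = ∑ x ∈ Finset.range l,
        s1.real rProb x * if s1.real rVal t ≤ s1.real rVal x then s1.real rVal t else 0)
      (by decide) (by decide) (by decide) (by simp [hm1]) hm ?_ ?_ ?_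
    · simp
    · intro l s3 hl hs3 hi3 hI
      have v3 : s3.real rVal = s1.real rVal := by
        rw [hs3.real _ (by decide), hs2.real _ (by decide)]
      have w3 : s3.real rProb = s1.real rProb := by
        rw [hs3.real _ (by decide), hs2.real _ (by decide)]
      have t3 : s3.nat iJ 0 = t := by
        rw [hs3.nat _ (by decide), hs2.nat _ (by decide), hi1]
      refine Ends.ite (fun hb => Ends.setR fun _ => ?_) fun hb => Ends.skip fun _ => ?_
      · simp only [BExp.Holds, RExp.eval, NExp.eval, t3, hi3, v3] at hb
        simp [hI, t3, hi3, v3, w3, Finset.sum_range_succ, hb]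
      · simp only [BExp.Holds, RExp.eval, NExp.eval, t3, hi3, v3] at hb
        simp [hI, Finset.sum_range_succ, hb]
    · intro s3 hs3 hI _
      have hrev : s3.real rTot 0 = revenue M.val M.prob fun _ => M.val ⟨t, ht⟩ Finset.univ := by
        rw [hI, Finset.sum_range, revenue_single hM (hM.val_nonneg _ _)]
        exact Finset.sum_congr rfl fun l _ => by rw [hvt, hv l, hw l]
      have o3 : s3.real rOut = s1.real rOut := by
        rw [hs3.real _ (by decide), hs2.real _ (by decide)]
      have b3 : s3.real rBest = s1.real rBest := by
        rw [hs3.real _ (by decide), hs2.real _ (by decide)]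
      have v3 : s3.real rVal t = M.val ⟨t, ht⟩ Finset.univ := by
        rw [hs3.real _ (by decide), hs2.real _ (by decide), hvt]
      have t3 : s3.nat iJ 0 = t := by
        rw [hs3.nat _ (by decide), hs2.nat _ (by decide), hi1]
      refine Ends.ite (fun hb => Ends.skip fun _ => ?_) fun hb => ?_
      · simp only [BExp.Holds, RExp.eval, NExp.eval, b3, hrev] at hb
        simp only [setNat_real, o3, b3]
        refine ⟨h1, h2, fun j hj => ?_⟩
        rcases eq_or_ne (j : ℕ) t with rfl | hne
        · exact hb
        · exact h3 j (by omega)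
      · simp only [BExp.Holds, RExp.eval, NExp.eval, b3, hrev, not_le] at hb
        refine Ends.seq (Ends.setR fun _ => Ends.setR fun _ => ?_)
        simp only [RExp.eval, NExp.eval, setNat_real, ne_eq, not_false_eq_true,
          Nat.reduceEqDiff, setReal_real_of_ne, setReal_real_self, setReal_nat,
          Function.update_self, hrev, t3, v3, true_and]
        refine ⟨hM.val_nonneg _ _, fun j hj => ?_⟩
        rcases eq_or_ne (j : ℕ) t with rfl | hne
        · exact le_rfl
        · exact (h3 j (by omega)).trans hb.le
  · intro s1 _ ⟨h1, h2, h3⟩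
    have hout : outputPrices 1 s1 = fun _ => s1.real rOut 0 := by
      funext i
      rw [Subsingleton.elim i 0]
      rfl
    rw [hout, ← h2]
    refine ⟨h1, fun q hq => ?_⟩
    rcases revenue_single_le hM hq with h | ⟨j, h⟩
    · refine h.trans ?_
      rw [h2]
      exact Finset.sum_nonneg fun j _ =>
        mul_nonneg (hM.prob_nonneg j) (payment_nonneg _ fun _ => h1)
    · exact h.trans (h3 j j.2)

end Single

/-! ### The approximation scheme -/

/-- The approximation scheme. Markets with a single item are solved exactly, as the time allowed
for them does not depend on the accuracy. -/
def scheme : Prog := .ite (.leN inN (.const 1)) singleItem (.seq setup processZones)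

section Scheme

variable {n m k : ℕ} {H ε : ℝ} {M : Market n m}

/-- The number of descriptions of a block. -/
noncomputable def descriptions (n k : ℕ) (ε : ℝ) : ℕ :=
  (n ^ k + 1) ^ (blockLen k (accuracy ε) + 1)

/-- A bound on the number of iterations of each loop of the scheme. -/
noncomputable def iterations (n m k : ℕ) (H ε : ℝ) : ℕ :=
  if n ≤ 1 then m else
    descriptions n k ε * m + 3 * descriptions n k ε + m + ⌈Real.log H⌉₊ + 1

theorem scheme_spec (hM : M.Valid k H) (hε : 0 < ε) :
    Ends (iterations n m k H ε) scheme (inputMemory M k ε) fun s' =>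
      (∀ i, 0 ≤ outputPrices n s' i) ∧ ∀ q : Fin n → ℝ, (∀ i, 0 ≤ q i) →
        revenue M.val M.prob q ≤ (1 + ε) * revenue M.val M.prob (outputPrices n s') := by
  have hn0 := hM.card_pos
  have hk0 := hM.width_pos
  have hkn := hM.width_le
  have hcell : (inputMemory M k ε).nat 0 0 = n := by simp [inputMemory]
  refine Ends.ite (fun hb => ?_) fun hb => ?_
  · simp only [BExp.Holds, NExp.eval, hcell] at hb
    obtain rfl : n = 1 := by omega
    obtain rfl : k = 1 := by omega
    refine (singleItem_spec hM (by simp [iterations])).mono ?_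
    intro s1 _ ⟨h1, h2⟩
    have hpos : ∀ i, 0 ≤ outputPrices 1 s1 i := fun i => Subsingleton.elim 0 i ▸ h1
    refine ⟨hpos, fun q hq => (h2 q (hq 0)).trans ?_⟩
    have h3 : 0 ≤ revenue M.val M.prob (outputPrices 1 s1) := Finset.sum_nonneg fun j _ =>
      mul_nonneg (hM.prob_nonneg j) (payment_nonneg _ hpos)
    nlinarith
  · simp only [BExp.Holds, NExp.eval, hcell, not_le] at hb
    have hL := accuracy_ge ε
    have hm0 := hM.types_pos
    rw [iterations, if_neg (by omega)]
    obtain ⟨E, hE⟩ : ∃ E, descriptions n k ε = E := ⟨_, rfl⟩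
    rw [hE]
    rw [descriptions] at hE
    have hN2 : 2 ≤ n ^ k + 1 := by
      have : 1 ≤ n ^ k := Nat.one_le_pow _ _ hn0
      omega
    have hbE : blockLen k (accuracy ε) + 1 < E := by
      rw [← hE]
      exact Nat.lt_pow_self (by omega)
    have hNE : n ^ k + 1 ≤ E := by
      rw [← hE]
      exact Nat.le_self_pow (by omega) _
    have hnE : n ≤ n ^ k := Nat.le_self_pow (by omega) _
    have hEm : E ≤ E * m := Nat.le_mul_of_pos_right _ hm0
    have hKm : n ^ k * m ≤ E * m := Nat.mul_le_mul_right _ (by omega)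
    have hLk : accuracy ε * k + accuracy ε ≤ blockLen k (accuracy ε) := by
      have h1 : accuracy ε * k ≤ gap k (accuracy ε) := by
        unfold gap
        exact Nat.mul_le_mul_right _ (Nat.le_mul_of_pos_right _ (by omega))
      have h2 : accuracy ε ≤ gap k (accuracy ε) :=
        (Nat.le_mul_of_pos_right _ (by omega : 0 < accuracy ε)).trans (sq_le_gap hk0)
      have h3 : gap k (accuracy ε) + gap k (accuracy ε) ≤ blockLen k (accuracy ε) := by
        unfold blockLen zoneLen
        have : 0 < accuracy ε := by omega
        exact (Nat.le_mul_of_pos_right _ (by positivity)).trans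
          (Nat.le_mul_of_pos_right _ this)
      omega
    refine Ends.seq ((setup_spec hM hε (by omega) (by omega) (by omega) (by omega)
      (by omega)).mono ?_)
    intro s1 _ h1 _
    refine (processZones_spec hM hL (valueSum_nonneg hM ε) (val_le_valueSum hM ε) (by omega)
      (by omega) (by omega) (by omega) (by omega) (fun q hq => ?_) h1).mono ?_
    · have h2 := zone_count hM hL hq
      have h3 := Nat.le_ceil (Real.log H)
      have h4 : (q : ℝ) ≤
          ((accuracy ε + (n ^ k + m + ⌈Real.log H⌉₊ + accuracy ε * k) : ℕ) : ℝ) := by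
        push_cast
        linarith
      have h5 := Nat.cast_le.1 h4
      omega
    · intro s2 _ ⟨Q, hQ, h2⟩
      exact ⟨h2.inv.out_nonneg, fun q hq => h2.inv.approx hM hL (accuracy_mul_ge hε)
        (valueSum_nonneg hM ε) (val_le_valueSum hM ε) hQ hq⟩

/-- The exponent of the number of items in the bound on the running time. -/
noncomputable def exponent : MvPolynomial (Fin 2) ℝ :=
  (MvPolynomial.X 0 + 1) *
    (2 * MvPolynomial.X 0 * (19 + 18 * MvPolynomial.X 1) ^ 5 + 1)

theorem descriptions_le (hM : M.Valid k H) (hn : 2 ≤ n) (hε : 0 < ε) :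
    (descriptions n k ε : ℝ) ≤
      (n : ℝ) ^ (MvPolynomial.eval ![(k : ℝ), 1 / ε] exponent) := by
  have hk := hM.width_pos
  have h1 : n ^ k + 1 ≤ n ^ (k + 1) := by
    have : 1 ≤ n ^ k := Nat.one_le_pow _ _ (by omega)
    rw [pow_succ]
    nlinarith
  have h2 : descriptions n k ε ≤ n ^ ((k + 1) * (blockLen k (accuracy ε) + 1)) := by
    rw [pow_mul]
    exact Nat.pow_le_pow_left h1 _
  have h3 : (descriptions n k ε : ℝ) ≤
      (n : ℝ) ^ (((k + 1) * (blockLen k (accuracy ε) + 1) : ℕ) : ℝ) := by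
    rw [Real.rpow_natCast]
    exact_mod_cast h2
  refine h3.trans (Real.rpow_le_rpow_of_exponent_le (by exact_mod_cast (by omega : 1 ≤ n)) ?_)
  have h4 := accuracy_le hε
  have h5 : (blockLen k (accuracy ε) : ℝ) = 2 * k * (accuracy ε : ℝ) ^ 5 := by
    unfold blockLen zoneLen gap
    push_cast
    ring
  simp only [exponent, map_mul, map_add, MvPolynomial.eval_X, map_one, map_pow, map_ofNat,
    Matrix.cons_val_zero, Matrix.cons_val_one]
  push_cast
  rw [h5]
  gcongr

theorem iterations_le (hM : M.Valid k H) (hε : 0 < ε) :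
    (iterations n m k H ε : ℝ) + 1 ≤
      (n : ℝ) ^ (MvPolynomial.eval ![(k : ℝ), 1 / ε] exponent) * m +
        3 * (n : ℝ) ^ (MvPolynomial.eval ![(k : ℝ), 1 / ε] exponent) + m + Real.log H + 3 := by
  have hlog := Real.log_nonneg hM.one_le_bound
  unfold iterations
  split_ifs with hn
  · have : (0 : ℝ) ≤ (n : ℝ) ^ (MvPolynomial.eval ![(k : ℝ), 1 / ε] exponent) := by positivity
    have : 0 ≤ (n : ℝ) ^ (MvPolynomial.eval ![(k : ℝ), 1 / ε] exponent) * m := by positivity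
    linarith
  · have h1 := descriptions_le hM (by omega) hε
    have h2 := (Nat.ceil_lt_add_one hlog).le
    have h3 := mul_le_mul_of_nonneg_right h1 (Nat.cast_nonneg (α := ℝ) m)
    push_cast
    linarith

end Scheme

end OrderedPricing

theorem mainTheorem2 :
    ∃ (P : OrderedPricing.Prog) (A : MvPolynomial (Fin 3) ℝ) (B : MvPolynomial (Fin 2) ℝ),
      ∀ (n m k : ℕ) (M : OrderedPricing.Market n m) (H ε : ℝ), M.Valid k H → 0 < ε →
        ∃ (s : OrderedPricing.Memory) (t : ℕ),
          OrderedPricing.Runs P (OrderedPricing.inputMemory M k ε) s t ∧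
          (t : ℝ) ≤ MvPolynomial.eval
            ![(m : ℝ), (n : ℝ) ^ (MvPolynomial.eval ![(k : ℝ), 1 / ε] B), Real.log H] A ∧
          (∀ i, 0 ≤ OrderedPricing.outputPrices n s i) ∧
          ∀ q : Fin n → ℝ, (∀ i, 0 ≤ q i) →
            OrderedPricing.revenue M.val M.prob q ≤
              (1 + ε) * OrderedPricing.revenue M.val M.prob (OrderedPricing.outputPrices n s) := by
  obtain ⟨C, d, hC⟩ := OrderedPricing.scheme.bound_le_poly
  refine ⟨OrderedPricing.scheme, MvPolynomial.C (C : ℝ) * (MvPolynomial.X 1 * MvPolynomial.X 0 +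
    3 * MvPolynomial.X 1 + MvPolynomial.X 0 + MvPolynomial.X 2 + 3) ^ d, OrderedPricing.exponent,
    fun n m k M H ε hM hε => ?_⟩
  obtain ⟨s, t, hrun, ht, -, hpos, hopt⟩ := OrderedPricing.scheme_spec hM hε
  refine ⟨s, t, hrun, ?_, hpos, hopt⟩
  have h1 : (t : ℝ) ≤ C * ((OrderedPricing.iterations n m k H ε : ℝ) + 1) ^ d := by
    exact_mod_cast ht.trans (hC _)
  refine h1.trans ?_
  simp only [map_mul, map_pow, map_add, MvPolynomial.eval_C, MvPolynomial.eval_X, map_ofNat,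
    Matrix.cons_val_zero, Matrix.cons_val_one, Matrix.cons_val]
  exact mul_le_mul_of_nonneg_left
    (pow_le_pow_left₀ (by positivity) (OrderedPricing.iterations_le hM hε) d) (by positivity)
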